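/- Let $n,m\in\mathbb R$, $\mathcal B>0$, and put $q=m-n+1$. Consider the power law thin film equation $$h_t=-(h^n h_{xxx})_x-\mathcal B\,(h^m h_x)_x .$$ A \emph{zero contact angle droplet steady state} of length $\hat X>0$ is a function $\hat h:\mathbb R\to[0,\infty)$ that is, for some interval $(a,b)$ with $b-a=\hat X$, positive on $(a,b)$ and zero elsewhere, $C^1$ on $[a,b]$ with one-sided derivatives $\hat h'(a)=\hat h'(b)=0$, and of class $C^4$ on $(a,b)$ with $(\hat h^n\hat h''')'+\mathcal B(\hat h^m\hat h')'=0$ there; its area is $\int_a^b\hat h\,dx$. For $X>0$ the energy is $$\mathcal E(\ell)=\int_0^X\Big[\tfrac12(\ell')^2-H(\ell)\Big]dx,$$ where $H$ is any function that is continuous on $[0,\infty)$ and $C^2$ on $(0,\infty)$ with $H''(y)=\mathcal B y^{q-1}$ for $y>0$. Here a droplet of length less than $X$ is translated so that its support lies in $[0,X]$. For $0<\alpha<1$ let $k_\alpha$ be the unique positive solution on $\mathbb R$ of $k''+\frac{k^q-1}{q}=0$ (of $k''+\log k=0$ if $q=0$) with $k(0)=\alpha$, $k'(0)=0$; when $q>-1$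 it is periodic. Let $P(\alpha)$ be its least period, $A(\alpha)=\int_0^{P(\alpha)}k_\alpha\,dx$, and $E(\alpha)=P(\alpha)^{3-q}A(\alpha)^{q-1}$. \textbf{Theorem.} Let $h_{\rm ss}\in C^4(\mathbb R)$ be a non-constant positive periodic steady state of the power law equation, with least period $X$ and area $A_{\rm ss}=\int_0^X h_{\rm ss}\,dx$. Suppose that $-1<q<1$, or $2\le q<3$, or that $1<q<2$ and $E'(\alpha)>0$ for all $\alpha\in(0,1)$. Then there exists a zero contact angle droplet steady state $\hat h_{\rm ss}$ of the same equation with length $\hat X<X$ and area $A_{\rm ss}$, and it satisfies $\mathcal E(\hat h_{\rm ss})<\mathcal E(h_{\rm ss})$ for every such choice of $H$. -/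

import Mathlib

open Set MeasureTheory

noncomputable section

namespace ThinFilm

/-- The right-hand side `-(f(h) h_xxx)_x - (g(h) h_x)_x` of the thin film evolution equation
`h_t = -(f(h) h_xxx)_x - (g(h) h_x)_x`, for a time-independent profile `h`. -/
def evolutionRHS (f g h : ℝ → ℝ) (x : ℝ) : ℝ :=
  -deriv (fun y => f (h y) * iteratedDeriv 3 h y) x - deriv (fun y => g (h y) * deriv h y) x

/-- The coefficient `f(y) = y ^ n` (with a real exponent), used for `y > 0`. -/
def powF (n : ℝ) (y : ℝ) : ℝ := y ^ n

/-- The coefficient `g(y) = B y ^ m` (with a real exponent), used for `y > 0`. -/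
def powG (B m : ℝ) (y : ℝ) : ℝ := B * y ^ m

/-- `X` is the least period of `h`. -/
def IsLeastPeriod (h : ℝ → ℝ) (X : ℝ) : Prop :=
  IsLeast {T : ℝ | 0 < T ∧ Function.Periodic h T} X

/-- `h ∈ C⁴(ℝ)` is a non-constant positive periodic classical steady state with
least period `X`. -/
structure IsPositivePeriodicSteadyState (f g h : ℝ → ℝ) (X : ℝ) : Prop where
  contDiff : ContDiff ℝ 4 h
  pos : ∀ x, 0 < h x
  nonconstant : ∃ x y, h x ≠ h y
  leastPeriod : IsLeastPeriod h X
  steady : ∀ x, evolutionRHS f g h x = 0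

/-- `h` is a droplet steady state: positive on `(a, b)`, zero elsewhere, `C¹` on `[a, b]`,
satisfying the steady state equation classically on `(a, b)`, with equal contact angles
`0 ≤ h'(a) = -h'(b)` (one-sided derivatives). -/
structure IsDropletSteadyState (f g h : ℝ → ℝ) (a b : ℝ) : Prop where
  lt : a < b
  pos : ∀ x ∈ Ioo a b, 0 < h x
  zero : ∀ x, x ∉ Ioo a b → h x = 0
  contDiffOn_Icc : ContDiffOn ℝ 1 h (Icc a b)
  contDiffOn_Ioo : ContDiffOn ℝ 4 h (Ioo a b)
  steady : ∀ x ∈ Ioo a b, evolutionRHS f g h x = 0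
  angle_nonneg : 0 ≤ derivWithin h (Icc a b) a
  angle_eq : derivWithin h (Icc a b) a = -derivWithin h (Icc a b) b

/-- A droplet steady state with zero contact angle. -/
structure IsZeroAngleDroplet (f g h : ℝ → ℝ) (a b : ℝ) : Prop
    extends IsDropletSteadyState f g h a b where
  angle_zero : derivWithin h (Icc a b) a = 0

/-- `H` is an admissible potential for the energy: `H'' = g / f` on `(0, ∞)`, and `H` extends
continuously to `0`, so that it can be evaluated on droplets. Any two such `H` differ by an
affine function. -/
structure IsEnergyPotential (f g H : ℝ → ℝ) : Prop where
  continuousOn : ContinuousOn H (Ici 0)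
  contDiffOn : ContDiffOn ℝ 2 H (Ioi 0)
  deriv_deriv : ∀ y, 0 < y → deriv (deriv H) y = g y / f y

/-- The energy `∫_0^X [ (ℓ')² / 2 - H(ℓ) ] dx`. -/
def energy (H : ℝ → ℝ) (X : ℝ) (l : ℝ → ℝ) : ℝ :=
  ∫ x in (0 : ℝ)..X, ((1 / 2) * deriv l x ^ 2 - H (l x))

/-- The force of the canonical oscillator: `(y ^ q - 1) / q` for `q ≠ 0`, `log y` for `q = 0`. -/
def canonicalForce (q y : ℝ) : ℝ :=
  if q = 0 then Real.log y else (y ^ q - 1) / q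

/-- `k` is a positive solution on `ℝ` of `k'' + (k ^ q - 1) / q = 0` (`k'' + log k = 0` if
`q = 0`) with `k(0) = α`, `k'(0) = 0`. For `0 < α < 1` the solution is unique, and it is
smooth and periodic with minimum value `α`. -/
structure IsCanonicalSolution (q α : ℝ) (k : ℝ → ℝ) : Prop where
  contDiff : ContDiff ℝ 2 k
  pos : ∀ x, 0 < k x
  ode : ∀ x, deriv (deriv k) x + canonicalForce q (k x) = 0
  init : k 0 = α
  init_deriv : deriv k 0 = 0

/-- The canonical solution `k_α`. -/
def kSol (q α : ℝ) : ℝ → ℝ :=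
  Classical.epsilon (IsCanonicalSolution q α)

/-- The least period `P(α)` of `k_α`. -/
def P (q α : ℝ) : ℝ :=
  sInf {T : ℝ | 0 < T ∧ Function.Periodic (kSol q α) T}

/-- The area `A(α)` under the graph of `k_α` over one period. -/
def A (q α : ℝ) : ℝ :=
  ∫ x in (0 : ℝ)..(P q α), kSol q α x

/-- `E(α) = P(α) ^ (3 - q) * A(α) ^ (q - 1)`. -/
def E (q α : ℝ) : ℝ :=
  P q α ^ (3 - q) * A q α ^ (q - 1)

end ThinFilm

end

open Set MeasureTheory Filter Topology

namespace ThinFilm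

/-! ### The canonical force and its potential well -/

/-! Integrated twice, the equation for positive periodic steady states becomes, after rescaling, one
conservative oscillator `k'' + R(k) = 0` with `R = canonicalForce q`, moving in the well `U = well
q` whose bottom is at height 1. Its orbits are labelled by an amplitude `w`, with total energy `v² /
2 + U = w²`. For `0 < w < maxAmp q` the orbit is positive and periodic. At `w = maxAmp q` the total
energy equals `U(0)`: the orbit reaches height 0 with zero velocity, and one turn of it is a zero
contact angle droplet. The theorem therefore compares an interior orbit with the separatrix orbit of
the same family, at equal area.

The profile `λ k(μ x)` fits the equation when `μ² = B λ^(q-1)`, and for `q < 3` the prescribed area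
determines `λ`. Write `P`, `A`, `J` for the period, area and action of the unscaled orbit. At fixed
area the length is a constant times `P A^((q-1)/(3-q))`, that is, a power of the quantity `E`. The
virial identity `area_eq` and `dJ/dw = 2 w P` (`hasDerivAt_action`) show that the `w`-derivative of
the energy is a positive factor times the same slope (`hasDerivAt_scaledEnergy`), because `level q w
< 0`. Hence length and energy both strictly decrease up to the separatrix once `(3 - q) P' A + (q -
1) A' P < 0` (`slope_neg`). The affine freedom in `H` is harmless: its linear part sees only the
common area, and its constant part only the common interval length.

For the slope, the coordinate `y = profile q (w sin θ)` with `U(y) = (w sin θ)²` turns `w P'` and `w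
A'` into time integrals of explicit functions of the height, built from `relDefect`. Pointwise
inequalities for these functions suffice, since the force has zero time integral over a turn. For `q
≤ 0` monotonicity of `relDefect` gives a Chebyshev correlation inequality; for `0 < q < 1` one gets
`P' ≤ 0`, from which the sign follows by the virial identity; for `2 ≤ q < 3` a combined pointwise
bound treats the remaining case `P' > 0`; for `1 < q < 2` the sign is the hypothesis on `E`,
transported by the chain rule. -/

lemma rpow_eq_one_add_force (q y : ℝ) :
    y ^ q = 1 + q * canonicalForce q y := by
  unfold canonicalForce
  split_ifs with h
  · simp [h]
  · field_simp
    ring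

lemma hasDerivAt_canonicalForce (q : ℝ) {y : ℝ} (hy : 0 < y) :
    HasDerivAt (canonicalForce q) (y ^ (q - 1)) y := by
  by_cases h : q = 0
  · subst h
    have h1 : canonicalForce 0 = Real.log := by
      funext t; simp [canonicalForce]
    rw [h1, zero_sub, Real.rpow_neg_one]
    exact Real.hasDerivAt_log hy.ne'
  · have h1 : canonicalForce q = fun t => (t ^ q - 1) / q := by
      funext t; simp [canonicalForce, h]
    rw [h1]
    have := ((Real.hasDerivAt_rpow_const (p := q) (Or.inl hy.ne')).sub_const 1).div_const q
    refine this.congr_deriv ?_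
    field_simp

lemma canonicalForce_one (q : ℝ) : canonicalForce q 1 = 0 := by
  unfold canonicalForce; split_ifs <;> simp

lemma continuousOn_canonicalForce (q : ℝ) : ContinuousOn (canonicalForce q) (Ioi 0) :=
  fun _ hy => (hasDerivAt_canonicalForce q hy).continuousAt.continuousWithinAt

lemma strictMonoOn_canonicalForce (q : ℝ) : StrictMonoOn (canonicalForce q) (Ioi 0) := by
  apply strictMonoOn_of_deriv_pos (convex_Ioi 0) (continuousOn_canonicalForce q)
  intro y hy
  rw [interior_Ioi] at hy
  rw [(hasDerivAt_canonicalForce q hy).deriv]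
  exact Real.rpow_pos_of_pos hy _

lemma canonicalForce_pos {q y : ℝ} (hy : 1 < y) : 0 < canonicalForce q y := by
  have := strictMonoOn_canonicalForce q (mem_Ioi.2 one_pos) (mem_Ioi.2 (one_pos.trans hy)) hy
  rwa [canonicalForce_one] at this

lemma canonicalForce_neg {q y : ℝ} (h0 : 0 < y) (hy : y < 1) : canonicalForce q y < 0 := by
  have := strictMonoOn_canonicalForce q (mem_Ioi.2 h0) (mem_Ioi.2 one_pos) hy
  rwa [canonicalForce_one] at this

lemma canonicalForce_ne_zero {q y : ℝ} (h0 : 0 < y) (hy : y ≠ 1) : canonicalForce q y ≠ 0 := by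
  rcases lt_or_gt_of_ne hy with h | h
  · exact (canonicalForce_neg h0 h).ne
  · exact (canonicalForce_pos h).ne'

lemma canonicalForce_mul (q : ℝ) {c y : ℝ} (hc : 0 < c) (hy : 0 < y) :
    canonicalForce q (c * y) = c ^ q * canonicalForce q y + canonicalForce q c := by
  unfold canonicalForce
  split_ifs with h
  · rw [Real.log_mul hc.ne' hy.ne', h, Real.rpow_zero]; ring
  · rw [Real.mul_rpow hc.le hy.le]; field_simp; ring

lemma measurable_canonicalForce (q : ℝ) : Measurable (canonicalForce q) := by
  unfold canonicalForce
  split_ifs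
  · exact Real.measurable_log
  · fun_prop

/-- Trades the stiffness `y^(q-1)` for `y` and the force. This keeps the later identities polynomial
and treats `q = 0` together with the other exponents. -/
lemma mul_rpow_sub_one (q : ℝ) {y : ℝ} (hy : 0 < y) :
    y * y ^ (q - 1) = 1 + q * canonicalForce q y := by
  rw [← rpow_eq_one_add_force q y, Real.rpow_sub_one hy.ne']
  field_simp

/-- The potential well: the antiderivative of the canonical force that vanishes at its
bottom `y = 1`. -/
noncomputable def well (q y : ℝ) : ℝ := (y * (canonicalForce q y - 1) + 1) / (q + 1)

lemma well_one (q : ℝ) : well q 1 = 0 := by simp [well, canonicalForce_one]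

lemma well_zero (q : ℝ) : well q 0 = 1 / (q + 1) := by simp [well]

lemma well_mul {q : ℝ} (hq : -1 < q) (y : ℝ) :
    (q + 1) * well q y = y * (canonicalForce q y - 1) + 1 := by
  have : q + 1 ≠ 0 := by linarith
  unfold well; field_simp

lemma hasDerivAt_well {q y : ℝ} (hq : -1 < q) (hy : 0 < y) :
    HasDerivAt (well q) (canonicalForce q y) y := by
  have h1 := (((hasDerivAt_id y).mul ((hasDerivAt_canonicalForce q hy).sub_const 1)).add_const
    1).div_const (q + 1)
  refine h1.congr_deriv ?_
  have h2 := mul_rpow_sub_one q hy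
  have : q + 1 ≠ 0 := by linarith
  simp only [id]
  rw [h2]; field_simp; ring

lemma continuousOn_well {q : ℝ} (hq : -1 < q) : ContinuousOn (well q) (Ici 0) := by
  have h1 : ContinuousOn (fun y => y * canonicalForce q y) (Ici 0) := by
    by_cases h : q = 0
    · have : (fun y => y * canonicalForce q y) = fun y => y * Real.log y := by
        funext y; simp [canonicalForce, h]
      rw [this]
      exact Real.continuous_mul_log.continuousOn
    · have h2 : ContinuousOn (fun y : ℝ => (y ^ (q + 1) - y) / q) (Ici 0) := by
        have : Continuous (fun y : ℝ => y ^ (q + 1)) :=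
          Real.continuous_rpow_const (by linarith)
        fun_prop
      refine h2.congr fun y hy => ?_
      rcases eq_or_lt_of_le (show (0 : ℝ) ≤ y from hy) with h3 | h3
      · subst h3
        simp [Real.zero_rpow (show q + 1 ≠ 0 by linarith)]
      · simp only [canonicalForce, h, if_false]
        rw [Real.rpow_add_one h3.ne']
        field_simp
  have h3 : ContinuousOn (fun y => (y * canonicalForce q y - y + 1) / (q + 1)) (Ici 0) :=
    ((h1.sub continuousOn_id).add continuousOn_const).div_const _
  refine h3.congr fun y _ => ?_
  simp only [well]; ring

lemma strictAntiOn_well {q : ℝ} (hq : -1 < q) : StrictAntiOn (well q) (Icc 0 1) := by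
  apply strictAntiOn_of_deriv_neg (convex_Icc 0 1)
    ((continuousOn_well hq).mono fun y hy => hy.1)
  intro y hy
  rw [interior_Icc] at hy
  rw [(hasDerivAt_well hq hy.1).deriv]
  exact canonicalForce_neg hy.1 hy.2

lemma strictMonoOn_well {q : ℝ} (hq : -1 < q) : StrictMonoOn (well q) (Ici 1) := by
  apply strictMonoOn_of_deriv_pos (convex_Ici 1)
    ((continuousOn_well hq).mono fun y hy => mem_Ici.2 (zero_le_one.trans (mem_Ici.1 hy)))
  intro y hy
  rw [interior_Ici] at hy
  rw [(hasDerivAt_well hq (one_pos.trans hy)).deriv]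
  exact canonicalForce_pos hy

lemma well_pos {q y : ℝ} (hq : -1 < q) (h0 : 0 ≤ y) (hy : y ≠ 1) : 0 < well q y := by
  rw [← well_one q]
  rcases lt_or_gt_of_ne hy with h | h
  · exact strictAntiOn_well hq ⟨h0, h.le⟩ ⟨zero_le_one, le_rfl⟩ h
  · exact strictMonoOn_well hq (mem_Ici.2 le_rfl) (mem_Ici.2 h.le) h

lemma well_nonneg {q y : ℝ} (hq : -1 < q) (h0 : 0 ≤ y) : 0 ≤ well q y := by
  by_cases h : y = 1
  · rw [h, well_one]
  · exact (well_pos hq h0 h).le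

/-- Convexity of the well: it lies above its tangent at 2, whose constant term is nonnegative. The
linear growth makes the square-root coordinate unbounded above. -/
lemma well_linear_bound {q y : ℝ} (hq : -1 < q) (hy : 2 ≤ y) :
    canonicalForce q 2 * (y - 2) ≤ well q y := by
  have h1 : MonotoneOn (fun y => well q y - canonicalForce q 2 * (y - 2)) (Ici 2) := by
    have hd : ∀ y : ℝ, 0 < y → HasDerivAt (fun y => well q y - canonicalForce q 2 * (y - 2))
        (canonicalForce q y - canonicalForce q 2) y := by
      intro y hy
      have := (hasDerivAt_well hq hy).sub
        (((hasDerivAt_id y).sub_const 2).const_mul (canonicalForce q 2))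
      exact this.congr_deriv (by simp)
    apply monotoneOn_of_deriv_nonneg (convex_Ici 2)
    · intro y hy
      exact (hd y (lt_of_lt_of_le two_pos hy)).continuousAt.continuousWithinAt
    · intro y hy
      rw [interior_Ici] at hy
      exact (hd y (two_pos.trans hy)).differentiableAt.differentiableWithinAt
    · intro y hy
      rw [interior_Ici] at hy
      rw [(hd y (two_pos.trans hy)).deriv]
      have := (strictMonoOn_canonicalForce q).monotoneOn (mem_Ioi.2 two_pos)
        (mem_Ioi.2 (two_pos.trans hy)) (le_of_lt hy)
      linarith
  have h2 := h1 (mem_Ici.2 le_rfl) (mem_Ici.2 hy) hy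
  have h3 := well_nonneg hq (zero_le_two)
  simp only [sub_self, mul_zero, sub_zero] at h2
  linarith

/-! ### The square-root coordinate of the well -/

/-- The amplitude of the separatrix of the well, which reaches `y = 0`. -/
noncomputable def maxAmp (q : ℝ) : ℝ := √(1 / (q + 1))

lemma maxAmp_pos {q : ℝ} (hq : -1 < q) : 0 < maxAmp q :=
  Real.sqrt_pos.2 (one_div_pos.2 (by linarith))

lemma maxAmp_sq {q : ℝ} (hq : -1 < q) : maxAmp q ^ 2 = 1 / (q + 1) :=
  Real.sq_sqrt (one_div_pos.2 (by linarith)).le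

/-- The signed square root of the well, increasing on `[0, ∞)`, extended linearly to `y < 0`. -/
noncomputable def signedRoot (q y : ℝ) : ℝ :=
  if y ≤ 1 then -√(well q (max y 0)) + min y 0 else √(well q (max y 0))

lemma signedRoot_of_le {q y : ℝ} (h0 : 0 ≤ y) (h1 : y ≤ 1) : signedRoot q y = -√(well q y) := by
  simp [signedRoot, h0, h1]

lemma signedRoot_of_ge {q y : ℝ} (h1 : 1 ≤ y) : signedRoot q y = √(well q y) := by
  rcases eq_or_lt_of_le h1 with h | h
  · rw [← h, signedRoot_of_le zero_le_one le_rfl, well_one]; simp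
  · simp [signedRoot, not_le.2 h, (zero_le_one.trans h1)]

lemma signedRoot_sq {q y : ℝ} (hq : -1 < q) (h0 : 0 ≤ y) : signedRoot q y ^ 2 = well q y := by
  rcases le_total y 1 with h | h
  · rw [signedRoot_of_le h0 h, neg_sq, Real.sq_sqrt (well_nonneg hq h0)]
  · rw [signedRoot_of_ge h, Real.sq_sqrt (well_nonneg hq h0)]

lemma signedRoot_zero (q : ℝ) : signedRoot q 0 = -maxAmp q := by
  rw [signedRoot_of_le le_rfl zero_le_one, well_zero, maxAmp]

lemma signedRoot_one (q : ℝ) : signedRoot q 1 = 0 := by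
  rw [signedRoot_of_ge le_rfl, well_one, Real.sqrt_zero]

lemma strictMono_signedRoot {q : ℝ} (hq : -1 < q) : StrictMono (signedRoot q) := by
  intro a b hab
  rcases le_or_gt b 1 with hb | hb
  · have ha : a ≤ 1 := hab.le.trans hb
    simp only [signedRoot, hb, ha, if_true]
    rcases le_or_gt b 0 with hb0 | hb0
    · rw [max_eq_right hb0, max_eq_right (hab.le.trans hb0), min_eq_left hb0,
        min_eq_left (hab.le.trans hb0)]
      linarith
    · have h1 : max a 0 < b := max_lt hab hb0
      have h2 := strictAntiOn_well hq ⟨le_max_right a 0, h1.le.trans hb⟩ ⟨hb0.le, hb⟩ h1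
      have h3 := Real.sqrt_lt_sqrt (well_nonneg hq hb0.le) h2
      rw [max_eq_left hb0.le, min_eq_right hb0.le]
      have := min_le_right a 0
      linarith
  · rw [signedRoot_of_ge hb.le]
    have h1 := well_pos hq (zero_le_one.trans hb.le) hb.ne'
    rcases le_or_gt a 1 with ha | ha
    · simp only [signedRoot, ha, if_true]
      have := Real.sqrt_pos.2 h1
      have := Real.sqrt_nonneg (well q (max a 0))
      have := min_le_right a 0
      linarith
    · rw [signedRoot_of_ge ha.le]
      exact Real.sqrt_lt_sqrt (well_nonneg hq (zero_le_one.trans ha.le))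
        (strictMonoOn_well hq (mem_Ici.2 ha.le) (mem_Ici.2 hb.le) hab)

lemma continuous_signedRoot {q : ℝ} (hq : -1 < q) : Continuous (signedRoot q) := by
  have h1 : Continuous fun y : ℝ => well q (max y 0) :=
    (continuousOn_well hq).comp_continuous (by fun_prop) fun y => mem_Ici.2 (le_max_right _ _)
  unfold signedRoot
  refine Continuous.if_le (by fun_prop) (by fun_prop) continuous_id continuous_const ?_
  intro y hy
  subst hy
  simp [well_one]

/-- The linear extension to negative heights supplies the limit at `-∞`. With it `signedRoot` is a
bijection of the line, so its inverse is total and continuous by monotonicity alone. -/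
lemma surjective_signedRoot {q : ℝ} (hq : -1 < q) : Function.Surjective (signedRoot q) := by
  apply (continuous_signedRoot hq).surjective
  · have h1 : Tendsto (fun y => canonicalForce q 2 * (y - 2)) atTop atTop :=
      (tendsto_atTop_add_const_right _ (-2) tendsto_id).const_mul_atTop
        (canonicalForce_pos one_lt_two)
    refine tendsto_atTop_mono' _ ?_ (Real.tendsto_sqrt_atTop.comp h1)
    filter_upwards [eventually_ge_atTop 2] with y hy
    rw [signedRoot_of_ge (by linarith)]
    exact Real.sqrt_le_sqrt (well_linear_bound hq hy)
  · refine tendsto_atBot_mono' _ ?_ tendsto_id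
    filter_upwards [eventually_le_atBot 0] with y hy
    simp only [signedRoot, hy.trans zero_le_one, if_true, min_eq_left hy, id]
    have := Real.sqrt_nonneg (well q (max y 0))
    linarith

/-- The inverse of `signedRoot`: the height as a function of the square-root coordinate. -/
noncomputable def profile (q : ℝ) : ℝ → ℝ := Function.invFun (signedRoot q)

lemma signedRoot_profile {q : ℝ} (hq : -1 < q) (z : ℝ) : signedRoot q (profile q z) = z :=
  Function.rightInverse_invFun (surjective_signedRoot hq) z

lemma profile_signedRoot {q : ℝ} (hq : -1 < q) (y : ℝ) : profile q (signedRoot q y) = y :=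
  Function.leftInverse_invFun (strictMono_signedRoot hq).injective y

lemma strictMono_profile {q : ℝ} (hq : -1 < q) : StrictMono (profile q) := by
  intro a b hab
  rwa [← (strictMono_signedRoot hq).lt_iff_lt, signedRoot_profile hq, signedRoot_profile hq]

lemma continuous_profile {q : ℝ} (hq : -1 < q) : Continuous (profile q) :=
  (strictMono_profile hq).monotone.continuous_of_surjective
    fun y => ⟨_, profile_signedRoot hq y⟩

lemma profile_zero {q : ℝ} (hq : -1 < q) : profile q 0 = 1 := by
  rw [← signedRoot_one q, profile_signedRoot hq]

lemma profile_neg_maxAmp {q : ℝ} (hq : -1 < q) : profile q (-maxAmp q) = 0 := by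
  rw [← signedRoot_zero q, profile_signedRoot hq]

lemma profile_pos {q z : ℝ} (hq : -1 < q) (hz : -maxAmp q < z) : 0 < profile q z := by
  rw [← profile_neg_maxAmp hq]; exact strictMono_profile hq hz

lemma profile_nonneg {q z : ℝ} (hq : -1 < q) (hz : -maxAmp q ≤ z) : 0 ≤ profile q z := by
  rw [← profile_neg_maxAmp hq]; exact (strictMono_profile hq).monotone hz

lemma profile_ne_one {q z : ℝ} (hq : -1 < q) (hz : z ≠ 0) : profile q z ≠ 1 := by
  rw [← profile_zero hq]; exact (strictMono_profile hq).injective.ne hz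

lemma well_profile {q z : ℝ} (hq : -1 < q) (hz : -maxAmp q ≤ z) :
    well q (profile q z) = z ^ 2 := by
  rw [← signedRoot_sq hq (profile_nonneg hq hz), signedRoot_profile hq]

lemma hasDerivAt_signedRoot {q y : ℝ} (hq : -1 < q) (hy : 0 < y) (h1 : y ≠ 1) :
    HasDerivAt (signedRoot q) (canonicalForce q y / (2 * signedRoot q y)) y := by
  have hw := well_pos hq hy.le h1
  have h2 := (hasDerivAt_well hq hy).sqrt hw.ne'
  rcases lt_or_gt_of_ne h1 with h | h
  · rw [signedRoot_of_le hy.le h.le]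
    have h3 := h2.neg
    refine (h3.congr_of_eventuallyEq ?_).congr_deriv ?_
    · filter_upwards [Ioo_mem_nhds hy h] with t ht
      rw [signedRoot_of_le ht.1.le ht.2.le]; rfl
    · have := (Real.sqrt_pos.2 hw).ne'
      field_simp
  · rw [signedRoot_of_ge h.le]
    refine h2.congr_of_eventuallyEq ?_
    filter_upwards [Ioi_mem_nhds h] with t ht
    rw [signedRoot_of_ge (le_of_lt ht)]

/-- The derivative of `profile` to the right of `-maxAmp q`. -/
noncomputable def profileDeriv (q z : ℝ) : ℝ :=
  if z ≤ -maxAmp q then 1 else if z = 0 then √2 else 2 * z / canonicalForce q (profile q z)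

lemma profileDeriv_of_ne {q z : ℝ} (hz : -maxAmp q < z) (h0 : z ≠ 0) :
    profileDeriv q z = 2 * z / canonicalForce q (profile q z) := by
  simp [profileDeriv, not_le.2 hz, h0]

lemma profileDeriv_zero {q : ℝ} (hq : -1 < q) : profileDeriv q 0 = √2 := by
  simp [profileDeriv, maxAmp_pos hq]

lemma profileDeriv_mul_force {q z : ℝ} (hq : -1 < q) (hz : -maxAmp q < z) :
    profileDeriv q z * canonicalForce q (profile q z) = 2 * z := by
  by_cases h0 : z = 0
  · rw [h0, profile_zero hq, canonicalForce_one]; simp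
  · rw [profileDeriv_of_ne hz h0]
    exact div_mul_cancel₀ _ (canonicalForce_ne_zero (profile_pos hq hz) (profile_ne_one hq h0))

/-- The value 1 at and below `-maxAmp q` makes the time element positive at every phase, also at
touchdown; strictly below, it is the slope of the linear extension. -/
lemma profileDeriv_pos {q : ℝ} (hq : -1 < q) (z : ℝ) : 0 < profileDeriv q z := by
  unfold profileDeriv
  split_ifs with h1 h2
  · exact one_pos
  · positivity
  · push Not at h1
    have hp := profile_pos hq h1
    rcases lt_or_gt_of_ne h2 with h | h
    · have : profile q z < 1 := by rw [← profile_zero hq]; exact strictMono_profile hq h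
      exact div_pos_of_neg_of_neg (by linarith) (canonicalForce_neg hp this)
    · have : 1 < profile q z := by rw [← profile_zero hq]; exact strictMono_profile hq h
      exact div_pos (by linarith) (canonicalForce_pos this)

lemma measurable_profileDeriv {q : ℝ} (hq : -1 < q) : Measurable (profileDeriv q) := by
  unfold profileDeriv
  refine Measurable.ite measurableSet_Iic measurable_const
    (Measurable.ite (measurableSet_singleton 0) measurable_const ?_)
  exact (measurable_const.mul measurable_id).div
    ((measurable_canonicalForce q).comp (continuous_profile hq).measurable)

/-! ### Smoothness of the height at the bottom of the well -/

lemma tendsto_profile_punctured {q : ℝ} (hq : -1 < q) :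
    Tendsto (profile q) (𝓝[≠] 0) (𝓝[≠] 1) := by
  refine tendsto_nhdsWithin_iff.2 ⟨?_, ?_⟩
  · have := (continuous_profile hq).tendsto 0
    rw [profile_zero hq] at this
    exact this.mono_left nhdsWithin_le_nhds
  · filter_upwards [self_mem_nhdsWithin] with z hz using profile_ne_one hq hz

/-- By l'Hôpital: the quotient of derivatives is `1 / (2 y^(q-1))`. The limit gives the slope of
`profile` at the bottom of the well. -/
lemma tendsto_well_div_force_sq {q : ℝ} (hq : -1 < q) :
    Tendsto (fun y => well q y / canonicalForce q y ^ 2) (𝓝[≠] 1) (𝓝 (1 / 2)) := by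
  have hpos : ∀ᶠ y : ℝ in 𝓝[≠] 1, 0 < y := nhdsWithin_le_nhds (Ioi_mem_nhds one_pos)
  have hne : ∀ᶠ y : ℝ in 𝓝[≠] 1, y ≠ 1 := self_mem_nhdsWithin
  refine HasDerivAt.lhopital_zero_nhdsNE (f' := fun y => canonicalForce q y)
    (g' := fun y => 2 * canonicalForce q y * y ^ (q - 1)) ?_ ?_ ?_ ?_ ?_ ?_
  · filter_upwards [hpos] with y hy using hasDerivAt_well hq hy
  · filter_upwards [hpos] with y hy
    exact ((hasDerivAt_canonicalForce q hy).pow 2).congr_deriv (by simp)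
  · filter_upwards [hpos, hne] with y hy h1
    have := canonicalForce_ne_zero (q := q) hy h1
    have := (Real.rpow_pos_of_pos hy (q - 1)).ne'
    positivity
  · have := (hasDerivAt_well hq one_pos).continuousAt.tendsto
    rw [well_one] at this
    exact this.mono_left nhdsWithin_le_nhds
  · have := (hasDerivAt_canonicalForce q one_pos).continuousAt.tendsto.pow 2
    rw [canonicalForce_one, zero_pow (by norm_num)] at this
    exact this.mono_left nhdsWithin_le_nhds
  · have h1 : ContinuousAt (fun y : ℝ => 1 / (2 * y ^ (q - 1))) 1 := by
      have : ContinuousAt (fun y : ℝ => y ^ (q - 1)) 1 :=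
        Real.continuousAt_rpow_const _ _ (Or.inl one_ne_zero)
      refine continuousAt_const.div (continuousAt_const.mul this) (by simp)
    have h2 := h1.tendsto
    simp only [Real.one_rpow, mul_one] at h2
    refine (h2.mono_left nhdsWithin_le_nhds).congr' ?_
    filter_upwards [hpos, hne] with y hy h1
    have := canonicalForce_ne_zero (q := q) hy h1
    have := (Real.rpow_pos_of_pos hy (q - 1)).ne'
    field_simp

/-- The defect `R² - 2 U S` of the well `U` with force `R` and stiffness `S`, which vanishes for a
quadratic well. -/
noncomputable def defect (q y : ℝ) : ℝ :=
  canonicalForce q y ^ 2 - 2 * well q y * y ^ (q - 1)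

lemma defect_one (q : ℝ) : defect q 1 = 0 := by simp [defect, canonicalForce_one, well_one]

lemma hasDerivAt_rpow_sub_one (q : ℝ) {y : ℝ} (hy : 0 < y) :
    HasDerivAt (fun y : ℝ => y ^ (q - 1)) ((q - 1) * y ^ (q - 2)) y := by
  have := Real.hasDerivAt_rpow_const (x := y) (p := q - 1) (Or.inl hy.ne')
  rwa [show q - 1 - 1 = q - 2 by ring] at this

lemma hasDerivAt_defect {q y : ℝ} (hq : -1 < q) (hy : 0 < y) :
    HasDerivAt (defect q) ((1 - q) * (2 * well q y) * y ^ (q - 2)) y := by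
  have h1 := (hasDerivAt_canonicalForce q hy).pow 2
  have h2 := ((hasDerivAt_well hq hy).const_mul 2).mul (hasDerivAt_rpow_sub_one q hy)
  refine (h1.sub h2).congr_deriv ?_
  simp; ring

/-- By l'Hôpital, reduced to the preceding limit: the quotient of derivatives is `(2 (1 - q) / 3)
y⁻¹` times `U / R²`. The limit is half the second derivative of `profile` at 0. -/
lemma tendsto_defect_div_force_cube {q : ℝ} (hq : -1 < q) :
    Tendsto (fun y => defect q y / canonicalForce q y ^ 3) (𝓝[≠] 1) (𝓝 ((1 - q) / 3)) := by
  have hpos : ∀ᶠ y : ℝ in 𝓝[≠] 1, 0 < y := nhdsWithin_le_nhds (Ioi_mem_nhds one_pos)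
  have hne : ∀ᶠ y : ℝ in 𝓝[≠] 1, y ≠ 1 := self_mem_nhdsWithin
  refine HasDerivAt.lhopital_zero_nhdsNE
    (f' := fun y => (1 - q) * (2 * well q y) * y ^ (q - 2))
    (g' := fun y => 3 * canonicalForce q y ^ 2 * y ^ (q - 1)) ?_ ?_ ?_ ?_ ?_ ?_
  · filter_upwards [hpos] with y hy using hasDerivAt_defect hq hy
  · filter_upwards [hpos] with y hy
    exact ((hasDerivAt_canonicalForce q hy).pow 3).congr_deriv (by simp)
  · filter_upwards [hpos, hne] with y hy h1
    have := canonicalForce_ne_zero (q := q) hy h1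
    have := (Real.rpow_pos_of_pos hy (q - 1)).ne'
    positivity
  · have := (hasDerivAt_defect hq one_pos).continuousAt.tendsto
    rw [defect_one] at this
    exact this.mono_left nhdsWithin_le_nhds
  · have := (hasDerivAt_canonicalForce q one_pos).continuousAt.tendsto.pow 3
    rw [canonicalForce_one, zero_pow (by norm_num)] at this
    exact this.mono_left nhdsWithin_le_nhds
  · have h1 : Tendsto (fun y : ℝ => 2 * (1 - q) / 3 * y⁻¹) (𝓝[≠] 1) (𝓝 (2 * (1 - q) / 3 * 1⁻¹)) :=
      ((continuousAt_const.mul (continuousAt_inv₀ one_ne_zero)).tendsto).mono_left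
        nhdsWithin_le_nhds
    have h2 := h1.mul (tendsto_well_div_force_sq hq)
    rw [show 2 * (1 - q) / 3 * 1⁻¹ * (1 / 2) = (1 - q) / 3 by ring] at h2
    refine h2.congr' ?_
    filter_upwards [hpos, hne] with y hy h1
    have h3 := canonicalForce_ne_zero (q := q) hy h1
    have h4 := (Real.rpow_pos_of_pos hy (q - 2)).ne'
    have h5 : y ^ (q - 1) = y ^ (q - 2) * y := by
      rw [← Real.rpow_add_one hy.ne']; congr 1; ring
    rw [h5]
    field_simp

lemma continuousAt_profileDeriv_zero {q : ℝ} (hq : -1 < q) :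
    ContinuousAt (profileDeriv q) 0 := by
  rw [← continuousWithinAt_compl_self, ContinuousWithinAt, profileDeriv_zero hq]
  -- The square of the slope `2 z / R` is `4 U / R²`, and positivity of the slope selects the root.
  have h1 := ((tendsto_well_div_force_sq hq).comp (tendsto_profile_punctured hq)).const_mul 4
  have h2 := (Real.continuous_sqrt.tendsto _).comp h1
  rw [show (4 : ℝ) * (1 / 2) = 2 by norm_num] at h2
  refine h2.congr' ?_
  have hm : ∀ᶠ z in 𝓝[≠] (0 : ℝ), -maxAmp q < z :=
    nhdsWithin_le_nhds (Ioi_mem_nhds (by linarith [maxAmp_pos hq]))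
  filter_upwards [hm, self_mem_nhdsWithin] with z hz h0
  have h3 := profileDeriv_pos hq z
  rw [Function.comp_apply, Function.comp_apply, Real.sqrt_eq_iff_mul_self_eq_of_pos h3,
    profileDeriv_of_ne hz h0, well_profile hq hz.le]
  ring

lemma hasDerivAt_profile_of_ne {q z : ℝ} (hq : -1 < q) (hz : -maxAmp q < z) (h0 : z ≠ 0) :
    HasDerivAt (profile q) (profileDeriv q z) z := by
  have h1 := hasDerivAt_signedRoot hq (profile_pos hq hz) (profile_ne_one hq h0)
  rw [signedRoot_profile hq] at h1
  have h2 := canonicalForce_ne_zero (q := q) (profile_pos hq hz) (profile_ne_one hq h0)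
  have h3 := HasDerivAt.of_local_left_inverse (continuous_profile hq).continuousAt h1
    (by positivity) (Eventually.of_forall (signedRoot_profile hq))
  rwa [inv_div, ← profileDeriv_of_ne hz h0] at h3

/-- Carries a derivative formula across one exceptional point by one-sided limits of derivatives. It
serves at `z = 0`, where the quotients defining both derivatives of `profile` are of the form `0 /
0`. -/
lemma hasDerivAt_of_punctured {f f' : ℝ → ℝ} {a b x : ℝ} (hx : x ∈ Ioo a b)
    (h : ∀ y ∈ Ioo a b, y ≠ x → HasDerivAt f (f' y) y) (hf : ContinuousAt f x)
    (hf' : ContinuousAt f' x) : HasDerivAt f (f' x) x := by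
  have hR : Ioo x b ∈ 𝓝[>] x := Ioo_mem_nhdsGT hx.2
  have hL : Ioo a x ∈ 𝓝[<] x := Ioo_mem_nhdsLT hx.1
  have h1 : HasDerivWithinAt f (f' x) (Ici x) x := by
    refine hasDerivWithinAt_Ici_of_tendsto_deriv (s := Ioo x b) (fun y hy =>
      (h y ⟨hx.1.trans hy.1, hy.2⟩ hy.1.ne').differentiableAt.differentiableWithinAt)
      hf.continuousWithinAt hR ?_
    refine Tendsto.congr' ?_ (hf'.tendsto.mono_left nhdsWithin_le_nhds)
    filter_upwards [hR] with y hy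
    exact (h y ⟨hx.1.trans hy.1, hy.2⟩ hy.1.ne').deriv.symm
  have h2 : HasDerivWithinAt f (f' x) (Iic x) x := by
    refine hasDerivWithinAt_Iic_of_tendsto_deriv (s := Ioo a x) (fun y hy =>
      (h y ⟨hy.1, hy.2.trans hx.2⟩ hy.2.ne).differentiableAt.differentiableWithinAt)
      hf.continuousWithinAt hL ?_
    refine Tendsto.congr' ?_ (hf'.tendsto.mono_left nhdsWithin_le_nhds)
    filter_upwards [hL] with y hy
    exact (h y ⟨hy.1, hy.2.trans hx.2⟩ hy.2.ne).deriv.symm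
  simpa using h2.union h1

lemma hasDerivAt_profile {q z : ℝ} (hq : -1 < q) (hz : -maxAmp q < z) :
    HasDerivAt (profile q) (profileDeriv q z) z := by
  by_cases h0 : z = 0
  · subst h0
    exact hasDerivAt_of_punctured (b := 1) ⟨hz, one_pos⟩
      (fun y hy h => hasDerivAt_profile_of_ne hq hy.1 h) (continuous_profile hq).continuousAt
      (continuousAt_profileDeriv_zero hq)
  · exact hasDerivAt_profile_of_ne hq hz h0

/-- The second derivative of `profile` to the right of `-maxAmp q`. -/
noncomputable def profileDeriv2 (q z : ℝ) : ℝ :=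
  if z = 0 then 2 * (1 - q) / 3
  else 2 * (defect q (profile q z) / canonicalForce q (profile q z) ^ 3)

lemma hasDerivAt_profileDeriv_of_ne {q z : ℝ} (hq : -1 < q) (hz : -maxAmp q < z) (h0 : z ≠ 0) :
    HasDerivAt (profileDeriv q) (profileDeriv2 q z) z := by
  have hp := profile_pos hq hz
  have hR := canonicalForce_ne_zero (q := q) hp (profile_ne_one hq h0)
  have h1 : HasDerivAt (fun z => canonicalForce q (profile q z))
      (profile q z ^ (q - 1) * profileDeriv q z) z :=
    (hasDerivAt_canonicalForce q hp).comp z (hasDerivAt_profile hq hz)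
  have h2 := ((hasDerivAt_id z).const_mul 2).div h1 hR
  refine (h2.congr_of_eventuallyEq ?_).congr_deriv ?_
  · filter_upwards [Ioi_mem_nhds hz, isOpen_ne.mem_nhds h0] with t ht ht0
    exact profileDeriv_of_ne ht ht0
  · simp only [profileDeriv2, h0, if_false, defect, id]
    rw [profileDeriv_of_ne hz h0, well_profile hq hz.le]
    field_simp

lemma continuousAt_profileDeriv {q z : ℝ} (hq : -1 < q) (hz : -maxAmp q < z) :
    ContinuousAt (profileDeriv q) z := by
  by_cases h0 : z = 0
  · rw [h0]; exact continuousAt_profileDeriv_zero hq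
  · exact (hasDerivAt_profileDeriv_of_ne hq hz h0).continuousAt

lemma continuousAt_profileDeriv2 {q z : ℝ} (hq : -1 < q) (hz : -maxAmp q < z) :
    ContinuousAt (profileDeriv2 q) z := by
  by_cases h0 : z = 0
  · subst h0
    rw [← continuousWithinAt_compl_self, ContinuousWithinAt]
    have h1 := ((tendsto_defect_div_force_cube hq).comp (tendsto_profile_punctured hq)).const_mul 2
    rw [show profileDeriv2 q 0 = 2 * ((1 - q) / 3) by simp [profileDeriv2]; ring]
    refine h1.congr' ?_
    filter_upwards [self_mem_nhdsWithin] with z hz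
    have : z ≠ 0 := hz
    simp [profileDeriv2, this]
  · have hp := profile_pos hq hz
    have hR := canonicalForce_ne_zero (q := q) hp (profile_ne_one hq h0)
    have hc := (continuous_profile hq).continuousAt (x := z)
    have h1 : ContinuousAt (fun z => canonicalForce q (profile q z)) z :=
      ContinuousAt.comp (f := profile q) (hasDerivAt_canonicalForce q hp).continuousAt hc
    have h2 : ContinuousAt (fun z => defect q (profile q z)) z :=
      ContinuousAt.comp (f := profile q) (hasDerivAt_defect hq hp).continuousAt hc
    have h3 : ContinuousAt (fun z => 2 * (defect q (profile q z) /
        canonicalForce q (profile q z) ^ 3)) z :=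
      continuousAt_const.mul (h2.div (h1.pow 3) (pow_ne_zero 3 hR))
    refine h3.congr ?_
    filter_upwards [isOpen_ne.mem_nhds h0] with t ht
    have : t ≠ 0 := ht
    simp [profileDeriv2, this]

lemma hasDerivAt_profileDeriv {q z : ℝ} (hq : -1 < q) (hz : -maxAmp q < z) :
    HasDerivAt (profileDeriv q) (profileDeriv2 q z) z := by
  by_cases h0 : z = 0
  · subst h0
    exact hasDerivAt_of_punctured (b := 1) ⟨hz, one_pos⟩
      (fun y hy h => hasDerivAt_profileDeriv_of_ne hq hy.1 h)
      (continuousAt_profileDeriv hq hz) (continuousAt_profileDeriv2 hq hz)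
  · exact hasDerivAt_profileDeriv_of_ne hq hz h0

/-- With `z = w sin θ`, a derivative in `w` produces `profileDeriv2 q z * sin θ`, and a further
factor `w` completes it to the left side. The right side is again the slope times a function of the
height, so `w P'` is a time integral along the orbit. -/
lemma mul_profileDeriv2 {q z : ℝ} (hq : -1 < q) (hz : -maxAmp q < z) :
    z * profileDeriv2 q z = profileDeriv q z *
      (defect q (profile q z) / canonicalForce q (profile q z) ^ 2) := by
  by_cases h0 : z = 0
  · rw [h0, profile_zero hq, canonicalForce_one]; simp
  · have hR := canonicalForce_ne_zero (q := q) (profile_pos hq hz) (profile_ne_one hq h0)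
    rw [profileDeriv_of_ne hz h0]
    simp only [profileDeriv2, h0, if_false]
    field_simp

/-- For `q ≤ 0` the force blows up at height 0, but it stands in the denominator: left of `-maxAmp q
/ 2` its absolute value is at least its value there. The bound dominates the turn integrals up to
and including the separatrix. -/
lemma exists_profileDeriv_le {q : ℝ} (hq : -1 < q) :
    ∃ C, ∀ z ∈ Icc (-maxAmp q) (maxAmp q), profileDeriv q z ≤ C := by
  have hm := maxAmp_pos hq
  have h1 : ContinuousOn (profileDeriv q) (Icc (-maxAmp q / 2) (maxAmp q)) := fun z hz =>
    (continuousAt_profileDeriv hq (by linarith [hz.1])).continuousWithinAt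
  obtain ⟨C, hC⟩ := isCompact_Icc.bddAbove_image h1
  set r := canonicalForce q (profile q (-maxAmp q / 2)) with hr
  have hp : 0 < profile q (-maxAmp q / 2) := profile_pos hq (by linarith)
  have hp1 : profile q (-maxAmp q / 2) < 1 := by
    rw [← profile_zero hq]; exact strictMono_profile hq (by linarith)
  have hr0 : r < 0 := canonicalForce_neg hp hp1
  refine ⟨max (max C 1) (2 * maxAmp q / -r), fun z hz => ?_⟩
  rcases le_or_gt z (-maxAmp q) with h | h
  · refine le_max_of_le_left (le_max_of_le_right ?_)
    simp [profileDeriv, h]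
  rcases le_or_gt (-maxAmp q / 2) z with h2 | h2
  · exact le_max_of_le_left (le_max_of_le_left (hC ⟨z, ⟨h2, hz.2⟩, rfl⟩))
  · refine le_max_of_le_right ?_
    rw [profileDeriv_of_ne h (by linarith)]
    have h3 : canonicalForce q (profile q z) ≤ r :=
      (strictMonoOn_canonicalForce q).monotoneOn (profile_pos hq h) hp
        ((strictMono_profile hq).monotone h2.le)
    rw [← neg_div_neg_eq]
    apply div_le_div₀ <;> linarith

/-! ### Integrals over one turn of an orbit

The orbit of amplitude `w` in the well is `y = profile q (w sin θ)`, with `θ` running over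
`[-π/2, 3π/2]` and time element `profileDeriv q (w sin θ) / √2 dθ`. -/

/-- The phase window starts at the lowest point, so even the separatrix orbit meets height 0 only at
the two ends of the window. -/
lemma neg_one_lt_sin {θ : ℝ} (hθ : θ ∈ Ioo (-(Real.pi / 2)) (3 * Real.pi / 2)) :
    -1 < Real.sin θ := by
  refine lt_of_le_of_ne (Real.neg_one_le_sin θ) fun h => ?_
  have h1 : Real.cos (θ + Real.pi / 2) = 1 := by rw [Real.cos_add_pi_div_two]; linarith
  have h2 := (Real.cos_eq_one_iff_of_lt_of_lt (by linarith [hθ.1, Real.pi_pos])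
    (by linarith [hθ.2, Real.pi_pos])).1 h1
  linarith [hθ.1]

lemma turn_le : -(Real.pi / 2) ≤ 3 * Real.pi / 2 := by linarith [Real.pi_pos]

lemma sin_turn_start : Real.sin (-(Real.pi / 2)) = -1 := by
  rw [Real.sin_neg, Real.sin_pi_div_two]

lemma cos_turn_start : Real.cos (-(Real.pi / 2)) = 0 := by
  rw [Real.cos_neg, Real.cos_pi_div_two]

lemma cos_turn_end : Real.cos (3 * Real.pi / 2) = 0 := by
  rw [show 3 * Real.pi / 2 = Real.pi / 2 + Real.pi by ring, Real.cos_add_pi, Real.cos_pi_div_two,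
    neg_zero]

lemma amp_mul_sin_mem {m w : ℝ} (hw : w ∈ Ioc 0 m) (θ : ℝ) : w * Real.sin θ ∈ Icc (-m) m := by
  have h1 := Real.neg_one_le_sin θ
  have h2 := Real.sin_le_one θ
  constructor <;> nlinarith [hw.1, hw.2]

lemma neg_lt_amp_mul_sin {m w θ : ℝ} (hw : w ∈ Ioc 0 m)
    (hθ : θ ∈ Ioo (-(Real.pi / 2)) (3 * Real.pi / 2)) : -m < w * Real.sin θ := by
  nlinarith [neg_one_lt_sin hθ, hw.1, hw.2]

lemma neg_lt_amp_mul_sin' {m w : ℝ} (hw : w ∈ Ioo 0 m) (θ : ℝ) : -m < w * Real.sin θ := by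
  nlinarith [Real.neg_one_le_sin θ, hw.1, hw.2]

lemma intervalIntegrable_mul_profileDeriv {q w : ℝ} (hq : -1 < q) (hw : w ∈ Ioc 0 (maxAmp q))
    {c : ℝ → ℝ} (hc : Continuous c) (a b : ℝ) :
    IntervalIntegrable (fun θ => c θ * profileDeriv q (w * Real.sin θ)) volume a b := by
  obtain ⟨C, hC⟩ := exists_profileDeriv_le hq
  refine IntervalIntegrable.continuousOn_mul ?_ hc.continuousOn
  refine (intervalIntegrable_const (c := C)).mono_fun ?_ ?_
  · exact ((measurable_profileDeriv hq).comp (by fun_prop)).aestronglyMeasurable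
  · refine Eventually.of_forall fun θ => ?_
    have h1 := profileDeriv_pos hq (w * Real.sin θ)
    have h2 := hC _ (amp_mul_sin_mem hw θ)
    beta_reduce
    rw [Real.norm_of_nonneg h1.le, Real.norm_of_nonneg (h1.le.trans h2)]
    exact h2

lemma continuous_comp_amp_mul_sin {m w : ℝ} (hw : w ∈ Ioo 0 m) {F : ℝ → ℝ}
    (hF : ∀ z, -m < z → ContinuousAt F z) : Continuous fun θ => F (w * Real.sin θ) :=
  continuous_iff_continuousAt.2 fun θ =>
    ContinuousAt.comp (f := fun θ => w * Real.sin θ) (hF _ (neg_lt_amp_mul_sin' hw θ))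
      (by fun_prop)

lemma hasDerivAt_integral_amp {m w : ℝ} (hw : w ∈ Ioo 0 m) {c F F' : ℝ → ℝ} (hc : Continuous c)
    (hF : ∀ z, -m < z → HasDerivAt F (F' z) z) (hF' : ∀ z, -m < z → ContinuousAt F' z)
    (a b : ℝ) :
    HasDerivAt (fun w => ∫ θ in a..b, c θ * F (w * Real.sin θ))
      (∫ θ in a..b, c θ * (F' (w * Real.sin θ) * Real.sin θ)) w := by
  -- Amplitudes below this midpoint keep `x sin θ` in `[-v, v]`, a compact set on which `F'` is
  -- bounded.
  set v := (w + m) / 2 with hv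
  have hwv : w < v := by rw [hv]; linarith [hw.2]
  have hvm : v < m := by rw [hv]; linarith [hw.2]
  have hs : Ioo 0 v ∈ 𝓝 w := Ioo_mem_nhds hw.1 hwv
  have hFc : ∀ z, -m < z → ContinuousAt F z := fun z hz => (hF z hz).continuousAt
  obtain ⟨C, hC⟩ := isCompact_Icc.exists_bound_of_continuousOn (s := Icc (-v) v) (f := F')
    fun z hz => (hF' z (by linarith [hz.1])).continuousWithinAt
  refine (intervalIntegral.hasDerivAt_integral_of_dominated_loc_of_deriv_le (s := Ioo 0 v)
    (bound := fun θ => ‖c θ‖ * C)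
    (F' := fun w θ => c θ * (F' (w * Real.sin θ) * Real.sin θ)) hs ?_ ?_ ?_ ?_ ?_ ?_).2
  · filter_upwards [hs] with x hx
    exact (hc.mul (continuous_comp_amp_mul_sin
      ⟨hx.1, hx.2.trans hvm⟩ hFc)).aestronglyMeasurable
  · exact (hc.mul (continuous_comp_amp_mul_sin hw hFc)).intervalIntegrable _ _
  · exact (hc.mul ((continuous_comp_amp_mul_sin hw hF').mul
      Real.continuous_sin)).aestronglyMeasurable
  · refine Eventually.of_forall fun θ _ x hx => ?_
    have h1 := hC _ (amp_mul_sin_mem ⟨hx.1, hx.2.le⟩ θ)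
    have h2 : ‖Real.sin θ‖ ≤ 1 := Real.abs_sin_le_one θ
    rw [norm_mul, norm_mul]
    refine mul_le_mul_of_nonneg_left ?_ (norm_nonneg _)
    calc _ ≤ C * 1 := mul_le_mul h1 h2 (norm_nonneg _) ((norm_nonneg _).trans h1)
      _ = C := mul_one C
  · exact (hc.norm.mul continuous_const).intervalIntegrable _ _
  · refine Eventually.of_forall fun θ _ x hx => ?_
    have h1 := hF (x * Real.sin θ) (neg_lt_amp_mul_sin' ⟨hx.1, hx.2.trans hvm⟩ θ)
    have h2 : HasDerivAt (fun x => x * Real.sin θ) (Real.sin θ) x := hasDerivAt_mul_const _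
    exact (h1.comp x h2).const_mul (c θ)

lemma continuousOn_integral_amp {m : ℝ} {c F : ℝ → ℝ} (hc : Continuous c)
    (hFm : Measurable F) (hF : ∀ z, -m < z → ContinuousAt F z) {C : ℝ}
    (hC : ∀ z ∈ Icc (-m) m, ‖F z‖ ≤ C) :
    ContinuousOn (fun w => ∫ θ in (-(Real.pi / 2))..(3 * Real.pi / 2), c θ * F (w * Real.sin θ))
      (Ioc 0 m) := by
  intro w hw
  refine intervalIntegral.continuousWithinAt_of_dominated_interval (bound := fun θ => ‖c θ‖ * C)
    ?_ ?_ ((hc.norm.mul continuous_const).intervalIntegrable _ _) ?_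
  · exact Eventually.of_forall fun x =>
      (hc.measurable.mul (hFm.comp (by fun_prop))).aestronglyMeasurable
  · filter_upwards [self_mem_nhdsWithin] with x hx
    refine Eventually.of_forall fun θ _ => ?_
    rw [norm_mul]
    exact mul_le_mul_of_nonneg_left (hC _ (amp_mul_sin_mem hx θ)) (norm_nonneg _)
  -- At `w = m` the final phase lands on the excluded value `-m`; one phase has measure zero, and
  -- the half-open window omits the initial one.
  · have h1 : ∀ᵐ θ : ℝ, θ ≠ 3 * Real.pi / 2 := by
      rw [ae_iff]; simp
    filter_upwards [h1] with θ hne hθ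
    rw [uIoc_of_le turn_le] at hθ
    have h2 := hF _ (neg_lt_amp_mul_sin hw ⟨hθ.1, lt_of_le_of_ne hθ.2 hne⟩)
    exact (continuousAt_const.mul (ContinuousAt.comp (f := fun x => x * Real.sin θ) h2
      (by fun_prop))).continuousWithinAt

/-- The time of one turn. -/
noncomputable def period (q w : ℝ) : ℝ :=
  ∫ θ in (-(Real.pi / 2))..(3 * Real.pi / 2), (√2)⁻¹ * profileDeriv q (w * Real.sin θ)

/-- The time integral of the height over one turn. -/
noncomputable def area (q w : ℝ) : ℝ :=
  ∫ θ in (-(Real.pi / 2))..(3 * Real.pi / 2),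
    (√2)⁻¹ * (profile q (w * Real.sin θ) * profileDeriv q (w * Real.sin θ))

/-- The time integral of the squared velocity over one turn. -/
noncomputable def action (q w : ℝ) : ℝ :=
  w ^ 2 * ∫ θ in (-(Real.pi / 2))..(3 * Real.pi / 2),
    (√2)⁻¹ * (2 * Real.cos θ ^ 2) * profileDeriv q (w * Real.sin θ)

/-- The total energy of the orbit of amplitude `w`, normalized to vanish on the separatrix. -/
noncomputable def level (q w : ℝ) : ℝ := w ^ 2 - 1 / (q + 1)

/-- The defect relative to the squared force. -/
noncomputable def relDefect (q y : ℝ) : ℝ := defect q y / canonicalForce q y ^ 2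

/-- The integral of a function of the height over one turn. -/
noncomputable def turnIntegral (q : ℝ) (f : ℝ → ℝ) (w : ℝ) : ℝ :=
  ∫ θ in (-(Real.pi / 2))..(3 * Real.pi / 2),
    (√2)⁻¹ * (f (profile q (w * Real.sin θ)) * profileDeriv q (w * Real.sin θ))

lemma level_neg {q w : ℝ} (hq : -1 < q) (hw : w ∈ Ioo 0 (maxAmp q)) : level q w < 0 := by
  have := maxAmp_sq hq
  unfold level
  nlinarith [hw.1, hw.2]

lemma period_pos {q w : ℝ} (hq : -1 < q) (hw : w ∈ Ioc 0 (maxAmp q)) : 0 < period q w := by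
  refine intervalIntegral.intervalIntegral_pos_of_pos
    (intervalIntegrable_mul_profileDeriv hq hw continuous_const _ _) (fun θ => ?_)
    (by linarith [Real.pi_pos])
  have := profileDeriv_pos hq (w * Real.sin θ)
  positivity

lemma area_pos {q w : ℝ} (hq : -1 < q) (hw : w ∈ Ioc 0 (maxAmp q)) : 0 < area q w := by
  have hI : IntervalIntegrable (fun θ => (√2)⁻¹ * (profile q (w * Real.sin θ) *
      profileDeriv q (w * Real.sin θ))) volume (-(Real.pi / 2)) (3 * Real.pi / 2) := by
    simp only [← mul_assoc]
    refine intervalIntegrable_mul_profileDeriv hq hw ?_ _ _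
    have := continuous_profile hq
    fun_prop
  refine intervalIntegral.intervalIntegral_pos_of_pos_on hI (fun θ hθ => ?_)
    (by linarith [Real.pi_pos])
  have h1 := profileDeriv_pos hq (w * Real.sin θ)
  have h2 := profile_pos hq (neg_lt_amp_mul_sin hw hθ)
  positivity

lemma action_nonneg {q w : ℝ} (hq : -1 < q) : 0 ≤ action q w := by
  refine mul_nonneg (sq_nonneg w) (intervalIntegral.integral_nonneg turn_le fun θ _ => ?_)
  have h1 := profileDeriv_pos hq (w * Real.sin θ)
  positivity

/-- A virial identity. Since `(y v)' = v² - y R` integrates to zero over a turn, `∫ y R = J`;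
inserting `y = y R + 1 - (q + 1) U` and `∫ U = w² P - J / 2` gives the formula. -/
lemma area_eq {q w : ℝ} (hq : -1 < q) (hw : w ∈ Ioc 0 (maxAmp q)) :
    area q w = (q + 3) / 2 * action q w - (q + 1) * level q w * period q w := by
  have hp := continuous_profile hq
  have hq1 : q + 1 ≠ 0 := by linarith
  have I1 := intervalIntegrable_mul_profileDeriv hq hw
    (c := fun θ => (√2)⁻¹) continuous_const (-(Real.pi / 2)) (3 * Real.pi / 2)
  have I2 := intervalIntegrable_mul_profileDeriv hq hw
    (c := fun θ => (√2)⁻¹ * (2 * Real.cos θ ^ 2)) (by fun_prop) (-(Real.pi / 2)) (3 * Real.pi / 2)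
  have I3 := intervalIntegrable_mul_profileDeriv hq hw
    (c := fun θ => (√2)⁻¹ * profile q (w * Real.sin θ)) (by fun_prop)
    (-(Real.pi / 2)) (3 * Real.pi / 2)
  simp only [mul_assoc _ (profile q _)] at I3
  have key : ∫ θ in (-(Real.pi / 2))..(3 * Real.pi / 2),
      ((q + 3) / 2 * w ^ 2 * ((√2)⁻¹ * (2 * Real.cos θ ^ 2) * profileDeriv q (w * Real.sin θ))
      - (q + 1) * level q w * ((√2)⁻¹ * profileDeriv q (w * Real.sin θ))
      - (√2)⁻¹ * (profile q (w * Real.sin θ) * profileDeriv q (w * Real.sin θ))) =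
      (√2)⁻¹ * 2 * w * profile q (w * Real.sin (3 * Real.pi / 2)) * Real.cos (3 * Real.pi / 2) -
      (√2)⁻¹ * 2 * w * profile q (w * Real.sin (-(Real.pi / 2))) * Real.cos (-(Real.pi / 2)) := by
    -- The primitive is height times velocity. Differentiability is needed only in the open window,
    -- which admits `w = maxAmp q`.
    refine intervalIntegral.integral_eq_sub_of_hasDerivAt_of_le (f := fun θ =>
      (√2)⁻¹ * 2 * w * profile q (w * Real.sin θ) * Real.cos θ) turn_le (by fun_prop)
      (fun θ hθ => ?_) (((I2.const_mul _).sub (I1.const_mul _)).sub I3)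
    have hz := neg_lt_amp_mul_sin hw hθ
    have h1 : HasDerivAt (fun θ => profile q (w * Real.sin θ))
        (profileDeriv q (w * Real.sin θ) * (w * Real.cos θ)) θ :=
      HasDerivAt.comp θ (hasDerivAt_profile hq hz) ((Real.hasDerivAt_sin θ).const_mul w)
    refine ((h1.const_mul ((√2)⁻¹ * 2 * w)).mul (Real.hasDerivAt_cos θ)).congr_deriv ?_
    have h2 := profileDeriv_mul_force hq hz
    have h3 := well_mul hq (profile q (w * Real.sin θ))
    rw [well_profile hq hz.le] at h3
    have h4 : (q + 1) * level q w = (q + 1) * w ^ 2 - 1 := by unfold level; field_simp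
    rw [h4]
    set ρ := profileDeriv q (w * Real.sin θ)
    set y := profile q (w * Real.sin θ)
    have h5 := Real.sin_sq_add_cos_sq θ
    have h6 : Real.cos θ ^ 2 = 1 - Real.sin θ ^ 2 := by linarith
    linear_combination (√2)⁻¹ * (y * h2 + ρ * h3) + (-(q + 1)) * (√2)⁻¹ * ρ * w ^ 2 * h6
  rw [intervalIntegral.integral_sub ((I2.const_mul _).sub (I1.const_mul _)) I3,
    intervalIntegral.integral_sub (I2.const_mul _) (I1.const_mul _),
    intervalIntegral.integral_const_mul, intervalIntegral.integral_const_mul,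
    cos_turn_start, cos_turn_end] at key
  unfold area action period
  linarith

/-- The classical relation that the derivative of the action in the total energy `w²` is the period.
The second derivative of `profile` is removed by integrating by parts with the primitive `cos θ sin
θ profileDeriv q (w sin θ)`, which vanishes at both ends. -/
lemma hasDerivAt_action {q w : ℝ} (hq : -1 < q) (hw : w ∈ Ioo 0 (maxAmp q)) :
    HasDerivAt (action q) (2 * w * period q w) w := by
  have hw' : w ∈ Ioc 0 (maxAmp q) := ⟨hw.1, hw.2.le⟩
  have hρ : Continuous fun θ => profileDeriv q (w * Real.sin θ) :=
    continuous_comp_amp_mul_sin hw fun z hz => continuousAt_profileDeriv hq hz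
  have hρ' : Continuous fun θ => profileDeriv2 q (w * Real.sin θ) :=
    continuous_comp_amp_mul_sin hw fun z hz => continuousAt_profileDeriv2 hq hz
  have h1 := hasDerivAt_integral_amp hw (c := fun θ => (√2)⁻¹ * (2 * Real.cos θ ^ 2))
    (by fun_prop) (fun z hz => hasDerivAt_profileDeriv hq hz)
    (fun z hz => continuousAt_profileDeriv2 hq hz) (-(Real.pi / 2)) (3 * Real.pi / 2)
  refine (((hasDerivAt_id w).pow 2).mul h1).congr_deriv ?_
  have key : ∫ θ in (-(Real.pi / 2))..(3 * Real.pi / 2),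
      (2 * w * ((√2)⁻¹ * (2 * Real.cos θ ^ 2) * profileDeriv q (w * Real.sin θ))
      + w ^ 2 * ((√2)⁻¹ * (2 * Real.cos θ ^ 2) *
        (profileDeriv2 q (w * Real.sin θ) * Real.sin θ))
      - 2 * w * ((√2)⁻¹ * profileDeriv q (w * Real.sin θ))) =
      (√2)⁻¹ * 2 * w * (Real.cos (3 * Real.pi / 2) * Real.sin (3 * Real.pi / 2)) *
        profileDeriv q (w * Real.sin (3 * Real.pi / 2)) -
      (√2)⁻¹ * 2 * w * (Real.cos (-(Real.pi / 2)) * Real.sin (-(Real.pi / 2))) *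
        profileDeriv q (w * Real.sin (-(Real.pi / 2))) := by
    refine intervalIntegral.integral_eq_sub_of_hasDerivAt (f := fun θ =>
      (√2)⁻¹ * 2 * w * (Real.cos θ * Real.sin θ) * profileDeriv q (w * Real.sin θ))
      (fun θ _ => ?_) (Continuous.intervalIntegrable (by fun_prop) _ _)
    have h1 : HasDerivAt (fun θ => profileDeriv q (w * Real.sin θ))
        (profileDeriv2 q (w * Real.sin θ) * (w * Real.cos θ)) θ :=
      HasDerivAt.comp θ (hasDerivAt_profileDeriv hq (neg_lt_amp_mul_sin' hw θ))
        ((Real.hasDerivAt_sin θ).const_mul w)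
    refine ((((Real.hasDerivAt_cos θ).mul (Real.hasDerivAt_sin θ)).const_mul
      ((√2)⁻¹ * 2 * w)).mul h1).congr_deriv ?_
    have h5 := Real.sin_sq_add_cos_sq θ
    simp only [Pi.mul_apply]
    linear_combination (-2) * (√2)⁻¹ * w * profileDeriv q (w * Real.sin θ) * h5
  have I1 : Continuous fun θ => (√2)⁻¹ * profileDeriv q (w * Real.sin θ) := by fun_prop
  have I2 : Continuous fun θ => (√2)⁻¹ * (2 * Real.cos θ ^ 2) * profileDeriv q (w * Real.sin θ) :=
    by fun_prop
  have I3 : Continuous fun θ => (√2)⁻¹ * (2 * Real.cos θ ^ 2) *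
    (profileDeriv2 q (w * Real.sin θ) * Real.sin θ) := by fun_prop
  rw [intervalIntegral.integral_sub (((I2.intervalIntegrable _ _).const_mul _).add
      ((I3.intervalIntegrable _ _).const_mul _)) ((I1.intervalIntegrable _ _).const_mul _),
    intervalIntegral.integral_add ((I2.intervalIntegrable _ _).const_mul _)
      ((I3.intervalIntegrable _ _).const_mul _),
    intervalIntegral.integral_const_mul, intervalIntegral.integral_const_mul,
    intervalIntegral.integral_const_mul, cos_turn_start, cos_turn_end] at key
  unfold period
  simp only [id, Pi.pow_apply, Nat.cast_ofNat, mul_one, Nat.add_one_sub_one, pow_one]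
  linarith

lemma hasDerivAt_period {q w : ℝ} (hq : -1 < q) (hw : w ∈ Ioo 0 (maxAmp q)) :
    HasDerivAt (period q) (turnIntegral q (relDefect q) w / w) w := by
  have h1 := hasDerivAt_integral_amp hw (c := fun _ => (√2)⁻¹) continuous_const
    (fun z hz => hasDerivAt_profileDeriv hq hz)
    (fun z hz => continuousAt_profileDeriv2 hq hz) (-(Real.pi / 2)) (3 * Real.pi / 2)
  refine h1.congr_deriv ?_
  rw [eq_div_iff hw.1.ne', ← intervalIntegral.integral_mul_const, turnIntegral]
  refine intervalIntegral.integral_congr fun θ _ => ?_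
  have := mul_profileDeriv2 hq (neg_lt_amp_mul_sin' hw θ)
  simp only [relDefect]
  linear_combination (√2)⁻¹ * this

lemma mul_profileDeriv {q z : ℝ} (hq : -1 < q) (hz : -maxAmp q < z) :
    z * profileDeriv q z = 2 * well q (profile q z) / canonicalForce q (profile q z) := by
  by_cases h0 : z = 0
  · rw [h0, profile_zero hq, canonicalForce_one]; simp
  · rw [profileDeriv_of_ne hz h0, well_profile hq hz.le]; ring

lemma hasDerivAt_area {q w : ℝ} (hq : -1 < q) (hw : w ∈ Ioo 0 (maxAmp q)) :
    HasDerivAt (area q)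
      (turnIntegral q (fun y => 2 * well q y / canonicalForce q y + y * relDefect q y) w / w) w := by
  have h1 := hasDerivAt_integral_amp hw (c := fun _ => (√2)⁻¹)
    (F := fun z => profile q z * profileDeriv q z) continuous_const
    (fun z hz => (hasDerivAt_profile hq hz).mul (hasDerivAt_profileDeriv hq hz))
    (fun z hz => ((continuousAt_profileDeriv hq hz).mul (continuousAt_profileDeriv hq hz)).add
      ((continuous_profile hq).continuousAt.mul (continuousAt_profileDeriv2 hq hz)))
    (-(Real.pi / 2)) (3 * Real.pi / 2)
  refine h1.congr_deriv ?_
  rw [eq_div_iff hw.1.ne', ← intervalIntegral.integral_mul_const, turnIntegral]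
  refine intervalIntegral.integral_congr fun θ _ => ?_
  have h2 := mul_profileDeriv2 hq (neg_lt_amp_mul_sin' hw θ)
  have h3 := mul_profileDeriv hq (neg_lt_amp_mul_sin' hw θ)
  simp only [relDefect]
  linear_combination (√2)⁻¹ * profile q (w * Real.sin θ) * h2 +
    (√2)⁻¹ * profileDeriv q (w * Real.sin θ) * h3

lemma continuousOn_period {q : ℝ} (hq : -1 < q) : ContinuousOn (period q) (Ioc 0 (maxAmp q)) := by
  obtain ⟨C, hC⟩ := exists_profileDeriv_le hq
  refine continuousOn_integral_amp (C := C) continuous_const (measurable_profileDeriv hq)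
    (fun z hz => continuousAt_profileDeriv hq hz) fun z hz => ?_
  rw [Real.norm_of_nonneg (profileDeriv_pos hq z).le]
  exact hC z hz

lemma continuousOn_area {q : ℝ} (hq : -1 < q) : ContinuousOn (area q) (Ioc 0 (maxAmp q)) := by
  obtain ⟨C, hC⟩ := exists_profileDeriv_le hq
  refine continuousOn_integral_amp (C := profile q (maxAmp q) * C) continuous_const
    ((continuous_profile hq).measurable.mul (measurable_profileDeriv hq))
    (fun z hz => (continuous_profile hq).continuousAt.mul (continuousAt_profileDeriv hq hz))
    fun z hz => ?_
  have h1 := profile_nonneg hq hz.1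
  have h2 := (profileDeriv_pos hq z).le
  rw [Pi.mul_apply, Real.norm_of_nonneg (mul_nonneg h1 h2)]
  have h3 := (strictMono_profile hq).monotone hz.2
  exact mul_le_mul h3 (hC z hz) h2 (h1.trans h3)

lemma continuousOn_action {q : ℝ} (hq : -1 < q) : ContinuousOn (action q) (Ioc 0 (maxAmp q)) := by
  obtain ⟨C, hC⟩ := exists_profileDeriv_le hq
  refine ContinuousOn.mul (by fun_prop) (continuousOn_integral_amp (C := C) (by fun_prop)
    (measurable_profileDeriv hq) (fun z hz => continuousAt_profileDeriv hq hz) fun z hz => ?_)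
  rw [Real.norm_of_nonneg (profileDeriv_pos hq z).le]
  exact hC z hz

/-! ### Signs from derivatives around `y = 1` -/

section Signs

variable {f f' : ℝ → ℝ}

lemma neg_right_of_deriv (hf : ∀ y, 0 < y → HasDerivAt f (f' y) y) (h1 : f 1 = 0)
    (h : ∀ y, 1 < y → f' y < 0) {y : ℝ} (hy : 1 < y) : f y < 0 := by
  have h2 : StrictAntiOn f (Ici 1) := by
    apply strictAntiOn_of_deriv_neg (convex_Ici 1)
    · exact fun y hy => (hf y (one_pos.trans_le hy)).continuousAt.continuousWithinAt
    · intro y hy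
      rw [interior_Ici] at hy
      rw [(hf y (one_pos.trans hy)).deriv]
      exact h y hy
  rw [← h1]
  exact h2 (mem_Ici.2 le_rfl) (mem_Ici.2 hy.le) hy

lemma neg_left_of_deriv (hf : ∀ y, 0 < y → HasDerivAt f (f' y) y) (h1 : f 1 = 0)
    (h : ∀ y, 0 < y → y < 1 → 0 < f' y) {y : ℝ} (h0 : 0 < y) (hy : y < 1) : f y < 0 := by
  have h2 : StrictMonoOn f (Ioc 0 1) := by
    apply strictMonoOn_of_deriv_pos (convex_Ioc 0 1)
    · exact fun y hy => (hf y hy.1).continuousAt.continuousWithinAt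
    · intro y hy
      rw [interior_Ioc] at hy
      rw [(hf y hy.1).deriv]
      exact h y hy.1 hy.2
  rw [← h1]
  exact h2 ⟨h0, hy.le⟩ ⟨one_pos, le_rfl⟩ hy

lemma pos_left_of_deriv (hf : ∀ y, 0 < y → HasDerivAt f (f' y) y) (h1 : f 1 = 0)
    (h : ∀ y, 0 < y → y < 1 → f' y < 0) {y : ℝ} (h0 : 0 < y) (hy : y < 1) : 0 < f y := by
  have := neg_left_of_deriv (f := fun y => -f y) (fun y hy => (hf y hy).neg) (by simp [h1])
    (fun y h0 hy => neg_pos.2 (h y h0 hy)) h0 hy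
  linarith

lemma nonneg_right_of_deriv (hf : ∀ y, 0 < y → HasDerivAt f (f' y) y) (h1 : f 1 = 0)
    (h : ∀ y, 1 < y → 0 ≤ f' y) {y : ℝ} (hy : 1 < y) : 0 ≤ f y := by
  have h2 : MonotoneOn f (Ici 1) := by
    apply monotoneOn_of_deriv_nonneg (convex_Ici 1)
    · exact fun y hy => (hf y (one_pos.trans_le hy)).continuousAt.continuousWithinAt
    · intro y hy
      rw [interior_Ici] at hy
      exact (hf y (one_pos.trans hy)).differentiableAt.differentiableWithinAt
    · intro y hy
      rw [interior_Ici] at hy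
      rw [(hf y (one_pos.trans hy)).deriv]
      exact h y hy
  rw [← h1]
  exact h2 (mem_Ici.2 le_rfl) (mem_Ici.2 hy.le) hy.le

lemma nonneg_left_of_deriv (hf : ∀ y, 0 < y → HasDerivAt f (f' y) y) (h1 : f 1 = 0)
    (h : ∀ y, 0 < y → y < 1 → f' y ≤ 0) {y : ℝ} (h0 : 0 < y) (hy : y < 1) : 0 ≤ f y := by
  have h2 : AntitoneOn f (Ioc 0 1) := by
    apply antitoneOn_of_deriv_nonpos (convex_Ioc 0 1)
    · exact fun y hy => (hf y hy.1).continuousAt.continuousWithinAt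
    · intro y hy
      rw [interior_Ioc] at hy
      exact (hf y hy.1).differentiableAt.differentiableWithinAt
    · intro y hy
      rw [interior_Ioc] at hy
      rw [(hf y hy.1).deriv]
      exact h y hy.1 hy.2
  rw [← h1]
  exact h2 ⟨h0, hy.le⟩ ⟨one_pos, le_rfl⟩ hy.le

end Signs

/-! ### Pointwise inequalities for the relative defect -/

lemma rpow_sub_one_eq (q : ℝ) {y : ℝ} (hy : 0 < y) : y ^ (q - 1) = y * y ^ (q - 2) := by
  rw [mul_comm, ← Real.rpow_add_one hy.ne']; congr 1; ring

/-- Eliminates the power and the well, leaving a polynomial in `y` and the force. The pointwise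
inequalities are compared in this form. -/
lemma mul_defect {q y : ℝ} (hq : -1 < q) (hy : 0 < y) :
    (q + 1) * y * defect q y = (1 - q) * y * canonicalForce q y ^ 2
      - 2 * (y * canonicalForce q y - (y - 1)) + 2 * q * (y - 1) * canonicalForce q y := by
  have h1 := well_mul hq y
  have h2 := mul_rpow_sub_one q hy
  unfold defect
  linear_combination (-2) * (q + 1) * well q y * h2
    - 2 * (1 + q * canonicalForce q y) * h1

lemma relDefect_one (q : ℝ) : relDefect q 1 = 0 := by simp [relDefect, defect_one]

lemma relDefect_mul_sq {q y : ℝ} (hy : 0 < y) :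
    relDefect q y * canonicalForce q y ^ 2 = defect q y := by
  by_cases h : y = 1
  · rw [h, defect_one, canonicalForce_one]; simp
  · have := canonicalForce_ne_zero (q := q) hy h
    unfold relDefect; field_simp

lemma well_div_force_mul {q y : ℝ} (hy : 0 < y) :
    well q y / canonicalForce q y * canonicalForce q y = well q y := by
  by_cases h : y = 1
  · rw [h, well_one, canonicalForce_one]; simp
  · have := canonicalForce_ne_zero (q := q) hy h
    field_simp

lemma continuousOn_relDefect {q : ℝ} (hq : -1 < q) : ContinuousOn (relDefect q) (Ioi 0) := by
  intro y hy
  refine ContinuousAt.continuousWithinAt ?_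
  by_cases h : y = 1
  · subst h
    rw [← continuousWithinAt_compl_self, ContinuousWithinAt, relDefect_one]
    have h1 := (tendsto_defect_div_force_cube hq).mul
      (((hasDerivAt_canonicalForce q one_pos).continuousAt.tendsto).mono_left
        (nhdsWithin_le_nhds (s := {1}ᶜ)))
    rw [canonicalForce_one, mul_zero] at h1
    refine h1.congr fun y => ?_
    unfold relDefect
    by_cases h2 : canonicalForce q y = 0
    · simp [h2]
    · field_simp
  · exact (hasDerivAt_defect hq hy).continuousAt.div
      ((hasDerivAt_canonicalForce q hy).continuousAt.pow 2)
      (pow_ne_zero 2 (canonicalForce_ne_zero hy h))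

lemma continuousOn_well_div_force {q : ℝ} (hq : -1 < q) :
    ContinuousOn (fun y => well q y / canonicalForce q y) (Ioi 0) := by
  intro y hy
  refine ContinuousAt.continuousWithinAt ?_
  by_cases h : y = 1
  · subst h
    rw [← continuousWithinAt_compl_self, ContinuousWithinAt, well_one, zero_div]
    have h1 := (tendsto_well_div_force_sq hq).mul
      (((hasDerivAt_canonicalForce q one_pos).continuousAt.tendsto).mono_left
        (nhdsWithin_le_nhds (s := {1}ᶜ)))
    rw [canonicalForce_one, mul_zero] at h1
    refine h1.congr fun y => ?_
    by_cases h2 : canonicalForce q y = 0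
    · simp [h2]
    · field_simp
  · exact (hasDerivAt_well hq hy).continuousAt.div (hasDerivAt_canonicalForce q hy).continuousAt
      (canonicalForce_ne_zero hy h)

/-- The constant is forced by first-order agreement at `y = 1`. After multiplication by `R²` the
difference has derivative `(1 - q) y^(q-2) (2 U - y R²)`, and `2 U - y R²` decreases through 0 at `y
= 1`, its own derivative being `-(1 + 2 q) R²`. -/
lemma relDefect_le_of_pos {q y : ℝ} (hq : 0 < q) (hq1 : q < 1) (hy : 0 < y) :
    relDefect q y ≤ (1 - q) / 3 * canonicalForce q y := by
  by_cases h : y = 1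
  · rw [h, relDefect_one, canonicalForce_one]; simp
  have hq' : -1 < q := by linarith
  have hR := canonicalForce_ne_zero (q := q) hy h
  have hT : ∀ y, 0 < y → HasDerivAt (fun y => 2 * well q y - y * canonicalForce q y ^ 2)
      (-(1 + 2 * q) * canonicalForce q y ^ 2) y := by
    intro y hy
    refine (((hasDerivAt_well hq' hy).const_mul 2).sub ((hasDerivAt_id y).mul
      ((hasDerivAt_canonicalForce q hy).pow 2))).congr_deriv ?_
    have := mul_rpow_sub_one q hy
    simp
    linear_combination (-2) * canonicalForce q y * this
  have hT' : ∀ y, 0 < y → y ≠ 1 → -(1 + 2 * q) * canonicalForce q y ^ 2 < 0 := by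
    intro y hy h
    have := canonicalForce_ne_zero (q := q) hy h
    have : 0 < (1 + 2 * q) * canonicalForce q y ^ 2 := by positivity
    linarith
  have hT1 : 2 * well q 1 - 1 * canonicalForce q 1 ^ 2 = 0 := by
    simp [well_one, canonicalForce_one]
  have hD : ∀ y, 0 < y → HasDerivAt (fun y => defect q y - (1 - q) / 3 * canonicalForce q y ^ 3)
      ((1 - q) * y ^ (q - 2) * (2 * well q y - y * canonicalForce q y ^ 2)) y := by
    intro y hy
    refine ((hasDerivAt_defect hq' hy).sub
      (((hasDerivAt_canonicalForce q hy).pow 3).const_mul ((1 - q) / 3))).congr_deriv ?_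
    simp only [Nat.cast_ofNat, Nat.add_one_sub_one, rpow_sub_one_eq q hy]
    ring
  have hD1 : defect q 1 - (1 - q) / 3 * canonicalForce q 1 ^ 3 = 0 := by
    simp [defect_one, canonicalForce_one]
  have hpos : ∀ y : ℝ, 0 < y → 0 < (1 - q) * y ^ (q - 2) := fun y hy =>
    mul_pos (by linarith) (Real.rpow_pos_of_pos hy _)
  have key : defect q y - (1 - q) / 3 * canonicalForce q y ^ 3 < 0 := by
    rcases lt_or_gt_of_ne h with h1 | h1
    · refine neg_left_of_deriv hD hD1 (fun y h0 h1 => mul_pos (hpos y h0) ?_) hy h1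
      exact pos_left_of_deriv hT hT1 (fun y h0 h1 => hT' y h0 h1.ne) h0 h1
    · refine neg_right_of_deriv hD hD1 (fun y h1 =>
        mul_neg_of_pos_of_neg (hpos y (one_pos.trans h1)) ?_) h1
      exact neg_right_of_deriv hT hT1 (fun y h1 => hT' y (one_pos.trans h1) h1.ne') h1
  rw [relDefect, div_le_iff₀ (by positivity)]
  linarith

/-! ### Monotonicity of the relative defect, and a bound for nonpositive exponents -/

section NonposExponent

variable {q : ℝ}

/-- The function differentiated here is the factor of undetermined sign in the numerator of the
derivative of `relDefect`. A second differentiation, in `hasDerivAt_monotone_aux2`, exposes the sign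
of `1 - y`. -/
lemma hasDerivAt_monotone_aux {y : ℝ} (hy : 0 < y) :
    HasDerivAt (fun y => (y - 1) * (2 - (1 - q) * canonicalForce q y) - 2 * canonicalForce q y)
      ((1 + q) * (1 - (1 - q) * canonicalForce q y - y ^ (q - 1))) y := by
  have hR := hasDerivAt_canonicalForce q hy
  refine ((((hasDerivAt_id y).sub_const 1).mul ((hR.const_mul (1 - q)).const_sub 2)).sub
    (hR.const_mul 2)).congr_deriv ?_
  have := mul_rpow_sub_one q hy
  simp only [id]
  linear_combination (-(1 - q)) * this

lemma hasDerivAt_monotone_aux2 {y : ℝ} (hy : 0 < y) :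
    HasDerivAt (fun y => 1 - (1 - q) * canonicalForce q y - y ^ (q - 1))
      ((1 - q) * y ^ (q - 2) * (1 - y)) y := by
  refine ((((hasDerivAt_canonicalForce q hy).const_mul (1 - q)).const_sub 1).sub
    (hasDerivAt_rpow_sub_one q hy)).congr_deriv ?_
  rw [rpow_sub_one_eq q hy]; ring

lemma monotone_aux_neg (hq1 : q < 1) {y : ℝ} (hy : 0 < y) (h : y ≠ 1) :
    1 - (1 - q) * canonicalForce q y - y ^ (q - 1) < 0 := by
  have hpos : ∀ y : ℝ, 0 < y → 0 < (1 - q) * y ^ (q - 2) := fun y hy =>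
    mul_pos (by linarith) (Real.rpow_pos_of_pos hy _)
  have h1 : 1 - (1 - q) * canonicalForce q 1 - (1 : ℝ) ^ (q - 1) = 0 := by
    simp [canonicalForce_one]
  rcases lt_or_gt_of_ne h with h2 | h2
  · exact neg_left_of_deriv (fun y hy => hasDerivAt_monotone_aux2 hy) h1
      (fun y h0 h1 => mul_pos (hpos y h0) (by linarith)) hy h2
  · exact neg_right_of_deriv (fun y hy => hasDerivAt_monotone_aux2 hy) h1
      (fun y h1 => mul_neg_of_pos_of_neg (hpos y (one_pos.trans h1)) (by linarith)) h2

lemma hasDerivAt_relDefect (hq : -1 < q) {y : ℝ} (hy : 0 < y) (h : y ≠ 1) :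
    HasDerivAt (relDefect q)
      (-2 * y ^ (q - 2) * ((y - 1) * (2 - (1 - q) * canonicalForce q y) - 2 * canonicalForce q y)
        / ((q + 1) * canonicalForce q y ^ 3)) y := by
  have hR := hasDerivAt_canonicalForce q hy
  have hR0 := canonicalForce_ne_zero (q := q) hy h
  refine ((hasDerivAt_defect hq hy).div (hR.pow 2) (pow_ne_zero 2 hR0)).congr_deriv ?_
  have h1 := well_mul hq y
  have h2 := mul_rpow_sub_one q hy
  have h4 := rpow_sub_one_eq q hy
  have h5 : q + 1 ≠ 0 := by linarith
  simp only [Pi.pow_apply, Nat.cast_ofNat, Nat.add_one_sub_one, pow_one]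
  rw [div_eq_div_iff (by positivity) (by positivity)]
  have h6 : defect q y = canonicalForce q y ^ 2 - 2 * well q y * y ^ (q - 1) := rfl
  rw [h6, h4]
  rw [h4] at h2
  set R := canonicalForce q y
  set s := y ^ (q - 2)
  set u := well q y
  linear_combination (4 * u * R ^ 4 * s * (q + 1)) * h2 +
    (2 * (1 - q) * R ^ 5 * s + 4 * R ^ 4 * s * (1 + q * R)) * h1

/-- In the derivative, the auxiliary factor has the sign of `1 - y`, the cube of the force that of
`y - 1`, and the prefactor `-2` makes the quotient nonnegative. The two sides are glued at 1 by
continuity. -/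
lemma monotoneOn_relDefect (hq : -1 < q) (hq1 : q < 1) : MonotoneOn (relDefect q) (Ioi 0) := by
  have hψ1 : (1 - 1) * (2 - (1 - q) * canonicalForce q 1) - 2 * canonicalForce q 1 = 0 := by
    simp [canonicalForce_one]
  have h1 : MonotoneOn (relDefect q) (Ioc 0 1) := by
    apply monotoneOn_of_deriv_nonneg (convex_Ioc 0 1)
    · exact (continuousOn_relDefect hq).mono Ioc_subset_Ioi_self
    · intro y hy
      rw [interior_Ioc] at hy
      exact (hasDerivAt_relDefect hq hy.1 hy.2.ne).differentiableAt.differentiableWithinAt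
    · intro y hy
      rw [interior_Ioc] at hy
      rw [(hasDerivAt_relDefect hq hy.1 hy.2.ne).deriv]
      have h2 := pos_left_of_deriv (fun y hy => hasDerivAt_monotone_aux hy) hψ1
        (fun y h0 h1 => mul_neg_of_pos_of_neg (by linarith) (monotone_aux_neg hq1 h0 h1.ne))
        hy.1 hy.2
      have h3 := canonicalForce_neg (q := q) hy.1 hy.2
      have h4 := Real.rpow_pos_of_pos hy.1 (q - 2)
      refine div_nonneg_of_nonpos ?_ ?_
      · have := mul_pos h4 h2
        linarith
      · have : canonicalForce q y ^ 3 < 0 := Odd.pow_neg (by decide) h3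
        exact (mul_neg_of_pos_of_neg (by linarith) this).le
  have h2 : MonotoneOn (relDefect q) (Ici 1) := by
    apply monotoneOn_of_deriv_nonneg (convex_Ici 1)
    · exact (continuousOn_relDefect hq).mono (fun y hy => mem_Ioi.2 (one_pos.trans_le hy))
    · intro y hy
      rw [interior_Ici] at hy
      exact (hasDerivAt_relDefect hq (one_pos.trans hy)
        (ne_of_gt hy)).differentiableAt.differentiableWithinAt
    · intro y hy
      rw [interior_Ici] at hy
      have hy0 : 0 < y := one_pos.trans hy
      rw [(hasDerivAt_relDefect hq hy0 (ne_of_gt hy)).deriv]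
      have h2 := neg_right_of_deriv (fun y hy => hasDerivAt_monotone_aux hy) hψ1
        (fun y h1 => mul_neg_of_pos_of_neg (by linarith)
          (monotone_aux_neg hq1 (one_pos.trans h1) h1.ne')) hy
      have h3 := canonicalForce_pos (q := q) hy
      have h4 := Real.rpow_pos_of_pos hy0 (q - 2)
      have h5 : 0 < q + 1 := by linarith
      refine div_nonneg ?_ (by positivity)
      have := mul_neg_of_pos_of_neg h4 h2
      linarith
  have h3 := h1.union_right h2 (c := 1) ⟨⟨one_pos, le_rfl⟩, fun y hy => hy.2⟩
    ⟨mem_Ici.2 le_rfl, fun y hy => hy⟩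
  rwa [Ioc_union_Ici_eq_Ioi one_pos] at h3

/-- The coefficient `(1 - q) / 6` makes both sides agree to first order at `y = 1`; the force term
disappears after integration over a turn. Multiplied by `(q + 1) R²`, the difference becomes the
function of `hΛ`; successive derivatives, stripped of positive factors, lead to those of `hκ` and
`hτ`, and the last is negative because `3 q - 1 < 0`. -/
lemma mul_relDefect_lt (hq : -1 < q) (hq1 : q ≤ 0) {y : ℝ} (hy : 0 < y) (h : y ≠ 1) :
    y * relDefect q y <
      (1 - q) * (well q y / canonicalForce q y) - (1 - q) / 6 * canonicalForce q y := by
  have hpos : ∀ y : ℝ, 0 < y → 0 < (1 - q) * y ^ (q - 2) := fun y hy =>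
    mul_pos (by linarith) (Real.rpow_pos_of_pos hy _)
  have hτ : ∀ y, 0 < y → HasDerivAt
      (fun y => canonicalForce q y - (y - 1) + (3 * q - 1) / 2 * canonicalForce q y ^ 2)
      (y ^ (q - 1) - 1 + (3 * q - 1) * canonicalForce q y * y ^ (q - 1)) y := by
    intro y hy
    have hR := hasDerivAt_canonicalForce q hy
    refine ((hR.sub ((hasDerivAt_id y).sub_const 1)).add
      ((hR.pow 2).const_mul ((3 * q - 1) / 2))).congr_deriv ?_
    simp; ring
  have hτn : ∀ y, 0 < y → y ≠ 1 →
      canonicalForce q y - (y - 1) + (3 * q - 1) / 2 * canonicalForce q y ^ 2 < 0 := by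
    intro y hy h
    have h1 : canonicalForce q 1 - (1 - 1) + (3 * q - 1) / 2 * canonicalForce q 1 ^ 2 = 0 := by
      simp [canonicalForce_one]
    rcases lt_or_gt_of_ne h with h2 | h2
    · refine neg_left_of_deriv hτ h1 (fun y h0 h1 => ?_) hy h2
      have h3 : 1 < y ^ (q - 1) :=
        Real.one_lt_rpow_of_pos_of_lt_one_of_neg h0 h1 (by linarith)
      have h4 := canonicalForce_neg (q := q) h0 h1
      have h5 : 0 < (3 * q - 1) * canonicalForce q y := mul_pos_of_neg_of_neg (by linarith) h4
      have := mul_pos h5 (one_pos.trans h3)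
      linarith
    · refine neg_right_of_deriv hτ h1 (fun y h1 => ?_) h2
      have h3 : y ^ (q - 1) < 1 := Real.rpow_lt_one_of_one_lt_of_neg h1 (by linarith)
      have h4 := canonicalForce_pos (q := q) h1
      have h5 : (3 * q - 1) * canonicalForce q y < 0 := mul_neg_of_neg_of_pos (by linarith) h4
      have := mul_neg_of_neg_of_pos h5 (Real.rpow_pos_of_pos (one_pos.trans h1) (q - 1))
      linarith
  have hκ : ∀ y, 0 < y → HasDerivAt
      (fun y => 1 - (1 - q) * canonicalForce q y - y ^ (q - 1)
        + (1 - q) / 2 * (canonicalForce q y ^ 2 * y ^ (q - 1)))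
      ((1 - q) * y ^ (q - 2) *
        (canonicalForce q y - (y - 1) + (3 * q - 1) / 2 * canonicalForce q y ^ 2)) y := by
    intro y hy
    refine ((hasDerivAt_monotone_aux2 hy).add ((((hasDerivAt_canonicalForce q hy).pow 2).mul
      (hasDerivAt_rpow_sub_one q hy)).const_mul ((1 - q) / 2))).congr_deriv ?_
    have h2 := mul_rpow_sub_one q hy
    rw [rpow_sub_one_eq q hy] at h2 ⊢
    simp
    linear_combination (1 - q) * canonicalForce q y * y ^ (q - 2) * h2
  have hκ1 : 1 - (1 - q) * canonicalForce q 1 - (1 : ℝ) ^ (q - 1)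
        + (1 - q) / 2 * (canonicalForce q 1 ^ 2 * (1 : ℝ) ^ (q - 1)) = 0 := by
    simp [canonicalForce_one]
  have hΛ : ∀ y, 0 < y → HasDerivAt
      (fun y => (y - 1) * (2 - (1 - q) * canonicalForce q y) - 2 * canonicalForce q y
        + (1 - q ^ 2) / 6 * canonicalForce q y ^ 3)
      ((1 + q) * (1 - (1 - q) * canonicalForce q y - y ^ (q - 1)
        + (1 - q) / 2 * (canonicalForce q y ^ 2 * y ^ (q - 1)))) y := by
    intro y hy
    refine ((hasDerivAt_monotone_aux hy).add (((hasDerivAt_canonicalForce q hy).pow 3).const_mul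
      ((1 - q ^ 2) / 6))).congr_deriv ?_
    simp; ring
  have hΛ1 : (1 - 1) * (2 - (1 - q) * canonicalForce q 1) - 2 * canonicalForce q 1
        + (1 - q ^ 2) / 6 * canonicalForce q 1 ^ 3 = 0 := by
    simp [canonicalForce_one]
  have key : (y - 1) * (2 - (1 - q) * canonicalForce q y) - 2 * canonicalForce q y
        + (1 - q ^ 2) / 6 * canonicalForce q y ^ 3 < 0 := by
    rcases lt_or_gt_of_ne h with h2 | h2
    · refine neg_left_of_deriv hΛ hΛ1 (fun y h0 h1 => mul_pos (by linarith) ?_) hy h2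
      exact pos_left_of_deriv hκ hκ1 (fun y h0 h1 =>
        mul_neg_of_pos_of_neg (hpos y h0) (hτn y h0 h1.ne)) h0 h1
    · refine neg_right_of_deriv hΛ hΛ1 (fun y h1 =>
        mul_neg_of_pos_of_neg (by linarith) ?_) h2
      exact neg_right_of_deriv hκ hκ1 (fun y h1 =>
        mul_neg_of_pos_of_neg (hpos y (one_pos.trans h1)) (hτn y (one_pos.trans h1) h1.ne')) h1
  have hR := canonicalForce_ne_zero (q := q) hy h
  have hc : 0 < (q + 1) * canonicalForce q y ^ 2 := by
    have : 0 < q + 1 := by linarith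
    positivity
  have h1 := mul_defect hq hy
  have h2 := well_mul hq y
  have h3 := relDefect_mul_sq (q := q) hy
  have h4 := well_div_force_mul (q := q) hy
  rw [← sub_neg]
  refine neg_of_mul_neg_left (b := (q + 1) * canonicalForce q y ^ 2) ?_ hc.le
  refine lt_of_eq_of_lt ?_ key
  linear_combination (q + 1) * y * h3 + h1 - (1 - q) * (q + 1) * canonicalForce q y * h4
    - (1 - q) * canonicalForce q y * h2

end NonposExponent

/-! ### Pointwise inequalities for exponents at least two -/

lemma hasDerivAt_rpow_sub {p : ℝ} {y : ℝ} (hy : 0 < y) {T : ℝ → ℝ} {T' : ℝ}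
    (hT : HasDerivAt T T' y) :
    HasDerivAt (fun y : ℝ => y ^ p - T y) (p * y ^ (p - 1) - T') y :=
  (Real.hasDerivAt_rpow_const (Or.inl hy.ne')).sub hT

/-- The bottom of a ladder of Taylor bounds at 1: each of the quadratic, cubic and quartic bounds
has the preceding one as the sign of its derivative. -/
lemma one_add_mul_le_rpow_of_nonpos {s y : ℝ} (hs : s ≤ 0) (hy : 0 < y) :
    1 + s * (y - 1) ≤ y ^ s := by
  have hd : ∀ y : ℝ, 0 < y → HasDerivAt (fun y : ℝ => y ^ s - (1 + s * (y - 1)))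
      (s * y ^ (s - 1) - s) y := fun y hy => hasDerivAt_rpow_sub hy (by
        simpa using (((hasDerivAt_id y).sub_const 1).const_mul s).const_add 1)
  have h1 : (1 : ℝ) ^ s - (1 + s * (1 - 1)) = 0 := by simp
  rcases lt_trichotomy y 1 with h | h | h
  · have := nonneg_left_of_deriv hd h1 (fun y h0 h1 => by
      have := Real.one_le_rpow_of_pos_of_le_one_of_nonpos h0 h1.le (show s - 1 ≤ 0 by linarith)
      nlinarith) hy h
    linarith
  · simp [h]
  · have := nonneg_right_of_deriv hd h1 (fun y h1 => by
      have := Real.rpow_le_one_of_one_le_of_nonpos h1.le (show s - 1 ≤ 0 by linarith)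
      nlinarith) h
    linarith

lemma quadratic_taylor_rpow {s : ℝ} (hs : 0 ≤ s) (hs1 : s ≤ 1) {y : ℝ} (hy : 0 < y) :
    (1 < y → 1 + s * (y - 1) + s * (s - 1) / 2 * (y - 1) ^ 2 ≤ y ^ s) ∧
    (y < 1 → y ^ s ≤ 1 + s * (y - 1) + s * (s - 1) / 2 * (y - 1) ^ 2) := by
  have hd : ∀ y : ℝ, 0 < y → HasDerivAt
      (fun y : ℝ => y ^ s - (1 + s * (y - 1) + s * (s - 1) / 2 * (y - 1) ^ 2))
      (s * y ^ (s - 1) - (s + s * (s - 1) * (y - 1))) y := fun y hy => hasDerivAt_rpow_sub hy (by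
        have h := (hasDerivAt_id y).sub_const 1
        refine (((h.const_mul s).const_add 1).add
          ((h.pow 2).const_mul (s * (s - 1) / 2))).congr_deriv ?_
        simp; ring)
  have h1 : (1 : ℝ) ^ s - (1 + s * (1 - 1) + s * (s - 1) / 2 * (1 - 1) ^ 2) = 0 := by simp
  have hd0 : ∀ y : ℝ, 0 < y → 0 ≤ s * y ^ (s - 1) - (s + s * (s - 1) * (y - 1)) := by
    intro y hy
    have := one_add_mul_le_rpow_of_nonpos (show s - 1 ≤ 0 by linarith) hy
    nlinarith
  constructor
  · intro h
    have := nonneg_right_of_deriv hd h1 (fun y h1 => hd0 y (one_pos.trans h1)) h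
    linarith
  · intro h
    have := nonneg_left_of_deriv (fun y hy => (hd y hy).neg) (by simp)
      (fun y h0 _ => neg_nonpos.2 (hd0 y h0)) hy h
    simp only [Pi.neg_apply] at this
    linarith

lemma cubic_taylor_rpow {p : ℝ} (hp : 1 ≤ p) (hp2 : p ≤ 2) {y : ℝ} (hy : 0 < y) :
    1 + p * (y - 1) + p * (p - 1) / 2 * (y - 1) ^ 2 + p * (p - 1) * (p - 2) / 6 * (y - 1) ^ 3
      ≤ y ^ p := by
  have hd : ∀ y : ℝ, 0 < y → HasDerivAt
      (fun y : ℝ => y ^ p - (1 + p * (y - 1) + p * (p - 1) / 2 * (y - 1) ^ 2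
        + p * (p - 1) * (p - 2) / 6 * (y - 1) ^ 3))
      (p * y ^ (p - 1) - (p + p * (p - 1) * (y - 1) + p * (p - 1) * (p - 2) / 2 * (y - 1) ^ 2)) y :=
      fun y hy => hasDerivAt_rpow_sub hy (by
        have h := (hasDerivAt_id y).sub_const 1
        refine ((((h.const_mul p).const_add 1).add
          ((h.pow 2).const_mul (p * (p - 1) / 2))).add
          ((h.pow 3).const_mul (p * (p - 1) * (p - 2) / 6))).congr_deriv ?_
        simp; ring)
  have h1 : (1 : ℝ) ^ p - (1 + p * (1 - 1) + p * (p - 1) / 2 * (1 - 1) ^ 2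
        + p * (p - 1) * (p - 2) / 6 * (1 - 1) ^ 3) = 0 := by simp
  rcases lt_trichotomy y 1 with h | h | h
  · have := nonneg_left_of_deriv hd h1 (fun y h0 h1 => by
      have := (quadratic_taylor_rpow (show 0 ≤ p - 1 by linarith) (by linarith) h0).2 h1
      nlinarith) hy h
    linarith
  · simp [h]
  · have := nonneg_right_of_deriv hd h1 (fun y h1 => by
      have := (quadratic_taylor_rpow (show 0 ≤ p - 1 by linarith) (by linarith)
        (one_pos.trans h1)).1 h1
      nlinarith) h
    linarith

section

variable {q : ℝ}

lemma quartic_le_force (hq : 2 ≤ q) (hq3 : q ≤ 3) {y : ℝ} (hy : 1 < y) :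
    (y - 1) + (q - 1) / 2 * (y - 1) ^ 2 + (q - 1) * (q - 2) / 6 * (y - 1) ^ 3
      + (q - 1) * (q - 2) * (q - 3) / 24 * (y - 1) ^ 4 ≤ canonicalForce q y := by
  have hd : ∀ y : ℝ, 0 < y → HasDerivAt (fun y : ℝ => canonicalForce q y -
      ((y - 1) + (q - 1) / 2 * (y - 1) ^ 2 + (q - 1) * (q - 2) / 6 * (y - 1) ^ 3
        + (q - 1) * (q - 2) * (q - 3) / 24 * (y - 1) ^ 4))
      (y ^ (q - 1) - (1 + (q - 1) * (y - 1) + (q - 1) * (q - 2) / 2 * (y - 1) ^ 2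
        + (q - 1) * (q - 2) * (q - 3) / 6 * (y - 1) ^ 3)) y := by
    intro y hy
    have h := (hasDerivAt_id y).sub_const 1
    refine ((hasDerivAt_canonicalForce q hy).sub (((h.add
      ((h.pow 2).const_mul ((q - 1) / 2))).add
      ((h.pow 3).const_mul ((q - 1) * (q - 2) / 6))).add
      ((h.pow 4).const_mul ((q - 1) * (q - 2) * (q - 3) / 24)))).congr_deriv ?_
    simp; ring
  have := nonneg_right_of_deriv hd (by simp [canonicalForce_one]) (fun y h1 => by
    have := cubic_taylor_rpow (show 1 ≤ q - 1 by linarith) (by linarith) (one_pos.trans h1)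
    rw [show q - 1 - 1 = q - 2 by ring, show q - 1 - 2 = q - 3 by ring] at this
    linarith) hy
  linarith

lemma quadratic_le_force_right (hq : 2 ≤ q) {y : ℝ} (hy : 1 < y) :
    (y - 1) + (q - 1) / 2 * (y - 1) ^ 2 ≤ canonicalForce q y := by
  have hd : ∀ y : ℝ, 0 < y → HasDerivAt (fun y : ℝ => canonicalForce q y -
      ((y - 1) + (q - 1) / 2 * (y - 1) ^ 2)) (y ^ (q - 1) - (1 + (q - 1) * (y - 1))) y := by
    intro y hy
    have h := (hasDerivAt_id y).sub_const 1
    refine ((hasDerivAt_canonicalForce q hy).sub (h.add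
      ((h.pow 2).const_mul ((q - 1) / 2)))).congr_deriv ?_
    simp; ring
  have := nonneg_right_of_deriv hd (by simp [canonicalForce_one]) (fun y h1 => by
    have := one_add_mul_self_le_rpow_one_add (s := y - 1) (by linarith)
      (show 1 ≤ q - 1 by linarith)
    rw [show 1 + (y - 1) = y by ring] at this
    linarith) hy
  linarith

lemma quadratic_le_force_left (hq : 2 ≤ q) {y : ℝ} (h0 : 0 < y) (hy : y < 1) :
    (y - 1) + 1 / 2 * (y - 1) ^ 2 ≤ canonicalForce q y := by
  have hd : ∀ y : ℝ, 0 < y → HasDerivAt (fun y : ℝ => canonicalForce q y -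
      ((y - 1) + 1 / 2 * (y - 1) ^ 2)) (y ^ (q - 1) - y) y := by
    intro y hy
    have h := (hasDerivAt_id y).sub_const 1
    refine ((hasDerivAt_canonicalForce q hy).sub (h.add
      ((h.pow 2).const_mul (1 / 2)))).congr_deriv ?_
    simp
  have := nonneg_left_of_deriv hd (by simp [canonicalForce_one]) (fun y h0 h1 => by
    have := Real.rpow_le_rpow_of_exponent_ge h0 h1.le (show 1 ≤ q - 1 by linarith)
    rw [Real.rpow_one] at this
    linarith) h0 hy
  linarith

lemma sub_one_lt_force (hq : 2 ≤ q) {y : ℝ} (h0 : 0 < y) (hy : y ≠ 1) :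
    y - 1 < canonicalForce q y := by
  rcases lt_or_gt_of_ne hy with h | h
  · have := quadratic_le_force_left hq h0 h
    nlinarith
  · have := quadratic_le_force_right hq h
    nlinarith [mul_pos (show 0 < q - 1 by linarith) (pow_pos (sub_pos.2 h) 2)]

/-- Twice the left side is the difference in `relDefect_combination_le` multiplied by `(q + 1) y
R²`. Taylor bounds for the force reduce it to a polynomial whose leading factor is `(q - 1) (q - 2)
(y - 1)⁴`. The condition that the force is below 1 limits how far `y` exceeds 1. -/
lemma force_quadratic_nonpos (hq : 2 ≤ q) (hq3 : q < 3) {y : ℝ} (h0 : 0 < y)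
    (hy1 : canonicalForce q y < 1) :
    -(2 / 3) * (q - 1) * (q - 2) * (y - 1) * y * canonicalForce q y ^ 2
      + ((q - 1) * (q - 2) * (y - 1) ^ 2 - 2) * canonicalForce q y
      + (y - 1) * ((q - 1) * (y - 1) + 2) ≤ 0 := by
  rcases lt_trichotomy y 1 with h | h | h
  · have hR := quadratic_le_force_left hq h0 h
    have hR0 := canonicalForce_neg (q := q) h0 h
    have ht := cubic_taylor_rpow (show 1 ≤ q - 1 by linarith) (by linarith) h0
    have h2 := mul_rpow_sub_one q h0
    set R := canonicalForce q y
    -- Below 1 the terms linear in `R` are traded for `t = y^(q-1)` by multiplying by `q` and using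
    -- `y t = 1 + q R`; the cubic Taylor bound then applies to `t`.
    obtain ⟨p, hp⟩ : ∃ p, p = q - 1 := ⟨_, rfl⟩
    obtain ⟨ξ, hξ⟩ : ∃ ξ, ξ = 1 - y := ⟨_, rfl⟩
    obtain ⟨t, hT⟩ : ∃ t, t = y ^ (q - 1) := ⟨_, rfl⟩
    rw [← hT, ← hp] at ht
    rw [← hT] at h2
    have hq' : q = p + 1 := by linarith
    have hy' : y = 1 - ξ := by linarith
    subst hq' hy'
    have hξ0 : 0 < ξ := by linarith
    have hξ1 : ξ < 1 := by linarith
    have hp1 : 1 ≤ p := by linarith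
    have hp2 : p < 2 := by linarith
    have hpp : 0 ≤ p * (p - 1) := mul_nonneg (by linarith) (by linarith)
    have hR2 : R ^ 2 ≤ (ξ * (1 - ξ / 2)) ^ 2 := by
      rw [← neg_sq R]
      exact pow_le_pow_left₀ (by linarith) (by nlinarith) 2
    have hc : 0 ≤ 2 - p * (p - 1) * ξ ^ 2 := by
      have : p * (p - 1) ≤ 2 := by nlinarith
      have : ξ ^ 2 ≤ 1 := by nlinarith
      nlinarith
    have hA : (2 / 3) * (p * (p - 1)) * (p + 1) * ξ * R ^ 2 ≤
        (2 / 3) * (p * (p - 1)) * (p + 1) * ξ * (ξ * (1 - ξ / 2)) ^ 2 :=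
      mul_le_mul_of_nonneg_left hR2 (by positivity)
    have hB := mul_le_mul_of_nonneg_right ht hc
    have hC : 0 ≤ (2 / 3) * (p + 1) - p * (p - 1) / 2
        - ξ * ((p + 1) + (2 - p) * (p * (p - 1))) / 6 := by
      have h1 : p * (p - 1) ≤ 2 * (p - 1) := by nlinarith
      have h3 : (2 - p) * (p * (p - 1)) ≤ p - 1 := by
        have : (2 - p) * p ≤ 1 := by nlinarith [sq_nonneg (p - 1)]
        nlinarith
      have h4 : 0 ≤ (2 - p) * (p * (p - 1)) := mul_nonneg (by linarith) hpp
      nlinarith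
    have hD : 0 ≤ p * (p - 1) * ξ ^ 4 * ((2 / 3) * (p + 1) - p * (p - 1) / 2
        - ξ * ((p + 1) + (2 - p) * (p * (p - 1))) / 6) := mul_nonneg (by positivity) hC
    have key : (2 / 3) * (p * (p - 1)) * (p + 1) * ξ * R ^ 2 - 2 * (p - 1) + 2 * p * (1 - ξ)
        - t * (2 - p * (p - 1) * ξ ^ 2) ≤ 0 := by
      linarith [hA, hB, hD]
    have h5 : 0 < p + 1 := by linarith
    refine nonpos_of_mul_nonpos_right (a := p + 1) ?_ h5
    have := mul_nonpos_of_nonneg_of_nonpos h0.le key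
    refine le_trans (le_of_eq ?_) this
    linear_combination (2 - p * (p - 1) * ξ ^ 2) * h2
  · rw [h, canonicalForce_one]; simp
  · have hR := quartic_le_force hq hq3.le h
    have hR2 := quadratic_le_force_right hq h
    set R := canonicalForce q y
    obtain ⟨p, hp⟩ : ∃ p, p = q - 1 := ⟨_, rfl⟩
    obtain ⟨x, hx⟩ : ∃ x, x = y - 1 := ⟨_, rfl⟩
    have hq' : q = p + 1 := by linarith
    have hy' : y = 1 + x := by linarith
    subst hq' hy'
    have hx0 : 0 < x := by linarith
    have hp1 : 1 ≤ p := by linarith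
    have hp2 : p < 2 := by linarith
    simp only [add_sub_cancel_left, add_sub_cancel_right] at hR hR2 ⊢
    rw [show p + 1 - 2 = p - 1 by ring] at hR ⊢
    rw [show p + 1 - 3 = p - 2 by ring] at hR
    have hpp : 0 ≤ p * (p - 1) := mul_nonneg (by linarith) (by linarith)
    -- The quadratic lower bound for `R` and `R < 1` confine `x`, which fixes the sign of the
    -- coefficient multiplying the quartic bound.
    have hx1 : x < 1 := by nlinarith [mul_pos (show 0 < p by linarith) (pow_pos hx0 2)]
    have hc : 0 ≤ 2 - p * (p - 1) * x ^ 2 := by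
      have : p * (p - 1) ≤ 2 := by nlinarith
      have : x ^ 2 ≤ 1 := by nlinarith
      nlinarith
    have hRsq : (x + p / 2 * x ^ 2) ^ 2 ≤ R ^ 2 := pow_le_pow_left₀ (by positivity) hR2 2
    have hA : (2 / 3) * (p * (p - 1)) * x * (1 + x) * (x + p / 2 * x ^ 2) ^ 2 ≤
        (2 / 3) * (p * (p - 1)) * x * (1 + x) * R ^ 2 :=
      mul_le_mul_of_nonneg_left hRsq (by positivity)
    have hB := mul_le_mul_of_nonneg_right hR hc
    have h2p : 0 ≤ 2 - p := by linarith
    have hD : 0 ≤ p * (p - 1) * x ^ 4 * ((1 / 2 + p / 4) + 5 * p / 6 * x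
        + (p ^ 2 / 6 + p * (p - 1) * (2 - p) / 24) * x ^ 2) := by
      have : 0 ≤ p * (p - 1) * (2 - p) := mul_nonneg hpp h2p
      positivity
    linarith [hA, hB, hD]

/-- The left side is the integrand of `w ((3 - q) P' + (q - 1) A')`, since `2 + (q - 1) (y - 1) = (3
- q) + (q - 1) y`. The slope on the right is the first-order coefficient at `y = 1`. -/
lemma relDefect_combination_le (hq : 2 ≤ q) (hq3 : q < 3) {y : ℝ} (h0 : 0 < y)
    (hy1 : canonicalForce q y < 1) :
    2 * relDefect q y + (q - 1) * (2 * (well q y / canonicalForce q y) + (y - 1) * relDefect q y)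
      ≤ (q - 1) / 3 * (y - 1) := by
  by_cases h : y = 1
  · rw [h, relDefect_one, well_one]; simp
  have hq' : -1 < q := by linarith
  have hR := canonicalForce_ne_zero (q := q) h0 h
  have hc : 0 < (q + 1) * y * canonicalForce q y ^ 2 := by
    have : 0 < q + 1 := by linarith
    positivity
  have h1 := mul_defect hq' h0
  have h2 := well_mul hq' y
  have h3 := relDefect_mul_sq (q := q) h0
  have h4 := well_div_force_mul (q := q) h0
  have key := force_quadratic_nonpos hq hq3 h0 hy1
  rw [← sub_nonpos]
  refine nonpos_of_mul_nonpos_right (a := (q + 1) * y * canonicalForce q y ^ 2) ?_ hc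
  have key2 := mul_nonpos_of_nonneg_of_nonpos (zero_le_two (α := ℝ)) key
  refine le_trans (le_of_eq ?_) key2
  linear_combination (q + 1) * y * (2 + (q - 1) * (y - 1)) * h3 + (2 + (q - 1) * (y - 1)) * h1
    + 2 * (q - 1) * (q + 1) * y * canonicalForce q y * h4
    + 2 * (q - 1) * y * canonicalForce q y * h2

end

/-! ### Monotonicity of the scaled period -/

section Turn

variable {q w : ℝ} {f g : ℝ → ℝ}

lemma profile_orbit_pos (hq : -1 < q) (hw : w ∈ Ioo 0 (maxAmp q)) (θ : ℝ) :
    0 < profile q (w * Real.sin θ) := profile_pos hq (neg_lt_amp_mul_sin' hw θ)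

/-- Along an orbit inside the separatrix `(q + 1) U < 1`, while `(q + 1) U = y (R - 1) + 1`. -/
lemma force_orbit_lt_one (hq : -1 < q) (hw : w ∈ Ioo 0 (maxAmp q)) (θ : ℝ) :
    canonicalForce q (profile q (w * Real.sin θ)) < 1 := by
  have h0 := profile_orbit_pos hq hw θ
  have h1 := well_mul hq (profile q (w * Real.sin θ))
  rw [well_profile hq (neg_lt_amp_mul_sin' hw θ).le] at h1
  have h2 := Real.sin_sq_le_one θ
  have h3 := maxAmp_sq hq
  have h4 : (w * Real.sin θ) ^ 2 < 1 / (q + 1) := by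
    rw [← h3, mul_pow]; nlinarith [hw.1, hw.2, sq_nonneg w]
  have h5 : (q + 1) * (w * Real.sin θ) ^ 2 < 1 := by
    rw [lt_div_iff₀ (by linarith)] at h4; linarith
  by_contra h
  push Not at h
  nlinarith

lemma continuous_turn (hq : -1 < q) (hw : w ∈ Ioo 0 (maxAmp q)) (hf : ContinuousOn f (Ioi 0)) :
    Continuous fun θ => (√2)⁻¹ *
      (f (profile q (w * Real.sin θ)) * profileDeriv q (w * Real.sin θ)) := by
  have h1 : Continuous fun θ => f (profile q (w * Real.sin θ)) :=
    hf.comp_continuous ((continuous_profile hq).comp (by fun_prop))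
      fun θ => profile_orbit_pos hq hw θ
  have h2 : Continuous fun θ => profileDeriv q (w * Real.sin θ) :=
    continuous_comp_amp_mul_sin hw fun z hz => continuousAt_profileDeriv hq hz
  exact continuous_const.mul (h1.mul h2)

lemma turnIntegral_linear (hq : -1 < q) (hw : w ∈ Ioo 0 (maxAmp q))
    (hf : ContinuousOn f (Ioi 0)) (hg : ContinuousOn g (Ioi 0)) (a b : ℝ) :
    turnIntegral q (fun y => a * f y + b * g y) w =
      a * turnIntegral q f w + b * turnIntegral q g w := by
  unfold turnIntegral
  rw [← intervalIntegral.integral_const_mul, ← intervalIntegral.integral_const_mul,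
    ← intervalIntegral.integral_add
      (((continuous_turn hq hw hf).intervalIntegrable _ _).const_mul a)
      (((continuous_turn hq hw hg).intervalIntegrable _ _).const_mul b)]
  refine intervalIntegral.integral_congr fun θ _ => ?_
  ring

lemma continuousOn_linear (hf : ContinuousOn f (Ioi 0)) (hg : ContinuousOn g (Ioi 0)) (a b : ℝ) :
    ContinuousOn (fun y => a * f y + b * g y) (Ioi 0) :=
  (continuousOn_const.mul hf).add (continuousOn_const.mul hg)

lemma turnIntegral_one : turnIntegral q (fun _ => 1) w = period q w := by
  simp [turnIntegral, period]

lemma turnIntegral_id : turnIntegral q (fun y => y) w = area q w := rfl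

/-- The force is minus the time derivative of the velocity. Hence multiples of it may be added to
pointwise bounds at no cost. -/
lemma turnIntegral_force (hq : -1 < q) (hw : w ∈ Ioo 0 (maxAmp q)) :
    turnIntegral q (canonicalForce q) w = 0 := by
  have h1 : turnIntegral q (canonicalForce q) w =
      ∫ θ in (-(Real.pi / 2))..(3 * Real.pi / 2), (√2)⁻¹ * 2 * w * Real.sin θ := by
    refine intervalIntegral.integral_congr fun θ _ => ?_
    have := profileDeriv_mul_force hq (neg_lt_amp_mul_sin' hw θ)
    linear_combination (√2)⁻¹ * this
  rw [h1, intervalIntegral.integral_const_mul, integral_sin, cos_turn_start, cos_turn_end]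
  simp

lemma turnIntegral_mono (hq : -1 < q) (hw : w ∈ Ioo 0 (maxAmp q)) (hf : ContinuousOn f (Ioi 0))
    (hg : ContinuousOn g (Ioi 0)) (h : ∀ y, 0 < y → canonicalForce q y < 1 → f y ≤ g y) :
    turnIntegral q f w ≤ turnIntegral q g w := by
  refine intervalIntegral.integral_mono_on turn_le
    ((continuous_turn hq hw hf).intervalIntegrable _ _)
    ((continuous_turn hq hw hg).intervalIntegrable _ _) fun θ _ => ?_
  have h1 := h _ (profile_orbit_pos hq hw θ) (force_orbit_lt_one hq hw θ)
  have h2 := profileDeriv_pos hq (w * Real.sin θ)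
  gcongr

lemma turnIntegral_lt (hq : -1 < q) (hw : w ∈ Ioo 0 (maxAmp q)) (hf : ContinuousOn f (Ioi 0))
    (hg : ContinuousOn g (Ioi 0)) (h : ∀ y, 0 < y → y ≠ 1 → f y < g y) :
    turnIntegral q f w < turnIntegral q g w := by
  have hpi := Real.pi_pos
  have h1 : f 1 ≤ g 1 := by
    have hm : (1 : ℝ) ∈ closure (Ioi 1) := by rw [closure_Ioi]; exact mem_Ici.2 le_rfl
    refine ContinuousWithinAt.closure_le hm
      ((hf 1 (mem_Ioi.2 one_pos)).mono (Ioi_subset_Ioi zero_le_one))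
      ((hg 1 (mem_Ioi.2 one_pos)).mono (Ioi_subset_Ioi zero_le_one))
      fun y hy => (h y (one_pos.trans hy) (ne_of_gt hy)).le
  have h2 : ∀ y, 0 < y → f y ≤ g y := fun y hy => by
    by_cases hy1 : y = 1
    · rwa [hy1]
    · exact (h y hy hy1).le
  refine intervalIntegral.integral_lt_integral_of_continuousOn_of_le_of_exists_lt
    (by linarith) (continuous_turn hq hw hf).continuousOn (continuous_turn hq hw hg).continuousOn
    (fun θ _ => ?_) ⟨Real.pi / 2, ⟨by linarith, by linarith⟩, ?_⟩
  · have h1 := h2 _ (profile_orbit_pos hq hw θ)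
    have h2 := profileDeriv_pos hq (w * Real.sin θ)
    gcongr
  · have h3 := h _ (profile_orbit_pos hq hw (Real.pi / 2)) (profile_ne_one hq (by
      rw [Real.sin_pi_div_two, mul_one]; exact hw.1.ne'))
    have h4 := profileDeriv_pos hq (w * Real.sin (Real.pi / 2))
    gcongr

end Turn

/-! ### Sign of the slope of the scaled period, by ranges of the exponent -/

section Slope

variable {q w : ℝ}

lemma continuousOn_mul_relDefect (hq : -1 < q) :
    ContinuousOn (fun y => y * relDefect q y) (Ioi 0) :=
  continuousOn_id.mul (continuousOn_relDefect hq)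

lemma deriv_area_eq_turn (hq : -1 < q) (hw : w ∈ Ioo 0 (maxAmp q)) :
    w * deriv (area q) w = 2 * turnIntegral q (fun y => well q y / canonicalForce q y) w +
      turnIntegral q (fun y => y * relDefect q y) w := by
  have h1 : (fun y => 2 * well q y / canonicalForce q y + y * relDefect q y) =
      fun y => 2 * (well q y / canonicalForce q y) + 1 * (y * relDefect q y) := by
    funext y; ring
  rw [(hasDerivAt_area hq hw).deriv, mul_div_cancel₀ _ hw.1.ne', h1,
    turnIntegral_linear hq hw (continuousOn_well_div_force hq)
      (continuousOn_mul_relDefect hq), one_mul]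

lemma deriv_period_eq_turn (hq : -1 < q) (hw : w ∈ Ioo 0 (maxAmp q)) :
    w * deriv (period q) w = turnIntegral q (relDefect q) w := by
  rw [(hasDerivAt_period hq hw).deriv, mul_div_cancel₀ _ hw.1.ne']

lemma deriv_area_eq (hq : -1 < q) (hw : w ∈ Ioo 0 (maxAmp q)) :
    deriv (area q) w = (1 - q) * w * period q w - (q + 1) * level q w * deriv (period q) w := by
  have hP := hasDerivAt_period hq hw
  have hJ := hasDerivAt_action hq hw
  have hl : HasDerivAt (level q) (2 * w) w := by
    have := ((hasDerivAt_id w).pow 2).sub_const (1 / (q + 1))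
    exact this.congr_deriv (by simp)
  rw [← hP.deriv] at hP
  have h1 := (hJ.const_mul ((q + 3) / 2)).sub ((hl.const_mul (q + 1)).mul hP)
  have h2 : HasDerivAt (area q) _ w := h1.congr_of_eventuallyEq (by
    filter_upwards [Ioo_mem_nhds hw.1 hw.2] with v hv
    exact area_eq hq ⟨hv.1, hv.2.le⟩)
  rw [h2.deriv]
  ring

/-- Inserting `area_eq` and its derivative turns the expression into `P' ((9 - q²) / 2 J - 2 (q + 1)
level P) - (q - 1)² w P²`. The bracket is positive since the level is negative. -/
lemma slope_neg_of_deriv_period_nonpos (hq : -1 < q) (hq3 : q < 3) (hq1 : q ≠ 1)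
    (hw : w ∈ Ioo 0 (maxAmp q)) (h : deriv (period q) w ≤ 0) :
    (3 - q) * deriv (period q) w * area q w + (q - 1) * deriv (area q) w * period q w < 0 := by
  have hw' : w ∈ Ioc 0 (maxAmp q) := ⟨hw.1, hw.2.le⟩
  have hP := period_pos hq hw'
  have hl := level_neg hq hw
  have hJ := action_nonneg (w := w) hq
  rw [deriv_area_eq hq hw, area_eq hq hw']
  have h1 : 0 ≤ (9 - q ^ 2) / 2 * action q w :=
    mul_nonneg (by nlinarith) hJ
  have h2 : 0 < -(2 * (q + 1) * level q w * period q w) := by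
    have : 0 < (q + 1) * -level q w * period q w := by
      have : 0 < q + 1 := by linarith
      have : 0 < -level q w := by linarith
      positivity
    linarith
  have h3 : 0 < (q - 1) ^ 2 * w * period q w ^ 2 := by
    have := hw.1
    have : q - 1 ≠ 0 := sub_ne_zero.2 hq1
    positivity
  have h4 := mul_nonpos_of_nonpos_of_nonneg h (add_pos_of_nonneg_of_pos h1 h2).le
  linarith

/-- With `n` for `relDefect q`, the bound `hmean` reduces `w` times the expression to at most `2 P
(∫ y n - (1 - q) ∫ U / R)`, which `hlt` makes negative. -/
lemma slope_neg_of_nonpos (hq : -1 < q) (hq0 : q ≤ 0) (hw : w ∈ Ioo 0 (maxAmp q)) :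
    (3 - q) * deriv (period q) w * area q w + (q - 1) * deriv (area q) w * period q w < 0 := by
  have hw' : w ∈ Ioc 0 (maxAmp q) := ⟨hw.1, hw.2.le⟩
  have hP := period_pos hq hw'
  have hA := area_pos hq hw'
  have cn := continuousOn_relDefect hq
  have cyn := continuousOn_mul_relDefect hq
  have cy : ContinuousOn (fun y : ℝ => y) (Ioi 0) := continuousOn_id
  have c1 : ContinuousOn (fun _ : ℝ => (1 : ℝ)) (Ioi 0) := continuousOn_const
  have cu := continuousOn_well_div_force hq
  have cR := continuousOn_canonicalForce q
  -- Chebyshev's inequality: with the mean height `m = A / P` and `n` the increasing relative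
  -- defect, `(y - m) (n(y) - n(m)) ≥ 0` is integrated over a turn.
  have hmean : turnIntegral q (relDefect q) w * area q w ≤
      period q w * turnIntegral q (fun y => y * relDefect q y) w := by
    set m := area q w / period q w with hm
    have hm0 : 0 < m := div_pos hA hP
    have hmP : m * period q w = area q w := div_mul_cancel₀ _ hP.ne'
    have h1 := turnIntegral_mono (f := fun y => relDefect q m * y + -(relDefect q m * m) * 1)
      (g := fun y => 1 * (y * relDefect q y) + -m * relDefect q y) hq hw
      (continuousOn_linear cy c1 _ _) (continuousOn_linear cyn cn _ _) (fun y hy _ => by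
        rcases le_total y m with h | h
        · have := monotoneOn_relDefect hq (by linarith) hy hm0 h
          nlinarith
        · have := monotoneOn_relDefect hq (by linarith) hm0 hy h
          nlinarith)
    rw [turnIntegral_linear hq hw cy c1, turnIntegral_linear hq hw cyn cn, turnIntegral_one,
      turnIntegral_id] at h1
    have h2 : m * turnIntegral q (relDefect q) w ≤
        turnIntegral q (fun y => y * relDefect q y) w := by
      have h3 : relDefect q m * area q w + -(relDefect q m * m) * period q w = 0 := by
        rw [← hmP]; ring
      linarith
    have h3 := mul_le_mul_of_nonneg_left h2 hP.le
    rw [← hmP]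
    linarith
  have hlt : turnIntegral q (fun y => y * relDefect q y) w <
      (1 - q) * turnIntegral q (fun y => well q y / canonicalForce q y) w := by
    have h1 := turnIntegral_lt (g := fun y => (1 - q) * (well q y / canonicalForce q y) +
      -((1 - q) / 6) * canonicalForce q y) hq hw cyn (continuousOn_linear cu cR _ _)
      (fun y hy h => by have := mul_relDefect_lt hq hq0 hy h; linarith)
    rw [turnIntegral_linear hq hw cu cR, turnIntegral_force hq hw] at h1
    linarith
  have h1 := deriv_period_eq_turn hq hw
  have h2 := deriv_area_eq_turn hq hw
  rw [← h1] at hmean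
  refine neg_of_mul_neg_right (a := w) ?_ hw.1.le
  have h3 := mul_pos hP (sub_pos.2 hlt)
  have h4 := mul_le_mul_of_nonneg_left hmean (show 0 ≤ 3 - q by linarith)
  have h5 : w * ((3 - q) * deriv (period q) w * area q w + (q - 1) * deriv (area q) w * period q w)
    = (3 - q) * (w * deriv (period q) w * area q w) + (q - 1) * (w * deriv (area q) w) * period q w
    := by ring
  rw [h5, h2]
  linarith

lemma slope_neg_of_pos_of_lt_one (hq : 0 < q) (hq1 : q < 1) (hw : w ∈ Ioo 0 (maxAmp q)) :
    (3 - q) * deriv (period q) w * area q w + (q - 1) * deriv (area q) w * period q w < 0 := by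
  have hq' : -1 < q := by linarith
  refine slope_neg_of_deriv_period_nonpos hq' (by linarith) hq1.ne hw ?_
  have cR := continuousOn_canonicalForce q
  have h1 := turnIntegral_mono
    (g := fun y => (1 - q) / 3 * canonicalForce q y + 0 * canonicalForce q y) hq' hw
    (continuousOn_relDefect hq') (continuousOn_linear cR cR _ _)
    (fun y hy _ => by have := relDefect_le_of_pos hq hq1 hy; linarith)
  rw [turnIntegral_linear hq' hw cR cR, turnIntegral_force hq' hw, mul_zero, mul_zero, add_zero,
    ← deriv_period_eq_turn hq' hw] at h1
  exact nonpos_of_mul_nonpos_right h1 hw.1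

/-- When `P' > 0`, the inequality `A < P` (from `y - 1 < R` and `∫ R = 0`) allows `A` to be replaced
by `P` in the first term. What remains is `P ((3 - q) P' + (q - 1) A')`, governed by the combined
pointwise bound. -/
lemma slope_neg_of_two_le (hq : 2 ≤ q) (hq3 : q < 3) (hw : w ∈ Ioo 0 (maxAmp q)) :
    (3 - q) * deriv (period q) w * area q w + (q - 1) * deriv (area q) w * period q w < 0 := by
  have hq' : -1 < q := by linarith
  rcases le_or_gt (deriv (period q) w) 0 with hS | hS
  · exact slope_neg_of_deriv_period_nonpos hq' hq3 (by linarith) hw hS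
  have hP := period_pos hq' ⟨hw.1, hw.2.le⟩
  have cn := continuousOn_relDefect hq'
  have cyn := continuousOn_mul_relDefect hq'
  have cy : ContinuousOn (fun y : ℝ => y) (Ioi 0) := continuousOn_id
  have c1 : ContinuousOn (fun _ : ℝ => (1 : ℝ)) (Ioi 0) := continuousOn_const
  have cu := continuousOn_well_div_force hq'
  have cR := continuousOn_canonicalForce q
  have hAP : area q w < period q w := by
    have h1 := turnIntegral_lt (f := fun y => 1 * y + -1 * 1) hq' hw
      (continuousOn_linear cy c1 _ _) cR
      (fun y hy h => by have := sub_one_lt_force hq hy h; linarith)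
    rw [turnIntegral_linear hq' hw cy c1, turnIntegral_one, turnIntegral_id,
      turnIntegral_force hq' hw] at h1
    linarith
  have h1 := turnIntegral_mono
    (f := fun y => 1 * ((3 - q) * relDefect q y + (q - 1) * (y * relDefect q y)) +
      2 * (q - 1) * (well q y / canonicalForce q y))
    (g := fun y => (q - 1) / 3 * y + -((q - 1) / 3) * 1) hq' hw
    (continuousOn_linear (continuousOn_linear cn cyn _ _) cu _ _) (continuousOn_linear cy c1 _ _)
    (fun y hy hR => by have := relDefect_combination_le hq hq3 hy hR; linarith)
  have h2 := deriv_area_eq_turn hq' hw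
  rw [turnIntegral_linear hq' hw (continuousOn_linear cn cyn _ _) cu,
    turnIntegral_linear hq' hw cn cyn, ← deriv_period_eq_turn hq' hw,
    turnIntegral_linear hq' hw cy c1, turnIntegral_one, turnIntegral_id] at h1
  have h6 : (q - 1) / 3 * area q w + -((q - 1) / 3) * period q w < 0 := by
    have := mul_pos (show 0 < (q - 1) / 3 by linarith) (sub_pos.2 hAP)
    linarith
  have h3 : (3 - q) * deriv (period q) w + (q - 1) * deriv (area q) w < 0 := by
    refine neg_of_mul_neg_right (a := w) ?_ hw.1.le
    linear_combination h1 + h6 + (q - 1) * h2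
  have h4 := mul_neg_of_pos_of_neg hP h3
  have h5 := mul_pos (mul_pos (show 0 < 3 - q by linarith) hS) (sub_pos.2 hAP)
  linarith

end Slope

/-! ### The orbits as functions of time -/

/-- The time at which the orbit of amplitude `w` reaches the phase `θ`. -/
noncomputable def orbitTime (q w θ : ℝ) : ℝ :=
  ∫ t in (-(Real.pi / 2))..θ, (√2)⁻¹ * profileDeriv q (w * Real.sin t)

/-- The phase of the orbit of amplitude `w` at a given time. -/
noncomputable def orbitPhase (q w : ℝ) : ℝ → ℝ := Function.invFun (orbitTime q w)

/-- The orbit of amplitude `w`, starting from its lowest height. -/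
noncomputable def orbit (q w x : ℝ) : ℝ := profile q (w * Real.sin (orbitPhase q w x))

/-- The velocity of the orbit of amplitude `w`. -/
noncomputable def orbitVel (q w x : ℝ) : ℝ := √2 * w * Real.cos (orbitPhase q w x)

section Orbit

variable {q w : ℝ}

lemma intervalIntegrable_timeElement (hq : -1 < q) (hw : w ∈ Ioc 0 (maxAmp q)) (a b : ℝ) :
    IntervalIntegrable (fun t => (√2)⁻¹ * profileDeriv q (w * Real.sin t)) volume a b :=
  intervalIntegrable_mul_profileDeriv hq hw continuous_const a b

lemma orbitTime_start : orbitTime q w (-(Real.pi / 2)) = 0 := intervalIntegral.integral_same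

lemma orbitTime_end : orbitTime q w (3 * Real.pi / 2) = period q w := rfl

lemma strictMono_orbitTime (hq : -1 < q) (hw : w ∈ Ioc 0 (maxAmp q)) :
    StrictMono (orbitTime q w) := by
  intro a b hab
  have h1 := intervalIntegral.intervalIntegral_pos_of_pos
    (intervalIntegrable_timeElement hq hw a b) (fun t => by
      have := profileDeriv_pos hq (w * Real.sin t); positivity) hab
  have h2 := intervalIntegral.integral_add_adjacent_intervals
    (intervalIntegrable_timeElement hq hw (-(Real.pi / 2)) a)
    (intervalIntegrable_timeElement hq hw a b)
  unfold orbitTime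
  linarith

lemma continuous_orbitTime (hq : -1 < q) (hw : w ∈ Ioc 0 (maxAmp q)) :
    Continuous (orbitTime q w) :=
  intervalIntegral.continuous_primitive (intervalIntegrable_timeElement hq hw) _

lemma orbitTime_add_two_pi (hq : -1 < q) (hw : w ∈ Ioc 0 (maxAmp q)) (θ : ℝ) :
    orbitTime q w (θ + 2 * Real.pi) = orbitTime q w θ + period q w := by
  have hper : Function.Periodic (fun t => (√2)⁻¹ * profileDeriv q (w * Real.sin t))
      (2 * Real.pi) := fun t => by simp only [Real.sin_add_two_pi]
  have h1 := hper.intervalIntegral_add_eq θ (-(Real.pi / 2))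
  rw [show -(Real.pi / 2) + 2 * Real.pi = 3 * Real.pi / 2 by ring] at h1
  have h2 := intervalIntegral.integral_add_adjacent_intervals
    (intervalIntegrable_timeElement hq hw (-(Real.pi / 2)) θ)
    (intervalIntegrable_timeElement hq hw θ (θ + 2 * Real.pi))
  unfold orbitTime period
  linarith

lemma orbitTime_add_nat_mul (hq : -1 < q) (hw : w ∈ Ioc 0 (maxAmp q)) (θ : ℝ) (n : ℕ) :
    orbitTime q w (θ + n * (2 * Real.pi)) = orbitTime q w θ + n * period q w := by
  induction n with
  | zero => simp
  | succ n ih =>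
    rw [show θ + ((n + 1 : ℕ) : ℝ) * (2 * Real.pi) = θ + n * (2 * Real.pi) + 2 * Real.pi by
      push_cast; ring, orbitTime_add_two_pi hq hw, ih]
    push_cast; ring

lemma surjective_orbitTime (hq : -1 < q) (hw : w ∈ Ioc 0 (maxAmp q)) :
    Function.Surjective (orbitTime q w) := by
  intro x
  have hP := period_pos hq hw
  obtain ⟨n, hn⟩ := exists_nat_gt (|x| / period q w)
  rw [div_lt_iff₀ hP] at hn
  have h1 := orbitTime_add_nat_mul hq hw (-(Real.pi / 2)) n
  have h2 := orbitTime_add_nat_mul hq hw (-(Real.pi / 2) - n * (2 * Real.pi)) n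
  rw [orbitTime_start] at h1
  rw [sub_add_cancel, orbitTime_start] at h2
  have h3 := neg_abs_le x
  have h4 := le_abs_self x
  exact mem_range_of_exists_le_of_exists_ge (continuous_orbitTime hq hw)
    ⟨-(Real.pi / 2) - n * (2 * Real.pi), by linarith⟩ ⟨-(Real.pi / 2) + n * (2 * Real.pi), by linarith⟩

lemma orbitTime_phase (hq : -1 < q) (hw : w ∈ Ioc 0 (maxAmp q)) (x : ℝ) :
    orbitTime q w (orbitPhase q w x) = x :=
  Function.rightInverse_invFun (surjective_orbitTime hq hw) x

lemma orbitPhase_time (hq : -1 < q) (hw : w ∈ Ioc 0 (maxAmp q)) (θ : ℝ) :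
    orbitPhase q w (orbitTime q w θ) = θ :=
  Function.leftInverse_invFun (strictMono_orbitTime hq hw).injective θ

lemma strictMono_orbitPhase (hq : -1 < q) (hw : w ∈ Ioc 0 (maxAmp q)) :
    StrictMono (orbitPhase q w) := by
  intro a b hab
  rwa [← (strictMono_orbitTime hq hw).lt_iff_lt, orbitTime_phase hq hw, orbitTime_phase hq hw]

lemma continuous_orbitPhase (hq : -1 < q) (hw : w ∈ Ioc 0 (maxAmp q)) :
    Continuous (orbitPhase q w) :=
  (strictMono_orbitPhase hq hw).monotone.continuous_of_surjective
    fun θ => ⟨_, orbitPhase_time hq hw θ⟩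

lemma orbitPhase_zero (hq : -1 < q) (hw : w ∈ Ioc 0 (maxAmp q)) :
    orbitPhase q w 0 = -(Real.pi / 2) := by
  rw [← orbitTime_start (q := q) (w := w), orbitPhase_time hq hw]

lemma orbitPhase_period (hq : -1 < q) (hw : w ∈ Ioc 0 (maxAmp q)) :
    orbitPhase q w (period q w) = 3 * Real.pi / 2 := by
  rw [← orbitTime_end, orbitPhase_time hq hw]

lemma orbitPhase_add_period (hq : -1 < q) (hw : w ∈ Ioc 0 (maxAmp q)) (x : ℝ) :
    orbitPhase q w (x + period q w) = orbitPhase q w x + 2 * Real.pi := by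
  apply (strictMono_orbitTime hq hw).injective
  rw [orbitTime_phase hq hw, orbitTime_add_two_pi hq hw, orbitTime_phase hq hw]

lemma orbitPhase_mem (hq : -1 < q) (hw : w ∈ Ioc 0 (maxAmp q)) {x : ℝ}
    (hx : x ∈ Ioo 0 (period q w)) :
    orbitPhase q w x ∈ Ioo (-(Real.pi / 2)) (3 * Real.pi / 2) := by
  rw [← orbitPhase_zero hq hw, ← orbitPhase_period hq hw]
  exact ⟨strictMono_orbitPhase hq hw hx.1, strictMono_orbitPhase hq hw hx.2⟩

lemma continuous_orbit (hq : -1 < q) (hw : w ∈ Ioc 0 (maxAmp q)) : Continuous (orbit q w) := by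
  have h1 := continuous_orbitPhase hq hw
  exact (continuous_profile hq).comp (by fun_prop)

lemma continuous_orbitVel (hq : -1 < q) (hw : w ∈ Ioc 0 (maxAmp q)) :
    Continuous (orbitVel q w) := by
  have h1 := continuous_orbitPhase hq hw
  unfold orbitVel
  fun_prop

lemma periodic_orbit (hq : -1 < q) (hw : w ∈ Ioc 0 (maxAmp q)) :
    Function.Periodic (orbit q w) (period q w) := fun x => by
  simp only [orbit, orbitPhase_add_period hq hw, Real.sin_add_two_pi]

lemma orbit_nonneg (hq : -1 < q) (hw : w ∈ Ioc 0 (maxAmp q)) (x : ℝ) : 0 ≤ orbit q w x :=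
  profile_nonneg hq (amp_mul_sin_mem hw _).1

lemma orbit_zero (hq : -1 < q) (hw : w ∈ Ioc 0 (maxAmp q)) : orbit q w 0 = profile q (-w) := by
  rw [orbit, orbitPhase_zero hq hw, sin_turn_start, mul_neg_one]

lemma orbitVel_zero (hq : -1 < q) (hw : w ∈ Ioc 0 (maxAmp q)) : orbitVel q w 0 = 0 := by
  rw [orbitVel, orbitPhase_zero hq hw, cos_turn_start, mul_zero]

lemma orbitVel_period (hq : -1 < q) (hw : w ∈ Ioc 0 (maxAmp q)) :
    orbitVel q w (period q w) = 0 := by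
  rw [orbitVel, orbitPhase_period hq hw, cos_turn_end, mul_zero]

/-- Conservation of energy along an orbit. -/
lemma orbit_energy (hq : -1 < q) (hw : w ∈ Ioc 0 (maxAmp q)) (x : ℝ) :
    orbitVel q w x ^ 2 / 2 + well q (orbit q w x) = w ^ 2 := by
  rw [orbitVel, orbit, well_profile hq (amp_mul_sin_mem hw _).1]
  have h1 := Real.sin_sq_add_cos_sq (orbitPhase q w x)
  have h2 : √2 ^ 2 = 2 := Real.sq_sqrt zero_le_two
  linear_combination w ^ 2 * h1 + w ^ 2 * Real.cos (orbitPhase q w x) ^ 2 / 2 * h2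

lemma hasDerivAt_orbitPhase (hq : -1 < q) (hw : w ∈ Ioc 0 (maxAmp q)) {x : ℝ}
    (hx : -maxAmp q < w * Real.sin (orbitPhase q w x)) :
    HasDerivAt (orbitPhase q w)
      (√2 / profileDeriv q (w * Real.sin (orbitPhase q w x))) x := by
  have hρ := profileDeriv_pos hq (w * Real.sin (orbitPhase q w x))
  have h1 : HasDerivAt (orbitTime q w)
      ((√2)⁻¹ * profileDeriv q (w * Real.sin (orbitPhase q w x))) (orbitPhase q w x) := by
    refine intervalIntegral.integral_hasDerivAt_right (intervalIntegrable_timeElement hq hw _ _)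
      ?_ ?_
    · exact (measurable_const.mul ((measurable_profileDeriv hq).comp
        (by fun_prop))).stronglyMeasurable.stronglyMeasurableAtFilter
    · exact continuousAt_const.mul (ContinuousAt.comp (f := fun t => w * Real.sin t)
        (continuousAt_profileDeriv hq hx) (by fun_prop))
  have h2 := HasDerivAt.of_local_left_inverse (continuous_orbitPhase hq hw).continuousAt h1
    (by positivity) (Eventually.of_forall (orbitTime_phase hq hw))
  refine h2.congr_deriv ?_
  rw [mul_inv, inv_inv, div_eq_mul_inv]

lemma hasDerivAt_orbit (hq : -1 < q) (hw : w ∈ Ioc 0 (maxAmp q)) {x : ℝ}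
    (hx : -maxAmp q < w * Real.sin (orbitPhase q w x)) :
    HasDerivAt (orbit q w) (orbitVel q w x) x := by
  have hρ := profileDeriv_pos hq (w * Real.sin (orbitPhase q w x))
  have h1 := (hasDerivAt_orbitPhase hq hw hx).sin.const_mul w
  have h2 := (hasDerivAt_profile hq hx).comp x h1
  refine h2.congr_deriv ?_
  unfold orbitVel
  field_simp

lemma hasDerivAt_orbitVel (hq : -1 < q) (hw : w ∈ Ioc 0 (maxAmp q)) {x : ℝ}
    (hx : -maxAmp q < w * Real.sin (orbitPhase q w x)) :
    HasDerivAt (orbitVel q w) (-canonicalForce q (orbit q w x)) x := by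
  have hρ := profileDeriv_pos hq (w * Real.sin (orbitPhase q w x))
  have h1 := (hasDerivAt_orbitPhase hq hw hx).cos.const_mul (√2 * w)
  refine h1.congr_deriv ?_
  have h2 := profileDeriv_mul_force hq hx
  have h3 : √2 ^ 2 = 2 := Real.sq_sqrt zero_le_two
  unfold orbit
  field_simp
  linear_combination h2 - w * Real.sin (orbitPhase q w x) * h3

lemma integral_orbitTime_comp (hq : -1 < q) (hw : w ∈ Ioc 0 (maxAmp q)) {F : ℝ → ℝ}
    (hF : Continuous F) :
    ∫ x in (0 : ℝ)..(period q w), F x = ∫ θ in (-(Real.pi / 2))..(3 * Real.pi / 2),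
      F (orbitTime q w θ) * ((√2)⁻¹ * profileDeriv q (w * Real.sin θ)) := by
  have hc := continuous_orbitTime hq hw
  have h1 := intervalIntegral.integral_comp_mul_deriv''' (a := -(Real.pi / 2))
    (b := 3 * Real.pi / 2) (f := orbitTime q w)
    (f' := fun θ => (√2)⁻¹ * profileDeriv q (w * Real.sin θ)) (g := F) hc.continuousOn
    (fun θ hθ => by
      rw [min_eq_left turn_le, max_eq_right turn_le] at hθ
      have hx := neg_lt_amp_mul_sin hw hθ
      refine HasDerivAt.hasDerivWithinAt ?_
      refine intervalIntegral.integral_hasDerivAt_right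
        (intervalIntegrable_timeElement hq hw _ _) ?_ ?_
      · exact (measurable_const.mul ((measurable_profileDeriv hq).comp
          (by fun_prop))).stronglyMeasurable.stronglyMeasurableAtFilter
      · exact continuousAt_const.mul (ContinuousAt.comp (f := fun t => w * Real.sin t)
          (continuousAt_profileDeriv hq hx) (by fun_prop)))
    hF.continuousOn
    (hF.continuousOn.integrableOn_compact (isCompact_uIcc.image hc))
    (by
      have h2 := (intervalIntegrable_timeElement hq hw (-(Real.pi / 2))
        (3 * Real.pi / 2)).continuousOn_mul (g := F ∘ orbitTime q w) (hF.comp hc).continuousOn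
      rw [intervalIntegrable_iff'] at h2
      exact h2)
  rw [orbitTime_start, orbitTime_end] at h1
  exact h1.symm

lemma integral_orbit (hq : -1 < q) (hw : w ∈ Ioc 0 (maxAmp q)) :
    ∫ x in (0 : ℝ)..(period q w), orbit q w x = area q w := by
  rw [integral_orbitTime_comp hq hw (continuous_orbit hq hw), area]
  refine intervalIntegral.integral_congr fun θ _ => ?_
  simp only [orbit, orbitPhase_time hq hw]
  ring

lemma integral_orbitVel_sq (hq : -1 < q) (hw : w ∈ Ioc 0 (maxAmp q)) :
    ∫ x in (0 : ℝ)..(period q w), orbitVel q w x ^ 2 = action q w := by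
  have hc : Continuous fun x => orbitVel q w x ^ 2 := (continuous_orbitVel hq hw).pow 2
  rw [integral_orbitTime_comp hq hw hc, action,
    ← intervalIntegral.integral_const_mul]
  refine intervalIntegral.integral_congr fun θ _ => ?_
  have h3 : √2 ^ 2 = 2 := Real.sq_sqrt zero_le_two
  simp only [orbitVel, orbitPhase_time hq hw]
  linear_combination w ^ 2 * Real.cos θ ^ 2 * (√2)⁻¹ * profileDeriv q (w * Real.sin θ) * h3

lemma integral_well_orbit (hq : -1 < q) (hw : w ∈ Ioc 0 (maxAmp q)) :
    ∫ x in (0 : ℝ)..(period q w), well q (orbit q w x) =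
      w ^ 2 * period q w - action q w / 2 := by
  have h1 : ∀ x, well q (orbit q w x) = w ^ 2 - 1 / 2 * orbitVel q w x ^ 2 := fun x => by
    linarith [orbit_energy hq hw x]
  simp only [h1]
  have hc : Continuous fun x => orbitVel q w x ^ 2 := (continuous_orbitVel hq hw).pow 2
  rw [intervalIntegral.integral_sub (by simp) ((hc.intervalIntegrable _ _).const_mul _),
    intervalIntegral.integral_const_mul, integral_orbitVel_sq hq hw]
  simp
  ring

/-- The lowest height is attained at time 0 and not again strictly inside one turn. -/
lemma isLeastPeriod_orbit (hq : -1 < q) (hw : w ∈ Ioo 0 (maxAmp q)) :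
    IsLeastPeriod (orbit q w) (period q w) := by
  have hw' : w ∈ Ioc 0 (maxAmp q) := ⟨hw.1, hw.2.le⟩
  refine ⟨⟨period_pos hq hw', periodic_orbit hq hw'⟩, fun T hT => ?_⟩
  by_contra h
  push Not at h
  have h1 := hT.2 0
  rw [zero_add, orbit_zero hq hw', orbit] at h1
  have h2 := (strictMono_profile hq).injective h1
  have h3 := neg_one_lt_sin (orbitPhase_mem hq hw' ⟨hT.1, h⟩)
  nlinarith [hw.1]

end Orbit

/-! ### Identification of the canonical solutions -/

section Canonical

variable {q α w : ℝ} {k k₁ k₂ : ℝ → ℝ}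

lemma IsCanonicalSolution.hasDerivAt (h : IsCanonicalSolution q α k) (x : ℝ) :
    HasDerivAt k (deriv k x) x :=
  (h.contDiff.differentiable (by norm_num)).differentiableAt.hasDerivAt

lemma IsCanonicalSolution.hasDerivAt_deriv (h : IsCanonicalSolution q α k) (x : ℝ) :
    HasDerivAt (deriv k) (-canonicalForce q (k x)) x := by
  have h1 : ContDiff ℝ 1 (deriv k) := by
    have := h.contDiff
    rw [show (2 : WithTop ℕ∞) = 1 + 1 by norm_num, contDiff_succ_iff_deriv] at this
    exact this.2.2
  have h2 := ((h1.differentiable (by norm_num)).differentiableAt (x := x)).hasDerivAt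
  rwa [show deriv (deriv k) x = -canonicalForce q (k x) by linarith [h.ode x]] at h2

lemma exists_lipschitz_force (q : ℝ) {c C : ℝ} (hc : 0 < c) :
    ∃ K, LipschitzOnWith K (fun p : ℝ × ℝ => (p.2, -canonicalForce q p.1))
      {p | p.1 ∈ Icc c C} := by
  have hcont : ContinuousOn (fun y : ℝ => y ^ (q - 1)) (Icc c C) := fun y hy =>
    (Real.continuousAt_rpow_const _ _ (Or.inl (hc.trans_le hy.1).ne')).continuousWithinAt
  obtain ⟨K, hK⟩ := isCompact_Icc.exists_bound_of_continuousOn hcont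
  have h1 : LipschitzOnWith K.toNNReal (canonicalForce q) (Icc c C) := by
    refine (convex_Icc c C).lipschitzOnWith_of_nnnorm_hasDerivWithin_le
      (fun y hy => (hasDerivAt_canonicalForce q (hc.trans_le hy.1)).hasDerivWithinAt)
      fun y hy => ?_
    rw [← NNReal.coe_le_coe, coe_nnnorm]
    exact (hK y hy).trans (Real.le_coe_toNNReal K)
  have h2 : LipschitzOnWith (K.toNNReal * 1) (fun p : ℝ × ℝ => canonicalForce q p.1)
      {p | p.1 ∈ Icc c C} :=
    h1.comp (LipschitzWith.prod_fst.lipschitzOnWith) fun p hp => hp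
  exact ⟨_, (LipschitzWith.prod_snd.lipschitzOnWith).prodMk h2.neg⟩

/-- On a bounded time interval both solutions stay in a compact part of `(0, ∞)`, where the force is
Lipschitz. Uniqueness identifies the chosen `kSol`, and later every positive periodic steady state,
with an orbit. -/
lemma IsCanonicalSolution.unique (h₁ : IsCanonicalSolution q α k₁)
    (h₂ : IsCanonicalSolution q α k₂) : k₁ = k₂ := by
  funext x
  set T := |x| + 1 with hT
  have hT0 : 0 < T := by positivity
  have hne : (Icc (-T) T).Nonempty := ⟨0, by linarith, hT0.le⟩
  have hc₁ : Continuous k₁ := h₁.contDiff.continuous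
  have hc₂ : Continuous k₂ := h₂.contDiff.continuous
  obtain ⟨a, -, ha⟩ := isCompact_Icc.exists_isMinOn hne (hc₁.min hc₂).continuousOn
  obtain ⟨b, -, hb⟩ := isCompact_Icc.exists_isMaxOn hne (hc₁.max hc₂).continuousOn
  have hpos : 0 < min (k₁ a) (k₂ a) := lt_min (h₁.pos a) (h₂.pos a)
  obtain ⟨K, hK⟩ := exists_lipschitz_force q (C := max (k₁ b) (k₂ b)) hpos
  have hsub : ∀ t ∈ Ioo (-T) T, t ∈ Icc (-T) T := fun t ht => ⟨ht.1.le, ht.2.le⟩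
  have hmem₁ : ∀ t ∈ Icc (-T) T, k₁ t ∈ Icc (min (k₁ a) (k₂ a)) (max (k₁ b) (k₂ b)) :=
    fun t ht => ⟨(ha ht).trans (min_le_left _ _), (le_max_left _ _).trans (hb ht)⟩
  have hmem₂ : ∀ t ∈ Icc (-T) T, k₂ t ∈ Icc (min (k₁ a) (k₂ a)) (max (k₁ b) (k₂ b)) :=
    fun t ht => ⟨(ha ht).trans (min_le_right _ _), (le_max_right _ _).trans (hb ht)⟩
  have hd : ∀ {k : ℝ → ℝ}, IsCanonicalSolution q α k → ∀ t,
      HasDerivAt (fun t => (k t, deriv k t)) (deriv k t, -canonicalForce q (k t)) t :=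
    fun h t => (h.hasDerivAt t).prodMk (h.hasDerivAt_deriv t)
  have heq := ODE_solution_unique_of_mem_Icc
    (v := fun _ p => (p.2, -canonicalForce q p.1))
    (s := fun _ => {p : ℝ × ℝ | p.1 ∈ Icc (min (k₁ a) (k₂ a)) (max (k₁ b) (k₂ b))})
    (f := fun t => (k₁ t, deriv k₁ t)) (g := fun t => (k₂ t, deriv k₂ t)) (t₀ := 0)
    (fun t _ => hK) ⟨by linarith, hT0⟩
    (fun t _ => (hd h₁ t).continuousAt.continuousWithinAt) (fun t _ => hd h₁ t)
    (fun t ht => hmem₁ t (hsub t ht))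
    (fun t _ => (hd h₂ t).continuousAt.continuousWithinAt) (fun t _ => hd h₂ t)
    (fun t ht => hmem₂ t (hsub t ht))
    (by simp only [h₁.init, h₂.init, h₁.init_deriv, h₂.init_deriv])
  have hx : x ∈ Icc (-T) T :=
    ⟨by linarith [neg_abs_le x], by linarith [le_abs_self x]⟩
  exact congrArg Prod.fst (heq hx)

lemma isCanonicalSolution_const (q : ℝ) : IsCanonicalSolution q 1 fun _ => 1 where
  contDiff := contDiff_const
  pos _ := one_pos
  ode x := by simp [canonicalForce_one]
  init := rfl
  init_deriv := by simp

lemma orbit_pos (hq : -1 < q) (hw : w ∈ Ioo 0 (maxAmp q)) (x : ℝ) : 0 < orbit q w x :=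
  profile_pos hq (neg_lt_amp_mul_sin' hw _)

lemma deriv_orbit (hq : -1 < q) (hw : w ∈ Ioo 0 (maxAmp q)) :
    deriv (orbit q w) = orbitVel q w :=
  funext fun _ => (hasDerivAt_orbit hq ⟨hw.1, hw.2.le⟩ (neg_lt_amp_mul_sin' hw _)).deriv

lemma isCanonicalSolution_orbit (hq : -1 < q) (hw : w ∈ Ioo 0 (maxAmp q)) :
    IsCanonicalSolution q (profile q (-w)) (orbit q w) := by
  have hw' : w ∈ Ioc 0 (maxAmp q) := ⟨hw.1, hw.2.le⟩
  have h1 : ∀ x, HasDerivAt (orbit q w) (orbitVel q w x) x := fun x =>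
    hasDerivAt_orbit hq hw' (neg_lt_amp_mul_sin' hw _)
  have h2 : ∀ x, HasDerivAt (orbitVel q w) (-canonicalForce q (orbit q w x)) x := fun x =>
    hasDerivAt_orbitVel hq hw' (neg_lt_amp_mul_sin' hw _)
  have h3 : deriv (orbitVel q w) = fun x => -canonicalForce q (orbit q w x) :=
    funext fun x => (h2 x).deriv
  refine ⟨?_, orbit_pos hq hw, fun x => ?_, orbit_zero hq hw', ?_⟩
  · rw [show (2 : WithTop ℕ∞) = 1 + 1 by norm_num, contDiff_succ_iff_deriv]
    refine ⟨fun x => (h1 x).differentiableAt, by simp, ?_⟩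
    rw [deriv_orbit hq hw, contDiff_one_iff_deriv, h3]
    refine ⟨fun x => (h2 x).differentiableAt, ?_⟩
    exact ((continuousOn_canonicalForce q).comp_continuous (continuous_orbit hq hw')
      (orbit_pos hq hw)).neg
  · rw [deriv_orbit hq hw, h3]; simp
  · rw [deriv_orbit hq hw, orbitVel_zero hq hw']

lemma kSol_eq_orbit (hq : -1 < q) (hw : w ∈ Ioo 0 (maxAmp q)) :
    kSol q (profile q (-w)) = orbit q w := by
  have h1 := isCanonicalSolution_orbit hq hw
  exact (Classical.epsilon_spec (p := IsCanonicalSolution q (profile q (-w))) ⟨_, h1⟩).unique h1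

lemma P_eq_period (hq : -1 < q) (hw : w ∈ Ioo 0 (maxAmp q)) :
    P q (profile q (-w)) = period q w := by
  rw [P, kSol_eq_orbit hq hw]
  exact (isLeastPeriod_orbit hq hw).csInf_eq

lemma A_eq_area (hq : -1 < q) (hw : w ∈ Ioo 0 (maxAmp q)) :
    A q (profile q (-w)) = area q w := by
  rw [A, kSol_eq_orbit hq hw, P_eq_period hq hw, integral_orbit hq ⟨hw.1, hw.2.le⟩]

/-- The minimum height `profile q (-w)` decreases as `w` grows, so the chain rule reverses the sign
of `E'`; the expression is the logarithmic derivative of `E` along `w`, up to the factor `P A`. -/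
lemma slope_neg_of_deriv_E_pos (hq : -1 < q) (hw : w ∈ Ioo 0 (maxAmp q))
    (hE : 0 < deriv (E q) (profile q (-w))) :
    (3 - q) * deriv (period q) w * area q w + (q - 1) * deriv (area q) w * period q w < 0 := by
  have hw' : w ∈ Ioc 0 (maxAmp q) := ⟨hw.1, hw.2.le⟩
  have hP := period_pos hq hw'
  have hA := area_pos hq hw'
  have h1 : HasDerivAt (E q) (deriv (E q) (profile q (-w))) (profile q (-w)) :=
    -- A nonzero `deriv` already entails differentiability, since its default value is 0.
    (differentiableAt_of_deriv_ne_zero hE.ne').hasDerivAt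
  have h2 : HasDerivAt (fun v => profile q (-v)) (profileDeriv q (-w) * -1) w :=
    (hasDerivAt_profile hq (neg_lt_neg hw.2)).comp w (hasDerivAt_neg w)
  have h3 := h1.comp w h2
  have h4 : HasDerivAt (fun v => period q v ^ (3 - q) * area q v ^ (q - 1))
      (deriv (E q) (profile q (-w)) * (profileDeriv q (-w) * -1)) w := by
    refine h3.congr_of_eventuallyEq ?_
    filter_upwards [Ioo_mem_nhds hw.1 hw.2] with v hv
    simp only [Function.comp_apply, E, P_eq_period hq hv, A_eq_area hq hv]
  have h5 := hasDerivAt_period hq hw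
  have h6 := hasDerivAt_area hq hw
  rw [← h5.deriv] at h5
  rw [← h6.deriv] at h6
  have h7 := (h5.rpow_const (p := 3 - q) (Or.inl hP.ne')).mul
    (h6.rpow_const (p := q - 1) (Or.inl hA.ne'))
  have h8 := h4.unique h7
  have h9 : deriv (E q) (profile q (-w)) * (profileDeriv q (-w) * -1) < 0 := by
    have := mul_pos hE (profileDeriv_pos hq (-w))
    linarith
  rw [h8, Real.rpow_sub_one hP.ne', Real.rpow_sub_one hA.ne' (q - 1)] at h9
  have hp1 := Real.rpow_pos_of_pos hP (3 - q)
  have hp2 := Real.rpow_pos_of_pos hA (q - 1)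
  refine neg_of_mul_neg_right (a := period q w ^ (3 - q) * area q w ^ (q - 1) /
    (period q w * area q w)) ?_ (by positivity)
  refine lt_of_eq_of_lt ?_ h9
  field_simp

lemma slope_neg (hcases : (-1 < q ∧ q < 1) ∨ (2 ≤ q ∧ q < 3) ∨
      ((1 < q ∧ q < 2) ∧ ∀ α ∈ Ioo (0 : ℝ) 1, 0 < deriv (E q) α))
    (hw : w ∈ Ioo 0 (maxAmp q)) :
    (3 - q) * deriv (period q) w * area q w + (q - 1) * deriv (area q) w * period q w < 0 := by
  rcases hcases with ⟨h1, h2⟩ | ⟨h1, h2⟩ | ⟨⟨h1, h2⟩, h3⟩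
  · rcases le_or_gt q 0 with h | h
    · exact slope_neg_of_nonpos h1 h hw
    · exact slope_neg_of_pos_of_lt_one h h2 hw
  · exact slope_neg_of_two_le h1 h2 hw
  · have hq : -1 < q := by linarith
    refine slope_neg_of_deriv_E_pos hq hw (h3 _ ⟨profile_pos hq (neg_lt_neg hw.2), ?_⟩)
    rw [← profile_zero hq]
    exact strictMono_profile hq (neg_neg_of_pos hw.1)

end Canonical

/-! ### Rescaling to a prescribed area -/

/-- The logarithm of the height scale that gives the orbit of amplitude `w` the area `a`. -/
noncomputable def logScale (q B a w : ℝ) : ℝ :=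
  2 / (3 - q) * (Real.log (√B * a) - Real.log (area q w))

/-- The spatial frequency that goes with the height scale `exp L`. -/
noncomputable def freq (q B L : ℝ) : ℝ := √B * Real.exp ((q - 1) / 2 * L)

/-- The length of the rescaled orbit. -/
noncomputable def scaledLength (q B a w : ℝ) : ℝ := period q w / freq q B (logScale q B a w)

/-- The energy of the rescaled orbit, up to an affine change of the potential. -/
noncomputable def scaledEnergy (q B a w : ℝ) : ℝ :=
  √B * Real.exp ((q + 3) / 2 * logScale q B a w) * (action q w - level q w * period q w) -
    B * a * canonicalForce q (Real.exp (logScale q B a w))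

section Scaling

variable {q B a w : ℝ}

lemma freq_pos (hB : 0 < B) (L : ℝ) : 0 < freq q B L :=
  mul_pos (Real.sqrt_pos.2 hB) (Real.exp_pos _)

lemma freq_sq (hB : 0 < B) (L : ℝ) : freq q B L ^ 2 = B * Real.exp L ^ (q - 1) := by
  rw [freq, mul_pow, Real.sq_sqrt hB.le, ← Real.exp_nat_mul, ← Real.exp_mul]
  congr 2
  push_cast; ring

lemma exp_logScale (hq : -1 < q) (hq3 : q < 3) (hB : 0 < B) (ha : 0 < a)
    (hw : w ∈ Ioc 0 (maxAmp q)) :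
    √B * a = area q w * Real.exp ((3 - q) / 2 * logScale q B a w) := by
  have h1 : 3 - q ≠ 0 := by linarith
  have hA := area_pos hq hw
  have hBa : 0 < √B * a := mul_pos (Real.sqrt_pos.2 hB) ha
  have h2 : (3 - q) / 2 * logScale q B a w = Real.log (√B * a) - Real.log (area q w) := by
    unfold logScale; field_simp
  rw [h2, Real.exp_sub, Real.exp_log hBa, Real.exp_log hA]
  field_simp

lemma scaled_area (hq : -1 < q) (hq3 : q < 3) (hB : 0 < B) (ha : 0 < a)
    (hw : w ∈ Ioc 0 (maxAmp q)) :
    Real.exp (logScale q B a w) * area q w / freq q B (logScale q B a w) = a := by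
  rw [div_eq_iff (freq_pos hB _).ne', freq]
  have h1 := exp_logScale hq hq3 hB ha hw
  have h2 : Real.exp (logScale q B a w) = Real.exp ((3 - q) / 2 * logScale q B a w) *
      Real.exp ((q - 1) / 2 * logScale q B a w) := by
    rw [← Real.exp_add]; congr 1; ring
  rw [h2]
  linear_combination (-Real.exp ((q - 1) / 2 * logScale q B a w)) * h1

lemma logScale_eq (hq : -1 < q) (hq3 : q < 3) (hB : 0 < B) {L : ℝ}
    (hw : w ∈ Ioc 0 (maxAmp q)) (ha : a = Real.exp L * area q w / freq q B L) :
    logScale q B a w = L := by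
  have h1 : 3 - q ≠ 0 := by linarith
  have hA := area_pos hq hw
  have hsB := Real.sqrt_pos.2 hB
  have h2 : √B * a = Real.exp ((3 - q) / 2 * L) * area q w := by
    have h3 : Real.exp L = Real.exp ((3 - q) / 2 * L) * Real.exp ((q - 1) / 2 * L) := by
      rw [← Real.exp_add]; congr 1; ring
    rw [ha, freq, h3]
    field_simp
  rw [logScale, h2, Real.log_mul (Real.exp_pos _).ne' hA.ne', Real.log_exp]
  field_simp
  ring

lemma hasDerivAt_logScale (hq : -1 < q) (hw : w ∈ Ioo 0 (maxAmp q)) :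
    HasDerivAt (logScale q B a) (-(2 / (3 - q)) * (deriv (area q) w / area q w)) w := by
  have hA := area_pos hq ⟨hw.1, hw.2.le⟩
  have h1 := hasDerivAt_area hq hw
  rw [← h1.deriv] at h1
  refine (((h1.log hA.ne').const_sub (Real.log (√B * a))).const_mul (2 / (3 - q))).congr_deriv ?_
  ring

lemma continuousOn_logScale (hq : -1 < q) :
    ContinuousOn (logScale q B a) (Ioc 0 (maxAmp q)) :=
  continuousOn_const.mul (continuousOn_const.sub
    ((continuousOn_area hq).log fun _ hw => ((area_pos hq hw).ne' :)))

/-- The slope of the period at fixed area. -/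
noncomputable def fixedAreaSlope (q w : ℝ) : ℝ :=
  deriv (period q) w + (q - 1) / (3 - q) * (period q w * (deriv (area q) w / area q w))

lemma fixedAreaSlope_neg (hq : -1 < q) (hq3 : q < 3) (hw : w ∈ Ioo 0 (maxAmp q))
    (h : (3 - q) * deriv (period q) w * area q w + (q - 1) * deriv (area q) w * period q w < 0) :
    fixedAreaSlope q w < 0 := by
  have hA := area_pos hq ⟨hw.1, hw.2.le⟩
  have h3 : 0 < 3 - q := by linarith
  refine neg_of_mul_neg_right (a := (3 - q) * area q w) ?_ (by positivity)
  refine lt_of_eq_of_lt ?_ h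
  unfold fixedAreaSlope
  field_simp

lemma hasDerivAt_scaledLength (hq : -1 < q) (hq3 : q < 3) (hB : 0 < B)
    (hw : w ∈ Ioo 0 (maxAmp q)) :
    HasDerivAt (scaledLength q B a)
      (fixedAreaSlope q w / freq q B (logScale q B a w)) w := by
  have h1 := hasDerivAt_period hq hw
  rw [← h1.deriv] at h1
  have hL := hasDerivAt_logScale (B := B) (a := a) hq hw
  have h2 : HasDerivAt (fun w => freq q B (logScale q B a w)) _ w :=
    ((hL.const_mul ((q - 1) / 2)).exp).const_mul (√B)
  have hf := freq_pos (q := q) hB (logScale q B a w)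
  have h3 : 3 - q ≠ 0 := by linarith
  have hA := area_pos hq ⟨hw.1, hw.2.le⟩
  refine (h1.div h2 hf.ne').congr_deriv ?_
  have h4 : √B * (Real.exp ((q - 1) / 2 * logScale q B a w) *
      ((q - 1) / 2 * (-(2 / (3 - q)) * (deriv (area q) w / area q w)))) =
      freq q B (logScale q B a w) *
        ((q - 1) / 2 * (-(2 / (3 - q)) * (deriv (area q) w / area q w))) := by
    unfold freq; ring
  rw [h4]
  unfold fixedAreaSlope
  field_simp
  ring

lemma hasDerivAt_level (q w : ℝ) : HasDerivAt (level q) (2 * w) w := by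
  have := ((hasDerivAt_id w).pow 2).sub_const (1 / (q + 1))
  exact this.congr_deriv (by simp)

/-- The terms `J'` and `level' P` cancel, both being `2 w P`. The area constraint (`h5`) and the
virial identity collect the terms carrying the derivative of the scale into a multiple of the level,
leaving the slope that also governs the length. -/
lemma hasDerivAt_scaledEnergy (hq : -1 < q) (hq3 : q < 3) (hB : 0 < B) (ha : 0 < a)
    (hw : w ∈ Ioo 0 (maxAmp q)) :
    HasDerivAt (scaledEnergy q B a)
      (-level q w * (√B * Real.exp ((q + 3) / 2 * logScale q B a w)) * fixedAreaSlope q w) w := by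
  have hw' : w ∈ Ioc 0 (maxAmp q) := ⟨hw.1, hw.2.le⟩
  have hA := area_pos hq hw'
  have h1 := hasDerivAt_period hq hw
  rw [← h1.deriv] at h1
  have hJ := hasDerivAt_action hq hw
  have hL := hasDerivAt_logScale (B := B) (a := a) hq hw
  have hl := hasDerivAt_level q w
  have hR : HasDerivAt (fun w => canonicalForce q (Real.exp (logScale q B a w))) _ w :=
    HasDerivAt.comp (h₂ := canonicalForce q) (h := fun w => Real.exp (logScale q B a w)) w
      (hasDerivAt_canonicalForce q (Real.exp_pos (logScale q B a w))) hL.exp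
  have h2 := ((((hL.const_mul ((q + 3) / 2)).exp).const_mul (√B)).mul (hJ.sub (hl.mul h1))).sub
    (hR.const_mul (B * a))
  refine h2.congr_deriv ?_
  have h3 : 3 - q ≠ 0 := by linarith
  have hsB : √B ^ 2 = B := Real.sq_sqrt hB.le
  have h5 : B * a * (Real.exp (logScale q B a w) ^ (q - 1) * Real.exp (logScale q B a w)) =
      √B * Real.exp ((q + 3) / 2 * logScale q B a w) * area q w := by
    have h6 := exp_logScale hq hq3 hB ha hw'
    have h7 : Real.exp ((q + 3) / 2 * logScale q B a w) =
        Real.exp ((3 - q) / 2 * logScale q B a w) *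
        (Real.exp (logScale q B a w) ^ (q - 1) * Real.exp (logScale q B a w)) := by
      rw [← Real.exp_mul, ← Real.exp_add, ← Real.exp_add]; congr 1; ring
    rw [h7]
    linear_combination √B * (Real.exp (logScale q B a w) ^ (q - 1) *
      Real.exp (logScale q B a w)) * h6 - a * (Real.exp (logScale q B a w) ^ (q - 1) *
      Real.exp (logScale q B a w)) * hsB
  have h8 := area_eq hq hw'
  simp only [Pi.sub_apply, Pi.mul_apply]
  unfold fixedAreaSlope
  set S := √B * Real.exp ((q + 3) / 2 * logScale q B a w)
  set d := deriv (area q) w / area q w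
  have h9 : 2 / (3 - q) * ((q - 1) / 2) = (q - 1) / (3 - q) := by field_simp
  linear_combination (2 / (3 - q) * d) * h5 + S * (2 / (3 - q)) * d * h8
    + S * level q w * period q w * d * h9

/-- Derivatives are available only inside the separatrix; continuity carries the monotonicity to the
closed endpoint `maxAmp q`, where the droplet sits. -/
lemma strictAntiOn_scaledLength (hq : -1 < q) (hq3 : q < 3) (hB : 0 < B)
    (h : ∀ w ∈ Ioo 0 (maxAmp q),
      (3 - q) * deriv (period q) w * area q w + (q - 1) * deriv (area q) w * period q w < 0) :
    StrictAntiOn (scaledLength q B a) (Ioc 0 (maxAmp q)) := by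
  apply strictAntiOn_of_deriv_neg (convex_Ioc _ _)
  · refine (continuousOn_period hq).div ?_ fun w _ => (freq_pos hB _).ne'
    exact continuousOn_const.mul
      (Real.continuous_exp.comp_continuousOn (continuousOn_const.mul (continuousOn_logScale hq)))
  · intro w hw
    rw [interior_Ioc] at hw
    rw [(hasDerivAt_scaledLength hq hq3 hB hw).deriv]
    exact div_neg_of_neg_of_pos (fixedAreaSlope_neg hq hq3 hw (h w hw)) (freq_pos hB _)

lemma strictAntiOn_scaledEnergy (hq : -1 < q) (hq3 : q < 3) (hB : 0 < B) (ha : 0 < a)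
    (h : ∀ w ∈ Ioo 0 (maxAmp q),
      (3 - q) * deriv (period q) w * area q w + (q - 1) * deriv (area q) w * period q w < 0) :
    StrictAntiOn (scaledEnergy q B a) (Ioc 0 (maxAmp q)) := by
  have hL := continuousOn_logScale (B := B) (a := a) hq
  apply strictAntiOn_of_deriv_neg (convex_Ioc _ _)
  · have h1 : ContinuousOn (level q) (Ioc 0 (maxAmp q)) := fun w _ =>
      (hasDerivAt_level q w).continuousAt.continuousWithinAt
    have h2 : ContinuousOn (fun w => canonicalForce q (Real.exp (logScale q B a w)))
        (Ioc 0 (maxAmp q)) :=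
      (continuousOn_canonicalForce q).comp (Real.continuous_exp.comp_continuousOn hL)
        fun w _ => Real.exp_pos _
    exact ((continuousOn_const.mul (Real.continuous_exp.comp_continuousOn
      (continuousOn_const.mul hL))).mul ((continuousOn_action hq).sub
      (h1.mul (continuousOn_period hq)))).sub (continuousOn_const.mul h2)
  · intro w hw
    rw [interior_Ioc] at hw
    rw [(hasDerivAt_scaledEnergy hq hq3 hB ha hw).deriv]
    have hl := level_neg hq hw
    have hs : 0 < √B * Real.exp ((q + 3) / 2 * logScale q B a w) :=
      mul_pos (Real.sqrt_pos.2 hB) (Real.exp_pos _)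
    exact mul_neg_of_pos_of_neg (mul_pos (by linarith) hs)
      (fixedAreaSlope_neg hq hq3 hw (h w hw))

end Scaling

/-! ### The energy of a rescaled orbit -/

section Energy

variable {q B w : ℝ} {H : ℝ → ℝ}

/-- Normalized to vanish at height 0, the well is homogeneous of degree `q + 1` up to a linear term,
which after integration depends only on the area. -/
lemma well_mul_sub (hq : -1 < q) {c y : ℝ} (hc : 0 < c) (hy : 0 ≤ y) :
    well q (c * y) - 1 / (q + 1) =
      c ^ (q + 1) * (well q y - 1 / (q + 1)) + c * y * canonicalForce q c := by
  have h0 : q + 1 ≠ 0 := by linarith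
  rcases hy.eq_or_lt with rfl | hy
  · simp [well_zero]
  have h1 := well_mul hq (c * y)
  have h2 := well_mul hq y
  have h3 := canonicalForce_mul q hc hy
  have h4 := rpow_eq_one_add_force q c
  have h5 : c ^ (q + 1) = c ^ q * c := Real.rpow_add_one hc.ne' q
  have h6 : (q + 1) * (1 / (q + 1)) = 1 := by field_simp
  apply mul_left_cancel₀ h0
  rw [h5]
  rw [h3] at h1
  linear_combination h1 - c ^ q * c * h2 - (1 - c ^ q * c) * h6 + c * y * h4

/-- Two energy potentials of the power law equation differ by an affine function. -/
lemma IsEnergyPotential.eq_well_add_affine {n m : ℝ} (hq : -1 < q) (hqm : q = m - n + 1)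
    (hH : IsEnergyPotential (powF n) (powG B m) H) :
    ∃ c₁ c₀ : ℝ, ∀ y, 0 ≤ y → H y = B * (well q y - 1 / (q + 1)) + c₁ * y + c₀ := by
  have hpre : IsPreconnected (Ioi (0 : ℝ)) := isPreconnected_Ioi
  have hH1 : ContDiffOn ℝ 1 (deriv H) (Ioi 0) :=
    hH.contDiffOn.deriv_of_isOpen isOpen_Ioi (by norm_num)
  have hd0 : ∀ y, 0 < y → HasDerivAt H (deriv H y) y := fun y hy =>
    ((hH.contDiffOn.differentiableOn (by norm_num)).differentiableAt
      (isOpen_Ioi.mem_nhds hy)).hasDerivAt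
  have hd1 : ∀ y, 0 < y → HasDerivAt (deriv H) (B * y ^ (q - 1)) y := fun y hy => by
    have h1 := ((hH1.differentiableOn (by norm_num)).differentiableAt
      (isOpen_Ioi.mem_nhds hy)).hasDerivAt
    rw [hH.deriv_deriv y hy, powF, powG, mul_div_assoc, ← Real.rpow_sub hy] at h1
    rwa [show q - 1 = m - n by linarith]
  obtain ⟨c₁, hc₁⟩ := isOpen_Ioi.exists_is_const_of_deriv_eq_zero hpre
    (f := fun y => deriv H y - B * canonicalForce q y)
    (fun y hy => ((hd1 y hy).sub
      ((hasDerivAt_canonicalForce q hy).const_mul B)).differentiableAt.differentiableWithinAt)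
    (fun y hy => by
      have := ((hd1 y hy).sub ((hasDerivAt_canonicalForce q hy).const_mul B)).deriv
      rw [sub_self] at this
      exact this)
  have hd2 : ∀ y, 0 < y → HasDerivAt (fun y => H y - B * well q y - c₁ * y) 0 y := fun y hy => by
    have h1 := ((hd0 y hy).sub ((hasDerivAt_well hq hy).const_mul B)).sub
      ((hasDerivAt_id y).const_mul c₁)
    refine h1.congr_deriv ?_
    linarith [hc₁ y hy]
  obtain ⟨c₀, hc₀⟩ := isOpen_Ioi.exists_is_const_of_deriv_eq_zero hpre
    (f := fun y => H y - B * well q y - c₁ * y)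
    (fun y hy => (hd2 y hy).differentiableAt.differentiableWithinAt)
    (fun y hy => (hd2 y hy).deriv)
  have hcont : ContinuousOn (fun y => H y - B * well q y - c₁ * y) (Ici 0) :=
    (hH.continuousOn.sub (continuousOn_const.mul (continuousOn_well hq))).sub (by fun_prop)
  have heq : EqOn (fun y => H y - B * well q y - c₁ * y) (fun _ => c₀) (Ici 0) := by
    have h1 : EqOn (fun y => H y - B * well q y - c₁ * y) (fun _ => c₀) (Ioi 0) :=
      fun y hy => hc₀ y hy
    refine h1.of_subset_closure hcont continuousOn_const Ioi_subset_Ici_self ?_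
    rw [closure_Ioi]
  refine ⟨c₁, c₀ + B * (1 / (q + 1)), fun y hy => ?_⟩
  have := heq hy
  simp only at this
  linarith

lemma integral_energy_orbit (hq : -1 < q) (hB : 0 < B) (hw : w ∈ Ioc 0 (maxAmp q)) {c₁ c₀ : ℝ}
    (hH : ∀ y, 0 ≤ y → H y = B * (well q y - 1 / (q + 1)) + c₁ * y + c₀) {L a : ℝ}
    (ha : a = Real.exp L * area q w / freq q B L) :
    ∫ x in (0 : ℝ)..(period q w / freq q B L),
      ((1 / 2) * (Real.exp L * freq q B L * orbitVel q w (freq q B L * x)) ^ 2 -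
        H (Real.exp L * orbit q w (freq q B L * x))) =
    √B * Real.exp ((q + 3) / 2 * L) * (action q w - level q w * period q w) -
      B * a * canonicalForce q (Real.exp L) - c₁ * a - c₀ * (period q w / freq q B L) := by
  set μ := freq q B L with hμ
  have hμ0 : 0 < μ := freq_pos hB L
  have hl0 := Real.exp_pos L
  have hμ2 : μ ^ 2 = B * Real.exp L ^ (q - 1) := freq_sq hB L
  have hpow : Real.exp L ^ (q + 1) = Real.exp L ^ (q - 1) * Real.exp L ^ 2 := by
    rw [← Real.rpow_natCast, ← Real.rpow_add hl0]; norm_num; ring_nf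
  have hS : √B * Real.exp ((q + 3) / 2 * L) = Real.exp L ^ 2 * μ := by
    rw [hμ, freq, ← Real.exp_nat_mul, mul_left_comm, ← Real.exp_add]
    congr 2; push_cast; ring
  set v := fun s => orbitVel q w s ^ 2
  set k := orbit q w
  have hk : ∀ s, 0 ≤ k s := orbit_nonneg hq hw
  have hvc : Continuous v := (continuous_orbitVel hq hw).pow 2
  have hkc : Continuous k := continuous_orbit hq hw
  have hwc : Continuous fun s => well q (k s) := (continuousOn_well hq).comp_continuous hkc hk
  set l := Real.exp L
  have hpt : ∀ s, (1 / 2) * (l * μ * orbitVel q w s) ^ 2 - H (l * k s) =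
      l ^ 2 * μ ^ 2 / 2 * v s - l ^ 2 * μ ^ 2 * well q (k s) -
        (B * canonicalForce q l + c₁) * l * k s + (l ^ 2 * μ ^ 2 / (q + 1) - c₀) := fun s => by
    rw [hH _ (mul_nonneg hl0.le (hk s)), well_mul_sub hq hl0 (hk s), hpow]
    simp only [v]
    linear_combination (l ^ 2 * well q (k s) - l ^ 2 * (1 / (q + 1))) * hμ2
  have hsub := intervalIntegral.integral_comp_mul_left (a := 0) (b := period q w / μ)
    (fun s => (1 / 2) * (l * μ * orbitVel q w s) ^ 2 - H (l * k s)) hμ0.ne'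
  rw [hsub, mul_zero, mul_div_cancel₀ _ hμ0.ne', smul_eq_mul]
  simp only [hpt]
  rw [intervalIntegral.integral_add, intervalIntegral.integral_sub, intervalIntegral.integral_sub,
    intervalIntegral.integral_const_mul, intervalIntegral.integral_const_mul,
    intervalIntegral.integral_const_mul, integral_orbitVel_sq hq hw, integral_orbit hq hw,
    integral_well_orbit hq hw, hS, ha, level]
  · simp only [intervalIntegral.integral_const, sub_zero, smul_eq_mul]
    field_simp
    ring
  all_goals exact Continuous.intervalIntegrable (by fun_prop) _ _

end Energy

/-! ### Droplets -/

lemma contDiffOn_canonicalForce (q : ℝ) : ContDiffOn ℝ 2 (canonicalForce q) (Ioi 0) := by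
  intro y hy
  have hy0 : y ≠ 0 := (mem_Ioi.1 hy).ne'
  refine ContDiffAt.contDiffWithinAt ?_
  rcases eq_or_ne q 0 with rfl | h
  · have : canonicalForce 0 = Real.log := funext fun y => by simp [canonicalForce]
    rw [this]
    exact Real.contDiffAt_log.2 hy0
  · have : canonicalForce q = fun y => (y ^ q - 1) / q := funext fun y => by
      simp [canonicalForce, h]
    rw [this]
    exact ((Real.contDiffAt_rpow_const (Or.inl hy0)).sub contDiffAt_const).div_const q

section SecondOrder

variable {q B D : ℝ} {s : Set ℝ} {h h₁ : ℝ → ℝ}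

lemma contDiffOn_succ_of_hasDerivAt (hs : IsOpen s) {k : ℕ} {f f' : ℝ → ℝ}
    (hf : ∀ x ∈ s, HasDerivAt f (f' x) x) (hf' : ContDiffOn ℝ k f' s) :
    ContDiffOn ℝ (k + 1) f s := by
  rw [contDiffOn_succ_iff_deriv_of_isOpen hs]
  exact ⟨fun x hx => (hf x hx).differentiableAt.differentiableWithinAt, by simp,
    hf'.congr fun x hx => (hf x hx).deriv⟩

/-- A bootstrap: each pass through the second-order equation gains two derivatives, so two passes
starting from continuity suffice. -/
lemma contDiffOn_of_ode (hs : IsOpen s) (hpos : ∀ x ∈ s, 0 < h x)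
    (hd : ∀ x ∈ s, HasDerivAt h (h₁ x) x)
    (hd₁ : ∀ x ∈ s, HasDerivAt h₁ (B * (D - canonicalForce q (h x))) x) :
    ContDiffOn ℝ 4 h s := by
  have hc : ContinuousOn h s := fun x hx => (hd x hx).continuousAt.continuousWithinAt
  have step : ∀ k : ℕ, (k : WithTop ℕ∞) ≤ 2 → ContDiffOn ℝ k h s →
      ContDiffOn ℝ ((k + 1 : ℕ) + 1) h s := fun k hk hh => by
    refine contDiffOn_succ_of_hasDerivAt hs hd ?_
    have := contDiffOn_succ_of_hasDerivAt hs hd₁ (contDiffOn_const.mul (contDiffOn_const.sub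
      (((contDiffOn_canonicalForce q).of_le hk).comp hh hpos)))
    exact_mod_cast this
  have h2 : ContDiffOn ℝ 2 h s := by
    have := step 0 (by simp) (contDiffOn_zero.2 hc)
    exact_mod_cast this
  have := step 2 le_rfl h2
  exact_mod_cast this

/-- Differentiating the second-order equation gives `h''' = -B h^(q-1) h'`; since `m = n + (q - 1)`,
the two fluxes cancel. -/
lemma evolutionRHS_of_ode {n m : ℝ} (hqm : q = m - n + 1) (hs : IsOpen s)
    (hpos : ∀ x ∈ s, 0 < h x) (hd : ∀ x ∈ s, HasDerivAt h (h₁ x) x)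
    (hd₁ : ∀ x ∈ s, HasDerivAt h₁ (B * (D - canonicalForce q (h x))) x) {x : ℝ} (hx : x ∈ s) :
    evolutionRHS (powF n) (powG B m) h x = 0 := by
  have e1 : ∀ x ∈ s, iteratedDeriv 1 h x = h₁ x := fun x hx => by
    rw [iteratedDeriv_one, (hd x hx).deriv]
  have e2 : ∀ x ∈ s, iteratedDeriv 2 h x = B * (D - canonicalForce q (h x)) := fun x hx => by
    rw [iteratedDeriv_succ, EventuallyEq.deriv_eq (f := h₁), (hd₁ x hx).deriv]
    filter_upwards [hs.mem_nhds hx] with y hy using e1 y hy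
  have e3 : ∀ x ∈ s, iteratedDeriv 3 h x = -(B * (h x ^ (q - 1) * h₁ x)) := fun x hx => by
    have h1 := (((hasDerivAt_canonicalForce q (hpos x hx)).comp x (hd x hx)).const_sub D).const_mul B
    rw [iteratedDeriv_succ, EventuallyEq.deriv_eq
      (f := fun y => B * (D - (canonicalForce q ∘ h) y)), h1.deriv]
    · ring
    · filter_upwards [hs.mem_nhds hx] with y hy using e2 y hy
  have hfg : (fun y => powF n (h y) * iteratedDeriv 3 h y) =ᶠ[𝓝 x]
      fun y => -(powG B m (h y) * deriv h y) := by
    filter_upwards [hs.mem_nhds hx] with y hy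
    rw [e3 y hy, (hd y hy).deriv, powF, powG, show m = n + (q - 1) by linarith,
      Real.rpow_add (hpos y hy)]
    ring
  rw [evolutionRHS, hfg.deriv_eq, deriv.fun_neg]
  ring

end SecondOrder

section Droplet

variable {q B w L : ℝ}

/-- At touchdown the chain rule through `profile` is not available, so the orbit is written as the
integral of its velocity, which is continuous up to the ends. -/
lemma hasDerivWithinAt_orbit (hq : -1 < q) (hw : w ∈ Ioc 0 (maxAmp q)) {x : ℝ}
    (hx : x ∈ Icc 0 (period q w)) :
    HasDerivWithinAt (orbit q w) (orbitVel q w x) (Icc 0 (period q w)) x := by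
  have hv := continuous_orbitVel hq hw
  have h1 : HasDerivAt (fun y => orbit q w 0 + ∫ t in (0 : ℝ)..y, orbitVel q w t)
      (orbitVel q w x) x :=
    (hv.integral_hasStrictDerivAt 0 x).hasDerivAt.const_add _
  have h2 : ∀ y ∈ Icc 0 (period q w),
      orbit q w y = orbit q w 0 + ∫ t in (0 : ℝ)..y, orbitVel q w t := fun y hy => by
    rw [intervalIntegral.integral_eq_sub_of_hasDerivAt_of_le hy.1
      (continuous_orbit hq hw).continuousOn (fun t ht => hasDerivAt_orbit hq hw
        (neg_lt_amp_mul_sin hw (orbitPhase_mem hq hw ⟨ht.1, ht.2.trans_le hy.2⟩)))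
      (hv.intervalIntegrable _ _)]
    ring
  exact h1.hasDerivWithinAt.congr h2 (h2 x hx)

lemma maxAmp_mem (hq : -1 < q) : maxAmp q ∈ Ioc 0 (maxAmp q) := ⟨maxAmp_pos hq, le_rfl⟩

/-- The length of the droplet with height scale `exp L`. -/
noncomputable def dropletLength (q B L : ℝ) : ℝ := period q (maxAmp q) / freq q B L

/-- The zero contact angle droplet with height scale `exp L`. -/
noncomputable def droplet (q B L : ℝ) : ℝ → ℝ :=
  (Ioo 0 (dropletLength q B L)).indicator
    fun x => Real.exp L * orbit q (maxAmp q) (freq q B L * x)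

lemma dropletLength_pos (hq : -1 < q) (hB : 0 < B) : 0 < dropletLength q B L :=
  div_pos (period_pos hq (maxAmp_mem hq)) (freq_pos hB L)

lemma droplet_of_mem_Icc (hq : -1 < q) (hB : 0 < B) {x : ℝ}
    (hx : x ∈ Icc 0 (dropletLength q B L)) :
    droplet q B L x = Real.exp L * orbit q (maxAmp q) (freq q B L * x) := by
  have h0 : orbit q (maxAmp q) 0 = 0 := by
    rw [orbit_zero hq (maxAmp_mem hq), profile_neg_maxAmp hq]
  by_cases h : x ∈ Ioo 0 (dropletLength q B L)
  · rw [droplet, indicator_of_mem h]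
  · rw [droplet, indicator_of_notMem h]
    rcases eq_endpoints_or_mem_Ioo_of_mem_Icc hx with rfl | rfl | h'
    · rw [mul_zero, h0, mul_zero]
    · have h1 := periodic_orbit hq (maxAmp_mem hq) 0
      rw [dropletLength, mul_div_cancel₀ _ (freq_pos hB L).ne', ← zero_add (period q _), h1, h0,
        mul_zero]
    · exact absurd h' h

lemma freq_mul_mem_Icc (hB : 0 < B) {x : ℝ} (hx : x ∈ Icc 0 (dropletLength q B L)) :
    freq q B L * x ∈ Icc 0 (period q (maxAmp q)) := by
  have h1 := freq_pos (q := q) hB L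
  refine ⟨mul_nonneg h1.le hx.1, ?_⟩
  have := hx.2
  rw [dropletLength, le_div_iff₀ h1] at this
  linarith

lemma freq_mul_mem_Ioo (hB : 0 < B) {x : ℝ} (hx : x ∈ Ioo 0 (dropletLength q B L)) :
    freq q B L * x ∈ Ioo 0 (period q (maxAmp q)) := by
  have h1 := freq_pos (q := q) hB L
  refine ⟨mul_pos h1 hx.1, ?_⟩
  have := hx.2
  rw [dropletLength, lt_div_iff₀ h1] at this
  linarith

lemma hasDerivWithinAt_droplet (hq : -1 < q) (hB : 0 < B) {x : ℝ}
    (hx : x ∈ Icc 0 (dropletLength q B L)) :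
    HasDerivWithinAt (droplet q B L)
      (Real.exp L * freq q B L * orbitVel q (maxAmp q) (freq q B L * x))
      (Icc 0 (dropletLength q B L)) x := by
  have h1 := HasDerivWithinAt.scomp x
    (hasDerivWithinAt_orbit hq (maxAmp_mem hq) (freq_mul_mem_Icc hB hx))
    ((hasDerivWithinAt_id x (Icc 0 (dropletLength q B L))).const_mul (freq q B L))
    fun y hy => freq_mul_mem_Icc hB hy
  refine ((h1.const_mul (Real.exp L)).congr (fun y hy => droplet_of_mem_Icc hq hB hy)
    (droplet_of_mem_Icc hq hB hx)).congr_deriv ?_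
  simp only [smul_eq_mul]; ring

lemma hasDerivAt_droplet (hq : -1 < q) (hB : 0 < B) {x : ℝ}
    (hx : x ∈ Ioo 0 (dropletLength q B L)) :
    HasDerivAt (droplet q B L)
      (Real.exp L * freq q B L * orbitVel q (maxAmp q) (freq q B L * x)) x :=
  (hasDerivWithinAt_droplet hq hB ⟨hx.1.le, hx.2.le⟩).hasDerivAt (Icc_mem_nhds hx.1 hx.2)

lemma droplet_pos (hq : -1 < q) (hB : 0 < B) {x : ℝ} (hx : x ∈ Ioo 0 (dropletLength q B L)) :
    0 < droplet q B L x := by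
  rw [droplet_of_mem_Icc hq hB ⟨hx.1.le, hx.2.le⟩]
  exact mul_pos (Real.exp_pos L) (profile_pos hq (neg_lt_amp_mul_sin (maxAmp_mem hq)
    (orbitPhase_mem hq (maxAmp_mem hq) (freq_mul_mem_Ioo hB hx))))

lemma hasDerivAt_droplet_slope (hq : -1 < q) (hB : 0 < B) {x : ℝ}
    (hx : x ∈ Ioo 0 (dropletLength q B L)) :
    HasDerivAt (fun x => Real.exp L * freq q B L * orbitVel q (maxAmp q) (freq q B L * x))
      (B * (canonicalForce q (Real.exp L) - canonicalForce q (droplet q B L x))) x := by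
  have hw := maxAmp_mem hq
  have hpos : 0 < orbit q (maxAmp q) (freq q B L * x) := by
    have := droplet_pos hq hB hx
    rw [droplet_of_mem_Icc hq hB ⟨hx.1.le, hx.2.le⟩] at this
    exact pos_of_mul_pos_right this (Real.exp_pos L).le
  have h1 := ((hasDerivAt_orbitVel hq hw (neg_lt_amp_mul_sin hw
    (orbitPhase_mem hq hw (freq_mul_mem_Ioo hB hx)))).comp x
      ((hasDerivAt_id x).const_mul (freq q B L))).const_mul (Real.exp L * freq q B L)
  refine h1.congr_deriv ?_
  rw [droplet_of_mem_Icc hq hB ⟨hx.1.le, hx.2.le⟩, canonicalForce_mul q (Real.exp_pos L) hpos]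
  have h2 := freq_sq (q := q) hB L
  have h3 : Real.exp L ^ q = Real.exp L ^ (q - 1) * Real.exp L := by
    rw [← Real.rpow_add_one (Real.exp_pos L).ne', sub_add_cancel]
  simp only [h3]
  linear_combination (-Real.exp L * canonicalForce q (orbit q (maxAmp q) (freq q B L * x))) * h2

lemma isZeroAngleDroplet_droplet {n m : ℝ} (hq : -1 < q) (hB : 0 < B) (hqm : q = m - n + 1) :
    IsZeroAngleDroplet (powF n) (powG B m) (droplet q B L) 0 (dropletLength q B L) := by
  have hX := dropletLength_pos (L := L) hq hB
  have hw := maxAmp_mem hq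
  have huniq := uniqueDiffOn_Icc hX
  have hd : ∀ x ∈ Icc 0 (dropletLength q B L), derivWithin (droplet q B L)
      (Icc 0 (dropletLength q B L)) x =
        Real.exp L * freq q B L * orbitVel q (maxAmp q) (freq q B L * x) := fun x hx =>
    (hasDerivWithinAt_droplet hq hB hx).derivWithin (huniq x hx)
  have hleft : derivWithin (droplet q B L) (Icc 0 (dropletLength q B L)) 0 = 0 := by
    rw [hd 0 ⟨le_rfl, hX.le⟩, mul_zero, orbitVel_zero hq hw, mul_zero]
  have hright : derivWithin (droplet q B L) (Icc 0 (dropletLength q B L))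
      (dropletLength q B L) = 0 := by
    rw [hd _ ⟨hX.le, le_rfl⟩]
    conv_lhs => rw [dropletLength, mul_div_cancel₀ _ (freq_pos hB L).ne', orbitVel_period hq hw]
    rw [mul_zero]
  have hv := continuous_orbitVel hq hw
  refine ⟨⟨hX, fun x hx => droplet_pos hq hB hx, fun x hx => indicator_of_notMem hx _, ?_,
    contDiffOn_of_ode isOpen_Ioo (fun x hx => droplet_pos hq hB hx)
      (fun x hx => hasDerivAt_droplet hq hB hx) fun x hx => hasDerivAt_droplet_slope hq hB hx,
    fun x hx => evolutionRHS_of_ode hqm isOpen_Ioo (fun x hx => droplet_pos hq hB hx)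
      (fun x hx => hasDerivAt_droplet hq hB hx) (fun x hx => hasDerivAt_droplet_slope hq hB hx) hx,
    hleft.ge, by rw [hleft, hright, neg_zero]⟩, hleft⟩
  rw [show (1 : WithTop ℕ∞) = 0 + 1 by norm_num, contDiffOn_succ_iff_derivWithin huniq]
  refine ⟨fun x hx => (hasDerivWithinAt_droplet hq hB hx).differentiableWithinAt, by simp, ?_⟩
  refine ContDiffOn.congr ?_ hd
  exact contDiffOn_zero.2 (by fun_prop)

lemma integral_droplet (hq : -1 < q) (hB : 0 < B) :
    ∫ x in (0 : ℝ)..(dropletLength q B L), droplet q B L x =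
      Real.exp L * area q (maxAmp q) / freq q B L := by
  have hμ := freq_pos (q := q) hB L
  have h1 : ∫ x in (0 : ℝ)..(dropletLength q B L), droplet q B L x =
      ∫ x in (0 : ℝ)..(dropletLength q B L),
        Real.exp L * orbit q (maxAmp q) (freq q B L * x) := by
    refine intervalIntegral.integral_congr fun x hx => ?_
    rw [uIcc_of_le (dropletLength_pos hq hB).le] at hx
    exact droplet_of_mem_Icc hq hB hx
  rw [h1, intervalIntegral.integral_const_mul,
    intervalIntegral.integral_comp_mul_left _ hμ.ne', mul_zero, dropletLength,
    mul_div_cancel₀ _ hμ.ne', integral_orbit hq (maxAmp_mem hq), smul_eq_mul]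
  ring

/-- The dry part of the interval contributes the constant `-H(0) = -c₀` per unit length, which
completes `-c₀` times the droplet length to `-c₀ X`. -/
lemma energy_droplet (hq : -1 < q) (hB : 0 < B) {H : ℝ → ℝ} {c₁ c₀ : ℝ}
    (hH : ∀ y, 0 ≤ y → H y = B * (well q y - 1 / (q + 1)) + c₁ * y + c₀) {a X : ℝ}
    (ha : a = Real.exp L * area q (maxAmp q) / freq q B L) (hX : dropletLength q B L ≤ X) :
    energy H X (droplet q B L) =
      √B * Real.exp ((q + 3) / 2 * L) *
          (action q (maxAmp q) - level q (maxAmp q) * period q (maxAmp q)) -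
        B * a * canonicalForce q (Real.exp L) - c₁ * a - c₀ * X := by
  have hw := maxAmp_mem hq
  have hX0 := dropletLength_pos (L := L) hq hB
  have hH0 : H 0 = c₀ := by rw [hH 0 le_rfl, well_zero]; ring
  have hv := continuous_orbitVel hq hw
  have hk := continuous_orbit hq hw
  have hin : ∀ x ∈ Ioo 0 (dropletLength q B L),
      (1 / 2) * (Real.exp L * freq q B L * orbitVel q (maxAmp q) (freq q B L * x)) ^ 2 -
        H (Real.exp L * orbit q (maxAmp q) (freq q B L * x)) =
      (1 / 2) * deriv (droplet q B L) x ^ 2 - H (droplet q B L x) := fun x hx => by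
    rw [(hasDerivAt_droplet hq hB hx).deriv, droplet_of_mem_Icc hq hB ⟨hx.1.le, hx.2.le⟩]
  have hout : ∀ x ∈ Ioo (dropletLength q B L) X,
      -c₀ = (1 / 2) * deriv (droplet q B L) x ^ 2 - H (droplet q B L x) := fun x hx => by
    have h0 : droplet q B L =ᶠ[𝓝 x] fun _ => 0 := by
      filter_upwards [Ioi_mem_nhds hx.1] with y hy
      exact indicator_of_notMem (fun h => lt_asymm h.2 hy) _
    rw [h0.deriv_eq, h0.eq_of_nhds, deriv_const, hH0]
    ring
  have hHc : Continuous fun x => H (Real.exp L * orbit q (maxAmp q) (freq q B L * x)) := by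
    have h1 : ContinuousOn H (Ici 0) := by
      refine ContinuousOn.congr (f := fun y => B * (well q y - 1 / (q + 1)) + c₁ * y + c₀) ?_
        fun y hy => hH y hy
      have := continuousOn_well hq
      fun_prop
    exact h1.comp_continuous (by fun_prop) fun x =>
      mul_nonneg (Real.exp_pos L).le (orbit_nonneg hq hw _)
  have hint1 : IntervalIntegrable (fun x => (1 / 2) * (Real.exp L * freq q B L *
      orbitVel q (maxAmp q) (freq q B L * x)) ^ 2 -
        H (Real.exp L * orbit q (maxAmp q) (freq q B L * x))) volume 0 (dropletLength q B L) :=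
    Continuous.intervalIntegrable (Continuous.sub (by fun_prop) hHc) _ _
  have hi1 : IntervalIntegrable (fun x => (1 / 2) * deriv (droplet q B L) x ^ 2 -
      H (droplet q B L x)) volume 0 (dropletLength q B L) :=
    hint1.congr_uIoo (by rw [uIoo_of_le hX0.le]; exact hin)
  have hi2 : IntervalIntegrable (fun x => (1 / 2) * deriv (droplet q B L) x ^ 2 -
      H (droplet q B L x)) volume (dropletLength q B L) X :=
    (intervalIntegrable_const (c := -c₀)).congr_uIoo (by rw [uIoo_of_le hX]; exact hout)
  rw [energy, ← intervalIntegral.integral_add_adjacent_intervals hi1 hi2,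
    ← intervalIntegral.integral_congr_Ioo_of_le hX0.le hin,
    ← intervalIntegral.integral_congr_Ioo_of_le hX hout, dropletLength,
    integral_energy_orbit hq hB hw hH ha]
  simp only [intervalIntegral.integral_const, smul_eq_mul]
  ring

end Droplet

/-! ### Positive periodic steady states -/

section SteadyState

variable {n m q B X : ℝ} {h : ℝ → ℝ}

lemma periodic_deriv {f : ℝ → ℝ} {T : ℝ} (hf : Function.Periodic f T) :
    Function.Periodic (deriv f) T := fun x => by
  rw [← deriv_comp_add_const, show (fun y => f (y + T)) = f from funext hf]

/-- Integrating the steady state equation twice. -/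
lemma IsPositivePeriodicSteadyState.exists_ode (hqm : q = m - n + 1)
    (hss : IsPositivePeriodicSteadyState (powF n) (powG B m) h X) :
    ∃ c, ∀ x, HasDerivAt (deriv h) (B * (canonicalForce q (h c) - canonicalForce q (h x))) x := by
  obtain ⟨hcd, hpos, -, ⟨⟨hX, hper⟩, -⟩, hst⟩ := hss
  have hc0 : ContDiff ℝ (3 + 1) h := by exact_mod_cast hcd
  have hc1 : ContDiff ℝ (2 + 1) (deriv h) := by
    have := (contDiff_succ_iff_deriv.1 hc0).2.2; exact_mod_cast this
  have hc2 : ContDiff ℝ (1 + 1) (deriv (deriv h)) := by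
    have := (contDiff_succ_iff_deriv.1 hc1).2.2; exact_mod_cast this
  have hc3 : ContDiff ℝ 1 (deriv (deriv (deriv h))) := (contDiff_succ_iff_deriv.1 hc2).2.2
  have e3 : iteratedDeriv 3 h = deriv (deriv (deriv h)) := by
    rw [iteratedDeriv_succ, iteratedDeriv_succ, iteratedDeriv_one]
  have hd0 : Differentiable ℝ h := hc0.differentiable (by norm_num)
  have hd1 : Differentiable ℝ (deriv h) := hc1.differentiable (by norm_num)
  have hd2 : Differentiable ℝ (deriv (deriv h)) := hc2.differentiable (by norm_num)
  have hd3 : Differentiable ℝ (deriv (deriv (deriv h))) := hc3.differentiable (by norm_num)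
  have hrp : ∀ p : ℝ, Differentiable ℝ fun y => h y ^ p := fun p x =>
    (hd0 x).rpow_const (Or.inl (hpos x).ne')
  have hF : Differentiable ℝ fun y => powF n (h y) * iteratedDeriv 3 h y := by
    rw [e3]; exact (hrp n).mul hd3
  have hG : Differentiable ℝ fun y => powG B m (h y) * deriv h y :=
    ((hrp m).const_mul B).mul hd1
  obtain ⟨C, hC⟩ : ∃ C, ∀ x,
      powF n (h x) * iteratedDeriv 3 h x + powG B m (h x) * deriv h x = C := by
    refine ⟨_, fun x => is_const_of_deriv_eq_zero (hF.add hG) (fun x => ?_) x 0⟩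
    have h1 := hst x
    rw [evolutionRHS] at h1
    rw [deriv_add (hF x) (hG x)]
    linarith
  have hK : ∀ x, HasDerivAt (fun y => deriv (deriv h) y + B * canonicalForce q (h y))
      (C * h x ^ (-n)) x := fun x => by
    have h1 := (hd2 x).hasDerivAt.add
      (((hasDerivAt_canonicalForce q (hpos x)).comp x (hd0 x).hasDerivAt).const_mul B)
    refine h1.congr_deriv ?_
    rw [← hC x, e3, powF, powG, show m = n + (q - 1) by linarith, Real.rpow_add (hpos x),
      Real.rpow_neg (hpos x).le]
    have := Real.rpow_pos_of_pos (hpos x) n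
    field_simp
  have hp1 := periodic_deriv hper
  have hp2 := periodic_deriv hp1
  -- The flux constant vanishes: the periodic function in `hK` has derivative `C h^(-n)`, which must
  -- be zero somewhere by Rolle, while `h^(-n)` is positive.
  have hC0 : C = 0 := by
    obtain ⟨c, -, hc⟩ := exists_hasDerivAt_eq_zero hX
      (fun x _ => (hK x).continuousAt.continuousWithinAt)
      (by rw [← zero_add X, hp2 0, hper 0]) (fun x _ => hK x)
    exact (mul_eq_zero.1 hc).resolve_right (Real.rpow_pos_of_pos (hpos c) _).ne'
  -- A zero of `h''` expresses the second integration constant as the force at the height `h c`,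
  -- which is therefore the equilibrium height.
  obtain ⟨c, -, hc⟩ := exists_hasDerivAt_eq_zero hX hd1.continuous.continuousOn
    (by rw [← zero_add X, hp1 0]) (fun x _ => (hd1 x).hasDerivAt)
  refine ⟨c, fun x => (hd1 x).hasDerivAt.congr_deriv ?_⟩
  have h1 := is_const_of_deriv_eq_zero (fun x => (hK x).differentiableAt)
    (fun x => by rw [(hK x).deriv, hC0, zero_mul]) x c
  simp only [hc] at h1
  linarith

/-- Every positive periodic steady state is a rescaled, translated orbit. -/
lemma IsPositivePeriodicSteadyState.exists_eq_orbit (hq : -1 < q) (hqm : q = m - n + 1)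
    (hB : 0 < B) (hss : IsPositivePeriodicSteadyState (powF n) (powG B m) h X) :
    ∃ w ∈ Ioo 0 (maxAmp q), ∃ L x₀, ∀ x,
      h (x + x₀) = Real.exp L * orbit q w (freq q B L * x) := by
  obtain ⟨c, hode⟩ := hss.exists_ode hqm
  obtain ⟨hcd, hpos, ⟨y₁, y₂, hne⟩, ⟨⟨hX, hper⟩, -⟩, -⟩ := hss
  -- Heights are measured in units of the equilibrium height, which moves it to 1.
  set L := Real.log (h c) with hL
  have hl : Real.exp L = h c := Real.exp_log (hpos c)
  set μ := freq q B L with hμd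
  have hμ : 0 < μ := freq_pos hB L
  have hμ2 : μ ^ 2 = B * h c ^ (q - 1) := by rw [hμd, freq_sq hB, hl]
  obtain ⟨x₀, -, hx₀⟩ := isCompact_Icc.exists_isMinOn ⟨0, le_rfl, hX.le⟩
    (hcd.continuous.continuousOn (s := Icc 0 X))
  have hmin : ∀ x, h x₀ ≤ h x := fun x => by
    obtain ⟨y, hy, hxy⟩ := hper.exists_mem_Ico₀ hX x
    rw [hxy]
    exact hx₀ ⟨hy.1, hy.2.le⟩
  have hd0 : ∀ x, HasDerivAt h (deriv h x) x := fun x =>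
    (hcd.differentiable (by norm_num) x).hasDerivAt
  set k : ℝ → ℝ := fun x => (h c)⁻¹ * h (x₀ + μ⁻¹ * x) with hk
  have hhc := hpos c
  have hin : ∀ x, HasDerivAt (fun x => x₀ + μ⁻¹ * x) μ⁻¹ x := fun x => by
    simpa using ((hasDerivAt_id x).const_mul μ⁻¹).const_add x₀
  have hk1 : ∀ x, HasDerivAt k ((h c)⁻¹ * (deriv h (x₀ + μ⁻¹ * x) * μ⁻¹)) x := fun x =>
    ((hd0 _).comp x (hin x)).const_mul _
  have hk1' : deriv k = fun x => (h c)⁻¹ * (deriv h (x₀ + μ⁻¹ * x) * μ⁻¹) :=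
    funext fun x => (hk1 x).deriv
  have hkpos : ∀ x, 0 < k x := fun x => mul_pos (inv_pos.2 hhc) (hpos _)
  have hhk : ∀ x, h (x₀ + μ⁻¹ * x) = h c * k x := fun x => by
    simp only [hk]; field_simp
  have hk2 : ∀ x, HasDerivAt (deriv k) (-canonicalForce q (k x)) x := fun x => by
    rw [hk1']
    refine ((((hode _).comp x (hin x)).mul_const μ⁻¹).const_mul (h c)⁻¹).congr_deriv ?_
    rw [hhk, canonicalForce_mul q hhc (hkpos x)]
    have h3 : h c ^ q = h c ^ (q - 1) * h c := by
      rw [← Real.rpow_add_one hhc.ne', sub_add_cancel]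
    rw [h3]
    field_simp
    rw [hμ2]
    ring
  have hcan : IsCanonicalSolution q ((h c)⁻¹ * h x₀) k := by
    refine ⟨?_, hkpos, fun x => by rw [(hk2 x).deriv]; ring, by simp [hk], ?_⟩
    · have : ContDiff ℝ 2 h := hcd.of_le (by norm_num)
      fun_prop
    · have : deriv h x₀ = 0 := IsLocalMin.deriv_eq_zero (Eventually.of_forall hmin)
      simp [hk1', this]
  set α := (h c)⁻¹ * h x₀ with hα
  have hα0 : 0 < α := mul_pos (inv_pos.2 hhc) (hpos _)
  -- The minimum is at most the equilibrium height; equality would make the solution constant by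
  -- uniqueness.
  have hα1 : α < 1 := by
    refine lt_of_le_of_ne ?_ fun h1 => hne ?_
    · rw [hα, inv_mul_le_iff₀ hhc, mul_one]; exact hmin c
    · rw [h1] at hcan
      have h2 := hcan.unique (isCanonicalSolution_const q)
      have h3 : ∀ y, h y = h c := fun y => by
        have h4 := hhk (μ * (y - x₀))
        rw [h2, inv_mul_cancel_left₀ hμ.ne', mul_one] at h4
        simpa using h4
      rw [h3, h3 y₂]
  have hr0 : signedRoot q α < 0 := by
    rw [← signedRoot_one]; exact strictMono_signedRoot hq hα1
  have hr1 : -maxAmp q < signedRoot q α := by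
    rw [← signedRoot_zero]; exact strictMono_signedRoot hq hα0
  -- The amplitude is read off from the minimum, since the orbit of amplitude `w` starts at `profile
  -- q (-w)`.
  have hw : -signedRoot q α ∈ Ioo 0 (maxAmp q) := ⟨by linarith, by linarith⟩
  have hcan' := isCanonicalSolution_orbit hq hw
  rw [neg_neg, profile_signedRoot hq] at hcan'
  refine ⟨_, hw, L, x₀, fun x => ?_⟩
  rw [← hcan.unique hcan', hl, ← hhk, inv_mul_cancel_left₀ hμ.ne', add_comm]

lemma isLeastPeriod_rescaled_orbit (hq : -1 < q) (hB : 0 < B) {w L x₀ : ℝ}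
    (hw : w ∈ Ioo 0 (maxAmp q))
    (hh : ∀ x, h (x + x₀) = Real.exp L * orbit q w (freq q B L * x)) :
    IsLeastPeriod h (period q w / freq q B L) := by
  have hw' : w ∈ Ioc 0 (maxAmp q) := ⟨hw.1, hw.2.le⟩
  have hμ := freq_pos (q := q) hB L
  have hP := isLeastPeriod_orbit hq hw
  have hh' : ∀ x, h x = Real.exp L * orbit q w (freq q B L * (x - x₀)) := fun x => by
    rw [← hh, sub_add_cancel]
  refine ⟨⟨div_pos (period_pos hq hw') hμ, fun x => ?_⟩, fun T hT => ?_⟩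
  · rw [hh', hh', ← periodic_orbit hq hw' (freq q B L * (x - x₀))]
    congr 2
    field_simp
    ring
  · rw [div_le_iff₀' hμ]
    refine hP.2 ⟨mul_pos hμ hT.1, fun s => ?_⟩
    have h1 := hT.2 ((freq q B L)⁻¹ * s + x₀)
    rw [add_right_comm, hh, hh, mul_add, mul_inv_cancel_left₀ hμ.ne'] at h1
    exact mul_left_cancel₀ (Real.exp_pos L).ne' h1

lemma integral_periodic_shift {f : ℝ → ℝ} {T : ℝ} (hf : Function.Periodic f T) (x₀ : ℝ) :
    ∫ x in (0 : ℝ)..T, f x = ∫ x in (0 : ℝ)..T, f (x + x₀) := by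
  rw [intervalIntegral.integral_comp_add_right, zero_add, add_comm T x₀,
    hf.intervalIntegral_add_eq x₀ 0, zero_add]

lemma integral_rescaled_orbit (hq : -1 < q) (hB : 0 < B) {w L x₀ : ℝ}
    (hw : w ∈ Ioo 0 (maxAmp q))
    (hh : ∀ x, h (x + x₀) = Real.exp L * orbit q w (freq q B L * x)) :
    ∫ x in (0 : ℝ)..(period q w / freq q B L), h x =
      Real.exp L * area q w / freq q B L := by
  have hμ := freq_pos (q := q) hB L
  rw [integral_periodic_shift (isLeastPeriod_rescaled_orbit hq hB hw hh).1.2 x₀]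
  simp only [hh]
  rw [intervalIntegral.integral_const_mul, intervalIntegral.integral_comp_mul_left _ hμ.ne',
    mul_zero, mul_div_cancel₀ _ hμ.ne', integral_orbit hq ⟨hw.1, hw.2.le⟩, smul_eq_mul]
  ring

lemma energy_rescaled_orbit (hq : -1 < q) (hB : 0 < B) {w L x₀ : ℝ}
    (hw : w ∈ Ioo 0 (maxAmp q))
    (hh : ∀ x, h (x + x₀) = Real.exp L * orbit q w (freq q B L * x))
    {H : ℝ → ℝ} {c₁ c₀ : ℝ}
    (hH : ∀ y, 0 ≤ y → H y = B * (well q y - 1 / (q + 1)) + c₁ * y + c₀) {a : ℝ}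
    (ha : a = Real.exp L * area q w / freq q B L) :
    energy H (period q w / freq q B L) h =
      √B * Real.exp ((q + 3) / 2 * L) * (action q w - level q w * period q w) -
        B * a * canonicalForce q (Real.exp L) - c₁ * a - c₀ * (period q w / freq q B L) := by
  have hw' : w ∈ Ioc 0 (maxAmp q) := ⟨hw.1, hw.2.le⟩
  have hper := (isLeastPeriod_rescaled_orbit hq hB hw hh).1.2
  have hd : ∀ x, deriv h (x + x₀) = Real.exp L * freq q B L * orbitVel q w (freq q B L * x) :=
    fun x => by
    rw [← deriv_comp_add_const, show (fun y => h (y + x₀)) = _ from funext hh]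
    have h1 := (hasDerivAt_orbit hq hw' (neg_lt_amp_mul_sin' hw
      (orbitPhase q w (freq q B L * x)))).comp x ((hasDerivAt_id x).const_mul (freq q B L))
    have h2 := (h1.const_mul (Real.exp L)).deriv
    simp only [Function.comp_def] at h2
    rw [h2]; ring
  rw [energy, integral_periodic_shift (x₀ := x₀), ← integral_energy_orbit hq hB hw' hH ha]
  · simp only [hd, hh]
  · intro x
    simp only [hper x, periodic_deriv hper x]

end SteadyState

end ThinFilm

open ThinFilm in
theorem mainTheorem2 (n m q B : ℝ) (hB : 0 < B) (hq : q = m - n + 1)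
    (hcases : (-1 < q ∧ q < 1) ∨ (2 ≤ q ∧ q < 3) ∨
      ((1 < q ∧ q < 2) ∧ ∀ α ∈ Set.Ioo (0 : ℝ) 1, 0 < deriv (ThinFilm.E q) α))
    (h : ℝ → ℝ) (X : ℝ)
    (hss : ThinFilm.IsPositivePeriodicSteadyState
      (ThinFilm.powF n) (ThinFilm.powG B m) h X) :
    ∃ (hhat : ℝ → ℝ) (Xhat : ℝ), 0 < Xhat ∧ Xhat < X ∧
      ThinFilm.IsZeroAngleDroplet (ThinFilm.powF n) (ThinFilm.powG B m) hhat 0 Xhat ∧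
      (∫ x in (0 : ℝ)..Xhat, hhat x) = (∫ x in (0 : ℝ)..X, h x) ∧
      ∀ H : ℝ → ℝ,
        ThinFilm.IsEnergyPotential (ThinFilm.powF n) (ThinFilm.powG B m) H →
          ThinFilm.energy H X hhat < ThinFilm.energy H X h := by
  have hq1 : -1 < q := by rcases hcases with h | h | h; exacts [h.1, by linarith, by linarith]
  have hq3 : q < 3 := by rcases hcases with h | h | h; exacts [by linarith, h.2, by linarith]
  have hslope := fun w hw => slope_neg (w := w) hcases hw
  obtain ⟨w, hw, L, x₀, hh⟩ := hss.exists_eq_orbit hq1 hq hB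
  have hw' : w ∈ Ioc 0 (maxAmp q) := ⟨hw.1, hw.2.le⟩
  have hmax := maxAmp_mem hq1
  obtain rfl : X = period q w / freq q B L :=
    hss.leastPeriod.unique (isLeastPeriod_rescaled_orbit hq1 hB hw hh)
  have harea := integral_rescaled_orbit hq1 hB hw hh
  set a := ∫ x in (0 : ℝ)..(period q w / freq q B L), h x
  have ha : 0 < a := by
    rw [harea]
    exact div_pos (mul_pos (Real.exp_pos L) (area_pos hq1 hw')) (freq_pos hB L)
  -- The given steady state is the member of amplitude `w` of the family of area `a`; the droplet is
  -- its member of amplitude `maxAmp q`.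
  have hL : logScale q B a w = L := logScale_eq hq1 hq3 hB hw' harea
  have hareaM := (scaled_area hq1 hq3 hB ha hmax).symm
  have hlen : dropletLength q B (logScale q B a (maxAmp q)) < period q w / freq q B L := by
    have := strictAntiOn_scaledLength (a := a) hq1 hq3 hB hslope hw' hmax hw.2
    rwa [scaledLength, scaledLength, hL] at this
  refine ⟨droplet q B (logScale q B a (maxAmp q)), dropletLength q B (logScale q B a (maxAmp q)),
    dropletLength_pos hq1 hB, hlen, isZeroAngleDroplet_droplet hq1 hB hq, ?_, fun H hH => ?_⟩
  · rw [integral_droplet hq1 hB, ← hareaM]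
  · obtain ⟨c₁, c₀, hH⟩ := hH.eq_well_add_affine hq1 hq
    -- Both energies carry the same affine contribution `-c₁ a - c₀ X`, so only the scaled energies
    -- are compared.
    rw [energy_droplet hq1 hB hH hareaM hlen.le, energy_rescaled_orbit hq1 hB hw hh hH harea]
    have := strictAntiOn_scaledEnergy hq1 hq3 hB ha hslope hw' hmax hw.2
    rw [scaledEnergy, scaledEnergy, hL] at this
    linarith
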